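/- Let $n\ge 1$, $N=2^n$, and let $H_z=\sum_{z\in\{0,1\}^n}E_z|z\rangle\langle z|$ be diagonal in the computational basis, with $M\ge 2$ distinct eigenvalues $0\le E_0<E_1<\dots<E_{M-1}\le 1$, where $E_k$ has degeneracy $d_k$. Put $\Delta=E_1-E_0$ and $A_r=\frac1N\sum_{k=1}^{M-1}\frac{d_k}{(E_k-E_0)^r}$, and suppose the spectral condition $\frac1\Delta\sqrt{\frac{d_0}{A_2N}}<c$ with $c=0.022$. Let $$H(s)=-(1-s)|\psi_0\rangle\langle\psi_0|+sH_z,\qquad |\psi_0\rangle=|+\rangle^{\otimes n},\quad s\in[0,1],$$ and let $g(s)$ be the difference of the two lowest eigenvalues of $H(s)$ restricted to its invariant subspace spanned by the uniform superpositions over the level sets $\{z: E_z=E_k\}$ (which contains $|\psi_0\rangle$). Put $$s^*=\tfrac{A_1}{A_1+1},\quad \delta_s=\tfrac{2}{(A_1+1)^2}\sqrt{\tfrac{d_0A_2}{N}},\quad g_{\min}=\tfrac{2A_1}{A_1+1}\sqrt{\tfrac{d_0}{A_2N}},\quad s_0=s^*-\frac{\frac14 g_{\min}(1-s^*)}{\frac{\Delta}{12}-\frac14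 g_{\min}},$$ $$g_0(s)=\begin{cases}\frac1{10}\frac{A_1}{A_2}\frac{s^*-s}{1-s^*}, & s<s^*-\delta_s,\\[2pt] \frac1{10}g_{\min}, & s^*-\delta_s\le s<s^*,\\[2pt] \frac{\Delta}{30}\frac{s-s_0}{1-s_0}, & s\ge s^*.\end{cases}$$ For every $p\in(1,2)$ there is a constant $C>0$, depending only on $p$, such that for all $n$ and $H_z$ as above the following holds. (a) $0<g_0(s)\le g(s)$ for all $s\in[0,1]$, and for every $\varepsilon\in(0,1)$ there is a time $$0<T\le C\cdot\frac1\varepsilon\cdot\frac{\sqrt{A_2}}{A_1^2\Delta^2}\cdot\sqrt{\frac{2^n}{d_0}}$$ and a monotone local, gap-adapted schedule $s:[0,T]\to[0,1]$ with $s(0)=0$, $s(T)=1$ and $s'(t)=v\,g_0(s(t))^p$ for some constant $v>0$, such that the solution of $i\,\psi'(t)=H(s(t))\psi(t)$, $\psi(0)=|\psi_0\rangle$, on $[0,T]$ satisfies $$|\langle v(1)|\psi(T)\rangle|^2\ge 1-\varepsilon,\qquad |v(1)\rangle=\frac1{\sqrt{d_0}}\sum_{z:\,E_z=E_0}|z\rangle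 .$$ (b) For Ising Hamiltonians with an inverse-polynomial gap the time is $\widetilde O(\frac1\varepsilon\sqrt{2^n/d_0})$, hence $\widetilde O(\frac1\varepsilon 2^{n/2})$, where $\widetilde O$ hides factors polynomial in $n$. Precisely: for every $m\in\mathbb N$ and every real polynomial $q$ there are $C'>0$ and $k\in\mathbb N$ (depending only on $p,m,q$) such that, if moreover $E_z=\alpha E^\sigma_z+\beta$ with $\alpha>0$, $\beta\in\mathbb R$ and $E^\sigma_z$ the eigenvalue on $|z\rangle$ of $\sum_{i<j}J_{ij}\sigma_z^i\sigma_z^j+\sum_jh_j\sigma_z^j$ for integers $J_{ij},h_j\in\{-m,\dots,m\}$, and if $q(n)\Delta\ge1$, then for every $\varepsilon\in(0,1)$ a time $T$ and a schedule as in (a) exist with $0<T\le C'\,\frac1\varepsilon\,n^k\sqrt{2^n/d_0}$. -/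

import Mathlib

open scoped Matrix ComplexConjugate

noncomputable section

namespace AQO

/-- Bit strings of length `n`; they label the computational basis of `n` qubits. -/
abbrev Bits (n : ℕ) : Type := Fin n → Bool

/-- The Hilbert space of `n` qubits, with its computational basis. -/
abbrev Qubits (n : ℕ) : Type := EuclideanSpace ℂ (Bits n)

/-- The state `|+⟩^{⊗ n}`: every qubit contributes the amplitude `1 / √2` to every basis state. -/
def plusState (n : ℕ) : Qubits n :=
  WithLp.toLp 2 fun _ => ∏ _i : Fin n, ((1 / √2 : ℝ) : ℂ)

section Spectrum

variable {n : ℕ} (E : Bits n → ℝ)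

/-- The problem Hamiltonian `H_z = ∑ z, E z |z⟩⟨z|`. -/
def problemMatrix : Matrix (Bits n) (Bits n) ℂ :=
  Matrix.diagonal fun z => (E z : ℂ)

/-- The adiabatic Hamiltonian `H(s) = -(1 - s) |ψ₀⟩⟨ψ₀| + s H_z`. -/
def adiabaticMatrix (s : ℝ) : Matrix (Bits n) (Bits n) ℂ :=
  -(((1 - s : ℝ) : ℂ) •
      Matrix.vecMulVec (fun z => plusState n z) (fun z => conj (plusState n z)))
    + ((s : ℝ) : ℂ) • problemMatrix E

/-- The adiabatic Hamiltonian as an operator. -/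
def adiabaticOp (s : ℝ) : Qubits n →ₗ[ℂ] Qubits n :=
  Matrix.toEuclideanLin (adiabaticMatrix E s)

/-- The finite set `{E₀, …, E_{M-1}}` of distinct eigenvalues of `H_z`. -/
def levels : Finset ℝ := Finset.univ.image E

/-- The degeneracy of the level `e`. -/
def degeneracy (e : ℝ) : ℕ := (Finset.univ.filter fun z => E z = e).card

/-- The ground energy `E₀`. -/
def groundEnergy : ℝ := sInf (levels E : Set ℝ)

/-- The levels `{E₁, …, E_{M-1}}`. -/
def excitedLevels : Finset ℝ := (levels E).erase (groundEnergy E)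

/-- The spectral gap `Δ = E₁ - E₀` of the problem Hamiltonian. -/
def problemGap : ℝ := sInf (excitedLevels E : Set ℝ) - groundEnergy E

/-- The degeneracy `d₀` of the ground level. -/
def groundDegeneracy : ℕ := degeneracy E (groundEnergy E)

/-- `A_p = (1 / N) ∑_{k ≥ 1} d_k / (E_k - E₀) ^ p` with `N = 2 ^ n`. -/
def spectralParam (p : ℕ) : ℝ :=
  (1 / (2 : ℝ) ^ n) *
    ∑ e ∈ excitedLevels E, (degeneracy E e : ℝ) / (e - groundEnergy E) ^ p

/-- The admissible problem Hamiltonians: eigenvalues in `[0, 1]`, at least two distinct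
eigenvalues (so that `Δ` makes sense), and the spectral condition with constant `c`. -/
structure IsProblemHamiltonian (c : ℝ) : Prop where
  energy_mem : ∀ z, E z ∈ Set.Icc (0 : ℝ) 1
  two_le_card_levels : 2 ≤ (levels E).card
  spectral_condition :
    (1 / problemGap E) *
      √((groundDegeneracy E : ℝ) / (spectralParam E 2 * (2 : ℝ) ^ n)) < c

/-- The uniform superposition of the basis states of energy `e`. -/
def levelState (e : ℝ) : Qubits n :=
  WithLp.toLp 2 fun z => if E z = e then ((1 / √(degeneracy E e : ℝ) : ℝ) : ℂ) else 0

/-- The uniform superposition of the ground states of `H_z`. -/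
def groundState : Qubits n := levelState E (groundEnergy E)

/-- The symmetric subspace, spanned by the uniform superpositions over the levels. It contains
`ψ₀`, and every `H(s)` leaves it invariant. -/
def symmetricSubspace : Submodule ℂ (Qubits n) :=
  Submodule.span ℂ (levelState E '' (levels E : Set ℝ))

/-- The eigenvalues of the restriction of `H(s)` to the symmetric subspace. -/
def symmetricSpectrum (s : ℝ) : Set ℝ :=
  {l | ∃ v ∈ symmetricSubspace E, v ≠ 0 ∧ adiabaticOp E s v = (l : ℂ) • v}

/-- The spectral gap `g(s)` of `H(s)` on the symmetric subspace: the difference of the two lowest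
eigenvalues. -/
def adiabaticGap (s : ℝ) : ℝ :=
  sInf (symmetricSpectrum E s \ {sInf (symmetricSpectrum E s)}) - sInf (symmetricSpectrum E s)

/-- The approximate position `s* = A₁ / (A₁ + 1)` of the avoided crossing. -/
def crossing : ℝ := spectralParam E 1 / (spectralParam E 1 + 1)

/-- The half-width `δ_s` of the window around the avoided crossing. -/
def crossingWidth : ℝ :=
  2 / (spectralParam E 1 + 1) ^ 2 *
    √((groundDegeneracy E : ℝ) * spectralParam E 2 / (2 : ℝ) ^ n)

/-- The minimal gap `g_min`, to leading order. -/
def minGap : ℝ :=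
  2 * spectralParam E 1 / (spectralParam E 1 + 1) *
    √((groundDegeneracy E : ℝ) / (spectralParam E 2 * (2 : ℝ) ^ n))

/-- The zero `s₀` of the line that bounds the gap to the right of the crossing: with `k = 1/4` and
`a = 4 k² Δ / 3 = Δ / 12`, it is `s* - k g_min (1 - s*) / (a - k g_min)`. -/
def rightZero : ℝ :=
  crossing E -
    (1 / 4) * minGap E * (1 - crossing E) / (problemGap E / 12 - (1 / 4) * minGap E)

/-- The continuous, piecewise linear lower bound `g₀(s)` on the gap, to which the schedule is
adapted. -/
def gapBound (s : ℝ) : ℝ :=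
  if s < crossing E - crossingWidth E then
    (1 / 10) * (spectralParam E 1 / spectralParam E 2) * ((crossing E - s) / (1 - crossing E))
  else if s < crossing E then
    (1 / 10) * minGap E
  else
    (problemGap E / 30) * ((s - rightZero E) / (1 - rightZero E))

/-- A local, gap-adapted schedule of duration `T`: a monotone `s : [0, T] → [0, 1]` from `0` to `1`
with speed `s'(t)` proportional to `g₀(s(t)) ^ p`. -/
structure IsGapAdaptedSchedule (p T : ℝ) (s : ℝ → ℝ) : Prop where
  start : s 0 = 0
  finish : s T = 1
  monotone : MonotoneOn s (Set.Icc 0 T)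
  speed : ∃ v : ℝ, 0 < v ∧ ∀ t ∈ Set.Icc 0 T,
    HasDerivWithinAt s (v * gapBound E (s t) ^ p) (Set.Icc 0 T) t

/-- `ψ` solves the Schrödinger equation `i ψ'(t) = H(s(t)) ψ(t)` on `[0, T]` with `ψ(0) = ψ₀`. -/
structure IsEvolution (T : ℝ) (s : ℝ → ℝ) (ψ : ℝ → Qubits n) : Prop where
  start : ψ 0 = plusState n
  schrodinger : ∀ t ∈ Set.Icc 0 T,
    HasDerivWithinAt ψ (-Complex.I • adiabaticOp E (s t) (ψ t)) (Set.Icc 0 T) t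

/-- Adiabatic evolution for time `T` along a gap-adapted schedule exists, and it ends in a state
whose fidelity with the uniform superposition of the ground states is at least `1 - ε`. -/
def PreparesGroundState (p ε T : ℝ) : Prop :=
  ∃ s : ℝ → ℝ, IsGapAdaptedSchedule E p T s ∧
    (∃ ψ : ℝ → Qubits n, IsEvolution E T s ψ) ∧
    ∀ ψ : ℝ → Qubits n, IsEvolution E T s ψ → 1 - ε ≤ ‖inner ℂ (groundState E) (ψ T)‖ ^ 2

end Spectrum

/-- The eigenvalue of `σ_z` on a bit. -/
def spin (b : Bool) : ℤ := if b then -1 else 1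

/-- The eigenvalue on `|z⟩` of `∑_{i < j} J_ij σ_z^i σ_z^j + ∑_j h_j σ_z^j`. -/
def isingEnergy {n : ℕ} (J : Fin n → Fin n → ℤ) (h : Fin n → ℤ) (z : Bits n) : ℤ :=
  (∑ i, ∑ j ∈ Finset.Ioi i, J i j * spin (z i) * spin (z j)) + ∑ j, h j * spin (z j)

/-- `E` is a rescaled and shifted Ising Hamiltonian with couplings and fields in `{-m, …, m}`. -/
def IsNormalizedIsing {n : ℕ} (m : ℕ) (E : Bits n → ℝ) : Prop :=
  ∃ (J : Fin n → Fin n → ℤ) (h : Fin n → ℤ) (α β : ℝ),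
    (∀ i j, |J i j| ≤ (m : ℤ)) ∧ (∀ j, |h j| ≤ (m : ℤ)) ∧ 0 < α ∧
    ∀ z, E z = α * (isingEnergy J h z : ℝ) + β

end AQO

end

/-!
Write `w = d₀ / N`, `r = s / (1 - s)`, and let `s (E₀ + μ)` be an eigenvalue of `H(s)` on the
symmetric subspace. As `H(s)` is diagonal up to a projector of rank one, the eigenvalues solve the
secular equation `r = -w / μ + (1 / N) ∑_{E z ≠ E₀} 1 / (E z - E₀ - μ)` (`secular_equation`). Exactly
one solution is negative.

*The gap.* The gap is `s (b + a)`, where `-a < 0 < b` are the two lowest solutions. To the left of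
the crossing `r = A₁`, Cauchy–Schwarz gives `A₁² ≤ r (A₁ + a A₂)`, and near the crossing one has
`w ≤ a² A₂`. To the right the equation for `b < Δ` gives
`(r - A₁ + w / b) (Δ - b) ≤ b A₂ Δ`. Each of these is a lower bound on `a` or `b` alone, and with the
spectral condition they imply `g₀ ≤ g` (`gapBound_le_adiabaticGap`).

*The adiabatic theorem.* The negative solution is `-1 / y`, with `s` an explicit increasing
function of `y`, so the inverse function theorem makes the ground vector `φ` and its energy `λ`
smooth on `(0, 1)`. The vector `χ` orthogonal to `φ` with `(H - λ) χ = φ'` is explicit too. By the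
Rayleigh principle the gap is a bound for the quadratic form of `H - λ` on the symmetric vectors
orthogonal to `φ`. Applied to the derivatives of `(H - λ) φ = 0` and of `(H - λ) χ = φ'`, it yields
`‖φ'‖ ≤ 4 / g`, `‖χ‖ ≤ 4 / g²` and `‖χ'‖ ≤ 80 / g³` (`norm_groundVector_bounds`). Integrating the
derivative of `|⟨φ, ψ⟩|²` by parts with the help of `χ` leaves boundary terms `s' ‖χ‖` and an
integral of second order in the speed `s'` (`sq_norm_inner_ge_of_adiabatic`). The speed has kinks
where `g₀` has them, so this is done on three intervals. The parameter `y` is infinite at `s = 1`, so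
the estimate is made on closed subintervals of `(0, 1)`, and the ends are reached as limits
(`fidelity_groundState_ge`).

*The time.* For the speed `s' = v g₀ ^ p` the loss of fidelity is of the order
`v ∫ g₀ ^ (p - 3)`, while the duration is `(1 / v) ∫ g₀ ^ (-p)`. For `1 < p < 2` both integrals are
dominated by the crossing, and are of the order `g_min ^ (p - 2) / (A₁ Δ)` and
`g_min ^ (1 - p) / (A₁ Δ)` (`integral_gapBound_rpow_le`), so that the loss times the duration is at
most a constant times `1 / (g_min A₁² Δ²)` (`loss_le`). This is the time in the theorem. The loss is
linear in `1 / T`, whence the factor `1 / ε`. With `1 / Δ` polynomial in `n` the remaining factors are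
polynomial, since `A₂ ≤ 1 / Δ²` and `A₁ ≥ 1 - w`.
-/

namespace AQO

open Filter Topology

variable {n : ℕ} {E : Bits n → ℝ}

/-! ### The spectrum of the problem Hamiltonian -/

/-- The basis states above the ground level. -/
noncomputable def excitedStates (E : Bits n → ℝ) : Finset (Bits n) :=
  Finset.univ.filter fun z => E z ≠ groundEnergy E

/-- The overlap `|⟨ψ₀|v(1)⟩|² = d₀ / 2 ^ n` of the initial state with the ground level. -/
noncomputable def groundWeight (E : Bits n → ℝ) : ℝ := (groundDegeneracy E : ℝ) / 2 ^ n

lemma mem_excitedStates {z : Bits n} : z ∈ excitedStates E ↔ E z ≠ groundEnergy E := by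
  simp [excitedStates]

lemma groundEnergy_mem_levels : groundEnergy E ∈ levels E :=
  Finset.Nonempty.csInf_mem ⟨E fun _ => false, by simp [levels]⟩

lemma groundEnergy_le (z : Bits n) : groundEnergy E ≤ E z :=
  csInf_le (Finset.bddBelow _) (by simp [levels])

lemma exists_eq_groundEnergy : ∃ z, E z = groundEnergy E := by
  simpa [levels] using groundEnergy_mem_levels (E := E)

lemma groundDegeneracy_pos : 0 < groundDegeneracy E := by
  obtain ⟨z, hz⟩ := exists_eq_groundEnergy (E := E)
  exact Finset.card_pos.2 ⟨z, by simp [hz]⟩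

lemma groundWeight_pos : 0 < groundWeight E := by
  have := groundDegeneracy_pos (E := E)
  unfold groundWeight
  positivity

lemma mem_excitedLevels {e : ℝ} :
    e ∈ excitedLevels E ↔ e ≠ groundEnergy E ∧ ∃ z, E z = e := by
  simp [excitedLevels, levels]

lemma spectralParam_eq (p : ℕ) :
    spectralParam E p = (1 / (2 : ℝ) ^ n) *
      ∑ z ∈ excitedStates E, 1 / (E z - groundEnergy E) ^ p := by
  unfold spectralParam
  congr 1
  rw [← Finset.sum_fiberwise_of_maps_to (t := excitedLevels E) (g := E)
    (fun z hz => mem_excitedLevels.2 ⟨mem_excitedStates.1 hz, z, rfl⟩)]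
  refine Finset.sum_congr rfl fun e he => ?_
  have hfil : (excitedStates E).filter (fun z => E z = e) =
      Finset.univ.filter fun z => E z = e := by
    ext z
    simp only [Finset.mem_filter, mem_excitedStates, Finset.mem_univ, true_and,
      and_iff_right_iff_imp]
    rintro rfl
    exact (mem_excitedLevels.1 he).1
  rw [hfil, Finset.sum_congr rfl (g := fun _ => 1 / (e - groundEnergy E) ^ p)
    (fun z hz => by rw [(Finset.mem_filter.1 hz).2])]
  simp [degeneracy, div_eq_mul_inv]

lemma card_excitedStates_add :
    ((excitedStates E).card : ℝ) + groundDegeneracy E = 2 ^ n := by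
  have h := Finset.card_filter_add_card_filter_not (s := (Finset.univ : Finset (Bits n)))
    (fun z => E z = groundEnergy E)
  have hc : (Finset.univ : Finset (Bits n)).card = 2 ^ n := by simp
  rw [hc] at h
  have h' : ((groundDegeneracy E + (excitedStates E).card : ℕ) : ℝ) = ((2 ^ n : ℕ) : ℝ) := by
    exact_mod_cast h
  push_cast at h'
  linarith

lemma sum_ground_add_sum_excited (f : Bits n → ℝ) :
    ∑ z, f z = ∑ z with E z = groundEnergy E, f z + ∑ z ∈ excitedStates E, f z :=
  (Finset.sum_filter_add_sum_filter_not Finset.univ (fun z => E z = groundEnergy E) f).symm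

lemma problemGap_le_sub {z : Bits n} (hz : z ∈ excitedStates E) :
    problemGap E ≤ E z - groundEnergy E :=
  sub_le_sub_right (csInf_le (Finset.bddBelow _)
    (mem_excitedLevels.2 ⟨mem_excitedStates.1 hz, z, rfl⟩)) _

lemma spectralParam_zero : spectralParam E 0 = 1 - groundWeight E := by
  have h := card_excitedStates_add (E := E)
  rw [spectralParam_eq, groundWeight]
  simp only [pow_zero, div_one, Finset.sum_const, nsmul_eq_mul, mul_one]
  field_simp
  linarith

namespace IsProblemHamiltonian

variable {c : ℝ}

lemma excitedLevels_nonempty (hE : IsProblemHamiltonian E c) : (excitedLevels E).Nonempty := by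
  have h := Finset.card_erase_of_mem (groundEnergy_mem_levels (E := E))
  have := hE.two_le_card_levels
  exact Finset.card_pos.1 (by unfold excitedLevels; omega)

lemma excitedStates_nonempty (hE : IsProblemHamiltonian E c) : (excitedStates E).Nonempty := by
  obtain ⟨e, he⟩ := hE.excitedLevels_nonempty
  obtain ⟨h, z, rfl⟩ := mem_excitedLevels.1 he
  exact ⟨z, mem_excitedStates.2 h⟩

lemma problemGap_pos (hE : IsProblemHamiltonian E c) : 0 < problemGap E := by
  obtain ⟨h, z, hz⟩ := mem_excitedLevels.1 hE.excitedLevels_nonempty.csInf_mem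
  have : groundEnergy E ≤ sInf (excitedLevels E : Set ℝ) := hz ▸ groundEnergy_le z
  exact sub_pos.2 (lt_of_le_of_ne this (Ne.symm h))

lemma sub_le_one (hE : IsProblemHamiltonian E c) (z : Bits n) : E z - groundEnergy E ≤ 1 := by
  obtain ⟨z₀, h₀⟩ := exists_eq_groundEnergy (E := E)
  have := (hE.energy_mem z₀).1
  have := (hE.energy_mem z).2
  linarith

lemma problemGap_le_one (hE : IsProblemHamiltonian E c) : problemGap E ≤ 1 := by
  obtain ⟨z, hz⟩ := hE.excitedStates_nonempty
  exact (problemGap_le_sub hz).trans (hE.sub_le_one z)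

lemma spectralParam_pos (hE : IsProblemHamiltonian E c) (p : ℕ) : 0 < spectralParam E p := by
  rw [spectralParam_eq]
  refine mul_pos (by positivity) (Finset.sum_pos (fun z hz => ?_) hE.excitedStates_nonempty)
  have := hE.problemGap_pos.trans_le (problemGap_le_sub hz)
  positivity

lemma spectralParam_le_succ (hE : IsProblemHamiltonian E c) (p : ℕ) :
    spectralParam E p ≤ spectralParam E (p + 1) := by
  rw [spectralParam_eq, spectralParam_eq]
  refine mul_le_mul_of_nonneg_left (Finset.sum_le_sum fun z hz => ?_) (by positivity)
  have h1 := hE.problemGap_pos.trans_le (problemGap_le_sub hz)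
  exact one_div_le_one_div_of_le (by positivity)
    (pow_le_pow_of_le_one h1.le (hE.sub_le_one z) (Nat.le_succ p))

lemma spectralParam_succ_mul_gap_le (hE : IsProblemHamiltonian E c) (p : ℕ) :
    spectralParam E (p + 1) * problemGap E ≤ spectralParam E p := by
  rw [spectralParam_eq, spectralParam_eq, mul_assoc, Finset.sum_mul]
  gcongr with z hz
  have h0 := problemGap_le_sub hz
  have h1 := hE.problemGap_pos.trans_le h0
  rw [pow_succ, div_mul_eq_mul_div, div_le_div_iff₀ (by positivity) (by positivity), one_mul,
    one_mul, mul_comm]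
  gcongr

/-- Cauchy–Schwarz; it bounds the slope of `g₀` on the left of the crossing. -/
lemma sq_spectralParam_one_le (hE : IsProblemHamiltonian E c) :
    spectralParam E 1 ^ 2 ≤ spectralParam E 2 := by
  have h := Finset.sum_mul_sq_le_sq_mul_sq (excitedStates E) (fun _ => (1 : ℝ))
    (fun z => 1 / (E z - groundEnergy E) ^ 1)
  have hcard := card_excitedStates_add (E := E)
  simp only [one_mul, one_pow, Finset.sum_const, nsmul_eq_mul, mul_one, div_pow, ← pow_mul] at h
  rw [spectralParam_eq, spectralParam_eq, mul_pow, one_div, inv_pow, inv_mul_le_iff₀ (by positivity)]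
  refine h.trans ?_
  rw [← mul_assoc]
  have : 0 ≤ ∑ z ∈ excitedStates E, 1 / (E z - groundEnergy E) ^ (1 * 2) :=
    Finset.sum_nonneg fun z hz =>
      have := hE.problemGap_pos.trans_le (problemGap_le_sub hz)
      by positivity
  simp only [one_mul] at this ⊢
  gcongr
  have : ((2 : ℝ) ^ n) ^ 2 * ((2 : ℝ) ^ n)⁻¹ = 2 ^ n := by field_simp
  rw [this]
  linarith

/-- `√(w / A₂) < c Δ`: the spectral condition in terms of the ground state overlap `w`. -/
lemma sqrt_weight_div_lt (hE : IsProblemHamiltonian E c) :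
    √(groundWeight E / spectralParam E 2) < c * problemGap E := by
  have h := hE.spectral_condition
  have hg := hE.problemGap_pos
  rw [one_div, inv_mul_lt_iff₀ hg] at h
  rw [groundWeight, div_div, mul_comm ((2 : ℝ) ^ n), mul_comm c]
  exact h

end IsProblemHamiltonian

/-- The square root `√(w / A₂)` of the overlap with the ground level, relative to `A₂`: it is the
half-width in energy of the avoided crossing. -/
noncomputable def crossingScale (E : Bits n → ℝ) : ℝ := √(groundWeight E / spectralParam E 2)

lemma minGap_eq : minGap E =
    2 * spectralParam E 1 / (spectralParam E 1 + 1) * crossingScale E := by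
  rw [minGap, crossingScale, groundWeight, div_div, mul_comm ((2 : ℝ) ^ n)]

namespace IsProblemHamiltonian

variable {c : ℝ}

lemma crossingScale_pos (hE : IsProblemHamiltonian E c) : 0 < crossingScale E :=
  Real.sqrt_pos.2 (div_pos groundWeight_pos (hE.spectralParam_pos 2))

lemma crossingScale_sq_mul (hE : IsProblemHamiltonian E c) :
    crossingScale E ^ 2 * spectralParam E 2 = groundWeight E := by
  have h2 := hE.spectralParam_pos 2
  rw [crossingScale, Real.sq_sqrt (div_pos groundWeight_pos h2).le]
  field_simp

lemma crossingWidth_eq (hE : IsProblemHamiltonian E c) : crossingWidth E =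
    2 / (spectralParam E 1 + 1) ^ 2 * (crossingScale E * spectralParam E 2) := by
  have h2 := hE.spectralParam_pos 2
  rw [crossingWidth]
  congr 1
  rw [Real.sqrt_eq_iff_mul_self_eq_of_pos (mul_pos hE.crossingScale_pos h2)]
  have := hE.crossingScale_sq_mul
  have h3 : (groundDegeneracy E : ℝ) * spectralParam E 2 / 2 ^ n
      = groundWeight E * spectralParam E 2 := by rw [groundWeight]; ring
  rw [h3, ← this]
  ring

/-- Under the spectral condition the ground level has a small overlap with the initial state, so
that the crossing does not lie much to the left of `1 / 2`. -/
lemma le_spectralParam_one (hE : IsProblemHamiltonian E (11 / 500)) :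
    999 / 1000 ≤ spectralParam E 1 := by
  have h1 := hE.spectralParam_le_succ 0
  rw [spectralParam_zero] at h1
  have h2 := hE.crossingScale_sq_mul
  have h3 : crossingScale E < 11 / 500 * problemGap E := hE.sqrt_weight_div_lt
  have h4 := hE.crossingScale_pos
  have h5 := hE.spectralParam_succ_mul_gap_le 0
  have h6 := hE.spectralParam_succ_mul_gap_le 1
  have hg := hE.problemGap_pos
  rw [spectralParam_zero] at h5
  have h7 : crossingScale E ^ 2 ≤ (11 / 500 * problemGap E) ^ 2 := by gcongr
  have h8 : spectralParam E 2 * problemGap E * problemGap E ≤ 1 - groundWeight E :=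
    (mul_le_mul_of_nonneg_right h6 hg.le).trans h5
  have h9 := mul_le_mul_of_nonneg_right h7 (hE.spectralParam_pos 2).le
  norm_num at h1
  nlinarith [groundWeight_pos (E := E)]

end IsProblemHamiltonian

/-! ### An adiabatic inequality -/

section Adiabatic

variable {F : Type*} [NormedAddCommGroup F] [InnerProductSpace ℂ F] [NormedSpace ℝ F]

open Complex in
/-- The adiabatic inequality. Along the evolution `ψ`, the fidelity with the instantaneous
eigenvector `φ` moves with speed `2 Re (⟨ψ, φ⟩ ⟨h φ', ψ⟩)`. As `φ' = (A - λ) χ`, this is, up to terms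
of second order in the speed `h`, the derivative of `2 Re (i h ⟨ψ, φ⟩ ⟨χ, ψ⟩)`, so only boundary
terms and the second order terms, dominated by `Φ'`, remain. Since `|⟨φ, ψ⟩|²` does not see the
phase of `ψ`, no dynamical phase enters. -/
theorem sq_norm_inner_ge_of_adiabatic {A : ℝ → F →ₗ[ℂ] F} {ψ φ φ' χ χ' : ℝ → F}
    {h h' lam Φ Φ' : ℝ → ℝ} {a b : ℝ} (hab : a ≤ b)
    (hA : ∀ t ∈ Set.Icc a b, (A t).IsSymmetric)
    (hψ : ∀ t ∈ Set.Icc a b, HasDerivWithinAt ψ (-I • A t (ψ t)) (Set.Icc a b) t)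
    (hφ : ∀ t ∈ Set.Icc a b, HasDerivWithinAt φ ((h t : ℂ) • φ' t) (Set.Icc a b) t)
    (hχ : ∀ t ∈ Set.Icc a b, HasDerivWithinAt χ ((h t : ℂ) • χ' t) (Set.Icc a b) t)
    (hh : ∀ t ∈ Set.Icc a b, HasDerivWithinAt h (h' t) (Set.Icc a b) t)
    (hΦ : ∀ t ∈ Set.Icc a b, HasDerivWithinAt Φ (Φ' t) (Set.Icc a b) t)
    (hAφ : ∀ t ∈ Set.Icc a b, A t (φ t) = (lam t : ℂ) • φ t)
    (hAχ : ∀ t ∈ Set.Icc a b, A t (χ t) = (lam t : ℂ) • χ t + φ' t)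
    (nψ : ∀ t ∈ Set.Icc a b, ‖ψ t‖ ≤ 1) (nφ : ∀ t ∈ Set.Icc a b, ‖φ t‖ ≤ 1)
    (h0 : ∀ t ∈ Set.Icc a b, 0 ≤ h t)
    (bound : ∀ t ∈ Set.Icc a b,
      |h' t| * ‖χ t‖ + h t ^ 2 * (‖χ' t‖ + ‖φ' t‖ * ‖χ t‖) ≤ Φ' t) :
    ‖inner ℂ (φ a) (ψ a)‖ ^ 2 - 2 * (h a * ‖χ a‖) - 2 * (h b * ‖χ b‖) - 2 * (Φ b - Φ a)
      ≤ ‖inner ℂ (φ b) (ψ b)‖ ^ 2 := by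
  set f : ℝ → ℂ := fun t => (h t : ℂ) * (inner ℂ (ψ t) (φ t) * inner ℂ (χ t) (ψ t)) with hf
  set m : ℝ → ℂ := fun t => inner ℂ (ψ t) (φ t) * inner ℂ (φ t) (ψ t) - 2 * I * f t with hm
  set M : ℝ → ℝ := fun t => (m t).re + 2 * Φ t with hM
  set D : ℝ → ℂ := fun t =>
    (inner ℂ (ψ t) ((h t : ℂ) • φ' t) + inner ℂ (-I • A t (ψ t)) (φ t)) * inner ℂ (φ t) (ψ t)
      + inner ℂ (ψ t) (φ t) *
        (inner ℂ (φ t) (-I • A t (ψ t)) + inner ℂ ((h t : ℂ) • φ' t) (ψ t))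
      - 2 * I * ((h' t : ℂ) * (inner ℂ (ψ t) (φ t) * inner ℂ (χ t) (ψ t))
        + (h t : ℂ) * (
          (inner ℂ (ψ t) ((h t : ℂ) • φ' t) + inner ℂ (-I • A t (ψ t)) (φ t))
              * inner ℂ (χ t) (ψ t)
          + inner ℂ (ψ t) (φ t) *
            (inner ℂ (χ t) (-I • A t (ψ t)) + inner ℂ ((h t : ℂ) • χ' t) (ψ t)))) with hD
  have hm' : ∀ t ∈ Set.Icc a b, HasDerivWithinAt m (D t) (Set.Icc a b) t := by
    intro t ht
    have e1 := (hψ t ht).inner ℂ (hφ t ht)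
    have e2 := (hφ t ht).inner ℂ (hψ t ht)
    have e3 := (hχ t ht).inner ℂ (hψ t ht)
    have e4 : HasDerivWithinAt (fun t => (h t : ℂ)) (h' t : ℂ) (Set.Icc a b) t :=
      (hh t ht).ofReal_comp
    exact (e1.mul e2).sub ((e4.mul (e1.mul e3)).const_mul (2 * I))
  have hM' : ∀ t ∈ Set.Icc a b,
      HasDerivWithinAt M ((D t).re + 2 * Φ' t) (Set.Icc a b) t := fun t ht =>
    (reCLM.hasFDerivAt.comp_hasDerivWithinAt t (hm' t ht)).add ((hΦ t ht).const_mul 2)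
  have key : ∀ t ∈ Set.Icc a b, 0 ≤ (D t).re + 2 * Φ' t := by
    intro t ht
    set p := inner ℂ (φ' t) (ψ t) with hp
    set x := inner ℂ (χ' t) (ψ t) with hx
    set X := inner ℂ (χ t) (ψ t) with hX
    set P := inner ℂ (φ t) (ψ t) with hP
    have i1 : inner ℂ (ψ t) (φ t) = conj P := (inner_conj_symm _ _).symm
    have i2 : inner ℂ (ψ t) (φ' t) = conj p := (inner_conj_symm _ _).symm
    have i3 : inner ℂ (φ t) (A t (ψ t)) = lam t * P := by
      rw [← hA t ht, hAφ t ht, inner_smul_left, conj_ofReal]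
    have i4 : inner ℂ (A t (ψ t)) (φ t) = lam t * conj P := by
      rw [hA t ht, hAφ t ht, inner_smul_right, i1]
    have i5 : inner ℂ (χ t) (A t (ψ t)) = lam t * X + p := by
      rw [← hA t ht, hAχ t ht, inner_add_left, inner_smul_left, conj_ofReal]
    have hDt : D t = (h t : ℂ) * (conj p * P + conj P * p) - 2 * ((h t : ℂ) * (conj P * p))
        - 2 * I * ((h' t : ℂ) * (conj P * X) + (h t : ℂ) ^ 2 * (conj p * X + conj P * x)) := by
      simp only [hD, inner_smul_left, inner_smul_right, i1, i2, i3, i4, i5, conj_ofReal, map_neg,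
        conj_I, ← hp, ← hx, ← hX, ← hP]
      ring_nf
      simp only [I_sq]
      ring
    set q : ℂ := (h' t : ℂ) * (conj P * X) + (h t : ℂ) ^ 2 * (conj p * X + conj P * x) with hq
    have hre : (D t).re = -2 * (I * q).re := by
      rw [hDt, mul_assoc 2 I q]
      simp only [sub_re, add_re, mul_re, conj_re, conj_im, ofReal_re, ofReal_im, re_ofNat, im_ofNat]
      ring
    have nP : ‖P‖ ≤ 1 := (norm_inner_le_norm _ _).trans
      (mul_le_one₀ (nφ t ht) (norm_nonneg _) (nψ t ht))
    have bd : ∀ v : F, ‖inner ℂ v (ψ t)‖ ≤ ‖v‖ := fun v => (norm_inner_le_norm _ _).trans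
      (mul_le_of_le_one_right (norm_nonneg _) (nψ t ht))
    have nq : ‖q‖ ≤ Φ' t := by
      refine le_trans ?_ (bound t ht)
      refine (norm_add_le _ _).trans (add_le_add ?_ ?_)
      · rw [norm_mul, norm_mul, norm_real, Real.norm_eq_abs, RCLike.norm_conj]
        refine mul_le_mul_of_nonneg_left ?_ (abs_nonneg _)
        exact (mul_le_of_le_one_left (norm_nonneg _) nP).trans (bd _)
      · rw [norm_mul, norm_pow, norm_real, Real.norm_eq_abs, sq_abs]
        refine mul_le_mul_of_nonneg_left ?_ (sq_nonneg _)
        refine (norm_add_le _ _).trans ?_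
        rw [norm_mul, norm_mul, RCLike.norm_conj, RCLike.norm_conj, add_comm]
        refine add_le_add ((mul_le_of_le_one_left (norm_nonneg _) nP).trans (bd _)) ?_
        exact mul_le_mul (bd _) (bd _) (norm_nonneg _) (norm_nonneg _)
    have : (I * q).re ≤ ‖q‖ := (re_le_norm _).trans (by simp)
    rw [hre]
    linarith
  have mono : MonotoneOn M (Set.Icc a b) := by
    refine monotoneOn_of_hasDerivWithinAt_nonneg (f' := fun t => (D t).re + 2 * Φ' t)
      (convex_Icc a b) (fun t ht => (hM' t ht).continuousWithinAt) (fun t ht => ?_)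
      fun t ht => key t (interior_subset ht)
    exact (hM' t (interior_subset ht)).mono interior_subset
  have hab' := mono ⟨le_rfl, hab⟩ ⟨hab, le_rfl⟩ hab
  have hMt : ∀ t, M t = ‖inner ℂ (φ t) (ψ t)‖ ^ 2 - 2 * (I * f t).re + 2 * Φ t := by
    intro t
    simp only [hM, hm]
    rw [sub_re, mul_assoc 2 I, ← inner_conj_symm (ψ t) (φ t), ← Complex.normSq_eq_conj_mul_self,
      ofReal_re, Complex.normSq_eq_norm_sq]
    simp
  have nf : ∀ t ∈ Set.Icc a b, |(I * f t).re| ≤ h t * ‖χ t‖ := by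
    intro t ht
    refine (abs_re_le_norm _).trans ?_
    rw [norm_mul, norm_I, one_mul, hf, norm_mul, norm_mul, norm_real, Real.norm_eq_abs,
      abs_of_nonneg (h0 t ht)]
    refine mul_le_mul_of_nonneg_left ?_ (h0 t ht)
    have n1 : ‖inner ℂ (ψ t) (φ t)‖ ≤ 1 := (norm_inner_le_norm _ _).trans
      (mul_le_one₀ (nψ t ht) (norm_nonneg _) (nφ t ht))
    have n2 : ‖inner ℂ (χ t) (ψ t)‖ ≤ ‖χ t‖ := (norm_inner_le_norm _ _).trans
      (mul_le_of_le_one_right (norm_nonneg _) (nψ t ht))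
    exact (mul_le_of_le_one_left (norm_nonneg _) n1).trans n2
  rw [hMt, hMt] at hab'
  have h1 := abs_le.1 (nf a ⟨le_rfl, hab⟩)
  have h2 := abs_le.1 (nf b ⟨hab, le_rfl⟩)
  linarith [h1.1, h1.2, h2.1, h2.2]

/-- A Schrödinger evolution preserves the norm. -/
lemma norm_eq_of_schrodinger {A : ℝ → F →ₗ[ℂ] F} {ψ : ℝ → F} {c : ℝ → ℝ} {T : ℝ}
    (hA : ∀ t ∈ Set.Icc 0 T, (A t).IsSymmetric)
    (hψ : ∀ t ∈ Set.Icc 0 T,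
      HasDerivWithinAt ψ (-Complex.I • ((c t : ℂ) • A t (ψ t))) (Set.Icc 0 T) t) :
    ∀ t ∈ Set.Icc 0 T, ‖ψ t‖ = ‖ψ 0‖ := by
  intro t ht
  have hd : ∀ t ∈ Set.Icc 0 T,
      HasDerivWithinAt (fun t => inner ℂ (ψ t) (ψ t)) 0 (Set.Icc 0 T) t := by
    intro t ht
    have h := (hψ t ht).inner ℂ (hψ t ht)
    have e : inner ℂ (ψ t) (-Complex.I • ((c t : ℂ) • A t (ψ t)))
        + inner ℂ (-Complex.I • ((c t : ℂ) • A t (ψ t))) (ψ t) = 0 := by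
      rw [inner_smul_left, inner_smul_right, inner_smul_left, inner_smul_right, hA t ht]
      simp
    rwa [e] at h
  have hc := (convex_Icc (0 : ℝ) T).norm_image_sub_le_of_norm_hasDerivWithin_le (C := 0)
    hd (by simp) ⟨le_rfl, ht.1.trans ht.2⟩ ht
  rw [zero_mul, norm_le_zero_iff, sub_eq_zero] at hc
  rw [inner_self_eq_norm_sq_to_K, inner_self_eq_norm_sq_to_K] at hc
  have hc' : ‖ψ t‖ ^ 2 = ‖ψ 0‖ ^ 2 := by exact_mod_cast hc
  exact (pow_left_inj₀ (norm_nonneg _) (norm_nonneg _) two_ne_zero).1 hc'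

end Adiabatic

/-! ### Existence of the evolution -/

section Existence

variable {F : Type*} [NormedAddCommGroup F]

/-- The radial retraction onto the closed unit ball is Lipschitz. -/
lemma norm_radial_sub_radial_le [NormedSpace ℂ F] (x y : F) :
    ‖(((max 1 ‖x‖)⁻¹ : ℝ) : ℂ) • x - (((max 1 ‖y‖)⁻¹ : ℝ) : ℂ) • y‖ ≤ 2 * ‖x - y‖ := by
  set a := max 1 ‖x‖ with ha
  set b := max 1 ‖y‖ with hb
  have ha1 : 1 ≤ a := le_max_left _ _
  have hb1 : 1 ≤ b := le_max_left _ _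
  have hyb : ‖y‖ ≤ b := le_max_right _ _
  have e : ((a⁻¹ : ℝ) : ℂ) • x - ((b⁻¹ : ℝ) : ℂ) • y =
      ((a⁻¹ : ℝ) : ℂ) • (x - y) + ((a⁻¹ - b⁻¹ : ℝ) : ℂ) • y := by
    push_cast
    rw [smul_sub, sub_smul]
    abel
  have hab : |a - b| ≤ ‖x - y‖ := by
    rw [ha, hb, max_comm 1, max_comm 1]
    exact (abs_max_sub_max_le_abs ‖x‖ ‖y‖ 1).trans (abs_norm_sub_norm_le x y)
  rw [e]
  refine (norm_add_le _ _).trans ?_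
  rw [norm_smul, norm_smul, Complex.norm_real, Complex.norm_real, Real.norm_eq_abs,
    Real.norm_eq_abs, abs_of_pos (inv_pos.2 (by linarith)), two_mul]
  refine add_le_add (mul_le_of_le_one_left (norm_nonneg _) (inv_le_one_of_one_le₀ ha1)) ?_
  rw [inv_sub_inv (by positivity) (by positivity), abs_div, abs_of_pos (a := a * b) (by positivity),
    div_mul_eq_mul_div, div_le_iff₀ (by positivity), abs_sub_comm]
  have h1 : |a - b| * ‖y‖ ≤ ‖x - y‖ * b := mul_le_mul hab hyb (norm_nonneg _) (norm_nonneg _)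
  nlinarith [mul_nonneg (norm_nonneg (x - y)) (by linarith : 0 ≤ b)]

variable [InnerProductSpace ℂ F] [CompleteSpace F]

/-- A Schrödinger equation with bounded, continuous Hamiltonian can be solved on all of `[0, T]`.
The right-hand side is cut off outside the unit ball, which makes the Picard–Lindelöf theorem
applicable on the whole interval; the cut-off equation still preserves the norm, so its solution
never feels the cut-off. -/
theorem exists_schrodinger {A : ℝ → F →ₗ[ℂ] F} {T K : ℝ} (hT : 0 ≤ T) (hK : 0 ≤ K)
    (hA : ∀ t ∈ Set.Icc 0 T, (A t).IsSymmetric)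
    (hAK : ∀ t ∈ Set.Icc 0 T, ∀ x, ‖A t x‖ ≤ K * ‖x‖)
    (hAc : ∀ x, ContinuousOn (fun t => A t x) (Set.Icc 0 T)) {x₀ : F} (hx₀ : ‖x₀‖ = 1) :
    ∃ ψ : ℝ → F, ψ 0 = x₀ ∧
      ∀ t ∈ Set.Icc 0 T, HasDerivWithinAt ψ (-Complex.I • A t (ψ t)) (Set.Icc 0 T) t := by
  lift K to NNReal using hK
  set ρ : F → ℝ := fun x => (max 1 ‖x‖)⁻¹ with hρ
  set f : ℝ → F → F := fun t x => -Complex.I • ((ρ x : ℂ) • A t x) with hf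
  have hnorm : ∀ x : F, ‖(ρ x : ℂ) • x‖ ≤ 1 := by
    intro x
    have : (0 : ℝ) < max 1 ‖x‖ := lt_max_of_lt_left one_pos
    rw [norm_smul, Complex.norm_real, Real.norm_eq_abs, abs_of_pos (inv_pos.2 this),
      inv_mul_le_iff₀ this, mul_one]
    exact le_max_right _ _
  have hpl : IsPicardLindelof f (tmin := 0) (tmax := T) ⟨0, le_rfl, hT⟩ x₀
      (K * T.toNNReal) 0 K (K * 2) := by
    refine ⟨fun t ht => LipschitzWith.lipschitzOnWith (LipschitzWith.of_dist_le_mul fun x y => ?_),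
      fun x _ => ?_, fun t ht x _ => ?_, ?_⟩
    · rw [dist_eq_norm, dist_eq_norm]
      simp only [hf]
      rw [← smul_sub, ← map_smul, ← map_smul, ← map_sub, norm_smul, norm_neg, Complex.norm_I, one_mul]
      refine (hAK t ht _).trans ?_
      rw [NNReal.coe_mul, mul_assoc]
      exact mul_le_mul_of_nonneg_left (norm_radial_sub_radial_le x y) K.2
    · exact ((hAc x).const_smul _).const_smul _
    · simp only [hf]
      rw [norm_smul, norm_neg, Complex.norm_I, one_mul, ← map_smul]
      exact (hAK t ht _).trans (mul_le_of_le_one_right K.2 (hnorm x))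
    · simp [hT]
  obtain ⟨ψ, h0, hψ⟩ := hpl.exists_eq_forall_mem_Icc_hasDerivWithinAt₀
  refine ⟨ψ, h0, fun t ht => ?_⟩
  have h1 := norm_eq_of_schrodinger (c := fun t => ρ (ψ t)) hA hψ t ht
  have h2 := hψ t ht
  simp only at h0
  rw [h0, hx₀] at h1
  simpa [hf, hρ, h1] using h2

end Existence

/-! ### The adiabatic Hamiltonian on the symmetric subspace -/

lemma plusState_apply (z : Bits n) : plusState n z = ((1 / √((2 : ℝ) ^ n) : ℝ) : ℂ) := by
  simp only [plusState, Finset.prod_const, Finset.card_univ, Fintype.card_fin]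
  have h : √((2 : ℝ) ^ n) = √2 ^ n := by
    rw [Real.sqrt_eq_iff_mul_self_eq_of_pos (by positivity), ← mul_pow,
      Real.mul_self_sqrt two_pos.le]
  rw [← Complex.ofReal_pow, div_pow, one_pow, h]

lemma norm_plusState : ‖plusState n‖ = 1 := by
  rw [EuclideanSpace.norm_eq, Real.sqrt_eq_one]
  simp only [plusState_apply, Complex.norm_real, Real.norm_eq_abs, sq_abs, div_pow, one_pow]
  rw [Real.sq_sqrt (by positivity)]
  simp

lemma adiabaticOp_apply (s : ℝ) (v : Qubits n) (z : Bits n) :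
    adiabaticOp E s v z = s * E z * v z - (1 - s) * (1 / 2 ^ n * ∑ z', v z') := by
  have h2 : (((1 / √((2 : ℝ) ^ n) : ℝ) : ℂ)) * ((1 / √((2 : ℝ) ^ n) : ℝ) : ℂ) = 1 / 2 ^ n := by
    rw [← Complex.ofReal_mul, div_mul_div_comm, Real.mul_self_sqrt (by positivity)]
    push_cast
    simp
  simp only [adiabaticOp, adiabaticMatrix, problemMatrix, Matrix.toLpLin_apply,
    Matrix.add_mulVec, Matrix.neg_mulVec, Matrix.smul_mulVec, Matrix.mulVec_diagonal,
    Pi.add_apply, Pi.neg_apply, Pi.smul_apply, smul_eq_mul]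
  simp only [Matrix.mulVec, dotProduct, Matrix.vecMulVec_apply, plusState_apply, Complex.conj_ofReal,
    h2, ← Finset.mul_sum]
  push_cast
  ring

lemma isSymmetric_adiabaticOp (s : ℝ) : (adiabaticOp E s).IsSymmetric := by
  intro v w
  simp only [PiLp.inner_apply, adiabaticOp_apply, RCLike.inner_apply, map_sub, map_mul,
    Complex.conj_ofReal, mul_sub, sub_mul, Finset.sum_sub_distrib, map_sum, map_one, map_div₀,
    map_pow, Complex.conj_ofNat]
  congr 1
  · exact Finset.sum_congr rfl fun z _ => by ring
  · simp only [← Finset.mul_sum, ← Finset.sum_mul]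
    ring

lemma mem_symmetricSubspace {v : Qubits n} :
    v ∈ symmetricSubspace E ↔ ∀ z z', E z = E z' → v z = v z' := by
  constructor
  · intro hv z z' hz
    induction hv using Submodule.span_induction with
    | mem x hx =>
      obtain ⟨e, -, rfl⟩ := hx
      simp [levelState, hz]
    | zero => rfl
    | add x y _ _ hx hy => simp [hx, hy]
    | smul a x _ hx => simp [hx]
  · intro hv
    have hf : Function.FactorsThrough (fun z => v z) E := fun z z' h => hv z z' h
    have hsum : v = ∑ e ∈ levels E,
        (Function.extend E (fun z => v z) 0 e * ((√(degeneracy E e : ℝ) : ℝ) : ℂ)) •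
          levelState E e := by
      ext z
      have hd : ((√(degeneracy E (E z) : ℝ) : ℝ) : ℂ) ≠ 0 := by
        have : 0 < degeneracy E (E z) := Finset.card_pos.2 ⟨z, by simp⟩
        exact_mod_cast (Real.sqrt_pos.2 (by exact_mod_cast this)).ne'
      rw [WithLp.ofLp_sum, Finset.sum_apply, Finset.sum_eq_single (E z)]
      · simp only [levelState, PiLp.smul_apply, smul_eq_mul, hf.extend_apply, if_true]
        push_cast
        field_simp
      · intro e _ he
        simp [levelState, Ne.symm he]
      · intro h
        exact absurd (by simp [levels]) h
    rw [hsum]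
    exact Submodule.sum_mem _ fun e he =>
      Submodule.smul_mem _ _ (Submodule.subset_span ⟨e, he, rfl⟩)

lemma norm_levelState {e : ℝ} (he : 0 < degeneracy E e) : ‖levelState E e‖ = 1 := by
  have hd : (0 : ℝ) < degeneracy E e := by exact_mod_cast he
  rw [EuclideanSpace.norm_eq, Real.sqrt_eq_one]
  have : ∀ z, ‖levelState E e z‖ ^ 2 = if E z = e then 1 / (degeneracy E e : ℝ) else 0 := by
    intro z
    simp only [levelState]
    split_ifs
    · rw [Complex.norm_real, Real.norm_eq_abs, sq_abs, div_pow, one_pow, Real.sq_sqrt hd.le]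
    · simp
  rw [Finset.sum_congr rfl fun z _ => this z, Finset.sum_ite, Finset.sum_const,
    Finset.sum_const_zero, add_zero, nsmul_eq_mul]
  exact mul_one_div_cancel hd.ne'

/-- The secular equation of the rank one perturbation `s H_z - (1 - s) |ψ₀⟩⟨ψ₀|`. -/
lemma secular_equation {s l : ℝ} (hs : s ∈ Set.Ioo (0 : ℝ) 1) (hl : l ∈ symmetricSpectrum E s) :
    (∀ z, s * E z ≠ l) ∧ (1 - s) * (1 / 2 ^ n * ∑ z, 1 / (s * E z - l)) = 1 := by
  obtain ⟨v, hv, hv0, hl⟩ := hl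
  rw [mem_symmetricSubspace] at hv
  set M : ℂ := 1 / 2 ^ n * ∑ z, v z with hM
  have h1s : ((1 : ℂ) - s) ≠ 0 := by exact_mod_cast (sub_pos.2 hs.2).ne'
  have heq : ∀ z, ((s : ℂ) * E z - l) * v z = (1 - s) * M := by
    intro z
    have := congrArg (fun w : Qubits n => w z) hl
    simp only [adiabaticOp_apply, PiLp.smul_apply, smul_eq_mul] at this
    linear_combination this
  -- An eigenvector orthogonal to `ψ₀` would live on one level and be constant there.
  have hM0 : M ≠ 0 := by
    intro h0
    have hz : ∃ z, v z ≠ 0 := by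
      by_contra! hcon
      exact hv0 (by ext z; simp [hcon z])
    obtain ⟨z₀, hz₀⟩ := hz
    have hl0 : (s : ℂ) * E z₀ - l = 0 := by
      have := heq z₀
      rw [h0, mul_zero] at this
      exact (mul_eq_zero.1 this).resolve_right hz₀
    have hvz : ∀ z, v z = if E z = E z₀ then v z₀ else 0 := by
      intro z
      split_ifs with h
      · exact hv _ _ h
      · have h' := heq z
        rw [h0, mul_zero] at h'
        refine (mul_eq_zero.1 h').resolve_left fun hc => h ?_
        have : (s : ℂ) * E z = s * E z₀ := by linear_combination hc - hl0
        have h3 := mul_left_cancel₀ (Complex.ofReal_ne_zero.2 hs.1.ne') this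
        exact_mod_cast h3
    have hsum : ∑ z, v z = (degeneracy E (E z₀) : ℂ) * v z₀ := by
      rw [Finset.sum_congr rfl fun z _ => hvz z, Finset.sum_ite]
      simp [degeneracy]
    have hd : (degeneracy E (E z₀) : ℂ) ≠ 0 := by
      have : 0 < degeneracy E (E z₀) := Finset.card_pos.2 ⟨z₀, by simp⟩
      exact_mod_cast this.ne'
    rw [hM, hsum] at h0
    simp [hd, hz₀] at h0
  have hne : ∀ z, s * E z ≠ l := by
    intro z hz
    have := heq z
    rw [← Complex.ofReal_mul, hz, sub_self, zero_mul] at this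
    exact mul_ne_zero h1s hM0 this.symm
  refine ⟨hne, ?_⟩
  have hvz : ∀ z, v z = (1 - s) * M * (1 / ((s : ℂ) * E z - l)) := by
    intro z
    have : (s : ℂ) * E z - l ≠ 0 := by exact_mod_cast sub_ne_zero.2 (hne z)
    rw [mul_one_div, eq_div_iff this, mul_comm]
    exact heq z
  have hMM : M = (1 - s) * M * (1 / 2 ^ n * ∑ z, 1 / ((s : ℂ) * E z - l)) := by
    conv_lhs => rw [hM, Finset.sum_congr rfl fun z _ => hvz z, ← Finset.mul_sum]
    ring
  have h1 : (1 - s) * (1 / 2 ^ n * ∑ z, 1 / ((s : ℂ) * E z - l)) = 1 :=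
    mul_left_cancel₀ hM0 (by linear_combination -hMM)
  have h2 : (((1 - s) * (1 / 2 ^ n * ∑ z, 1 / (s * E z - l)) : ℝ) : ℂ) = 1 := by
    push_cast
    exact h1
  exact_mod_cast h2

/-! ### The lowest eigenvalue, by an inverse function -/

/-- The mean `(1 / N) ∑ z, 1 / (1 + y (E z - E₀))`, where `1 / y` stands for the distance of the
lowest eigenvalue of `H(s) / s` from `E₀`. -/
noncomputable def meanResolvent (E : Bits n → ℝ) (y : ℝ) : ℝ :=
  1 / 2 ^ n * ∑ z, (1 + y * (E z - groundEnergy E))⁻¹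

/-- The value of `s` at which `s (E₀ - 1 / y)` is the lowest eigenvalue of `H(s)`. By the secular
equation, `s / (1 - s) = y * meanResolvent E y`. -/
noncomputable def resolventParam (E : Bits n → ℝ) (y : ℝ) : ℝ :=
  y * meanResolvent E y / (1 + y * meanResolvent E y)

/-- The inverse of `resolventParam`: the lowest eigenvalue of `H(s)` on the symmetric subspace is
`s (E₀ - 1 / y)` with `y = inverseDepth E s`. Unlike its reciprocal, `y` stays regular at
`s = 0`. -/
noncomputable def inverseDepth (E : Bits n → ℝ) (s : ℝ) : ℝ :=
  Function.invFunOn (resolventParam E) (Set.Ioi 0) s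

lemma one_add_mul_pos {y : ℝ} (hy : 0 ≤ y) (z : Bits n) :
    0 < 1 + y * (E z - groundEnergy E) := by
  have := mul_nonneg hy (sub_nonneg.2 (groundEnergy_le (E := E) z))
  linarith

lemma meanResolvent_le_one {y : ℝ} (hy : 0 ≤ y) : meanResolvent E y ≤ 1 := by
  have h : ∑ z : Bits n, (1 + y * (E z - groundEnergy E))⁻¹ ≤ ∑ _z : Bits n, (1 : ℝ) := by
    refine Finset.sum_le_sum fun z _ => inv_le_one_of_one_le₀ ?_
    have := mul_nonneg hy (sub_nonneg.2 (groundEnergy_le (E := E) z))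
    linarith
  rw [meanResolvent, one_div, inv_mul_le_iff₀ (by positivity)]
  simpa using h

lemma groundWeight_le_meanResolvent {y : ℝ} (hy : 0 ≤ y) : groundWeight E ≤ meanResolvent E y := by
  rw [meanResolvent, sum_ground_add_sum_excited, groundWeight, one_div, div_eq_inv_mul]
  refine mul_le_mul_of_nonneg_left ?_ (by positivity)
  have h1 : ∑ z with E z = groundEnergy E, (1 + y * (E z - groundEnergy E))⁻¹
      = groundDegeneracy E := by
    rw [Finset.sum_congr rfl (g := fun _ => 1) fun z hz => by
      rw [(Finset.mem_filter.1 hz).2]; simp]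
    simp [groundDegeneracy, degeneracy]
  have h2 : 0 ≤ ∑ z ∈ excitedStates E, (1 + y * (E z - groundEnergy E))⁻¹ :=
    Finset.sum_nonneg fun z _ => (inv_pos.2 (one_add_mul_pos hy z)).le
  rw [h1]
  exact le_add_of_nonneg_right h2

lemma meanResolvent_pos {y : ℝ} (hy : 0 ≤ y) : 0 < meanResolvent E y :=
  groundWeight_pos.trans_le (groundWeight_le_meanResolvent hy)

lemma inv_one_add_le_meanResolvent {c : ℝ} (hE : IsProblemHamiltonian E c) {y : ℝ} (hy : 0 ≤ y) :
    (1 + y)⁻¹ ≤ meanResolvent E y := by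
  have h : ∑ _z : Bits n, (1 + y)⁻¹ ≤ ∑ z : Bits n, (1 + y * (E z - groundEnergy E))⁻¹ := by
    refine Finset.sum_le_sum fun z _ => inv_anti₀ (one_add_mul_pos hy z) ?_
    have := mul_le_mul_of_nonneg_left (hE.sub_le_one z) hy
    linarith
  rw [meanResolvent, one_div, le_inv_mul_iff₀ (by positivity)]
  simpa using h

lemma mul_meanResolvent_eq (y : ℝ) : y * meanResolvent E y =
    1 / 2 ^ n * ∑ z, y * (1 + y * (E z - groundEnergy E))⁻¹ := by
  rw [meanResolvent, ← Finset.mul_sum]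
  ring

lemma hasDerivAt_mul_meanResolvent {y : ℝ} (hy : 0 ≤ y) :
    HasDerivAt (fun y => y * meanResolvent E y)
      (1 / 2 ^ n * ∑ z, ((1 + y * (E z - groundEnergy E)) ^ 2)⁻¹) y := by
  simp only [mul_meanResolvent_eq]
  refine HasDerivAt.const_mul _ (HasDerivAt.fun_sum fun z _ => ?_)
  have hp := one_add_mul_pos (E := E) hy z
  have h1 : HasDerivAt (fun y => 1 + y * (E z - groundEnergy E)) (E z - groundEnergy E) y := by
    simpa using ((hasDerivAt_id y).mul_const (E z - groundEnergy E)).const_add 1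
  refine ((hasDerivAt_id' y).mul (h1.inv hp.ne')).congr_deriv ?_
  simp only [Pi.inv_apply]
  field_simp
  ring

lemma hasDerivAt_resolventParam {y : ℝ} (hy : 0 ≤ y) :
    ∃ d, 0 < d ∧ HasDerivAt (resolventParam E) d y := by
  have h1 := hasDerivAt_mul_meanResolvent (E := E) hy
  have hpos : 0 < 1 + y * meanResolvent E y := by
    have := meanResolvent_pos (E := E) hy
    positivity
  have h2 := h1.div (h1.const_add 1) hpos.ne'
  refine ⟨_, ?_, h2⟩
  have h3 : 0 < 1 / 2 ^ n * ∑ z, ((1 + y * (E z - groundEnergy E)) ^ 2)⁻¹ := by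
    refine mul_pos (by positivity) (Finset.sum_pos (fun z _ => ?_) Finset.univ_nonempty)
    have := one_add_mul_pos (E := E) hy z
    positivity
  have e : ∀ a b : ℝ, a * (1 + b) - b * a = a := fun a b => by ring
  rw [e]
  exact div_pos h3 (by positivity)

lemma strictMonoOn_resolventParam : StrictMonoOn (resolventParam E) (Set.Ici 0) := by
  refine strictMonoOn_of_deriv_pos (convex_Ici 0) (fun y hy => ?_) fun y hy => ?_
  · obtain ⟨d, -, h⟩ := hasDerivAt_resolventParam (E := E) hy
    exact h.continuousAt.continuousWithinAt
  · obtain ⟨d, hd, h⟩ := hasDerivAt_resolventParam (E := E) (interior_subset hy)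
    rwa [h.deriv]

lemma exists_resolventParam_eq {s : ℝ} (hs : s ∈ Set.Ioo (0 : ℝ) 1) :
    ∃ y ∈ Set.Ioi (0 : ℝ), resolventParam E y = s := by
  have h1s := sub_pos.2 hs.2
  have hw := groundWeight_pos (E := E)
  set ρ := s / (1 - s) with hρ
  have hρ0 : 0 < ρ := div_pos hs.1 h1s
  have hb : 0 < ρ / groundWeight E := div_pos hρ0 hw
  have hcont : ContinuousOn (fun y => y * meanResolvent E y) (Set.Icc 0 (ρ / groundWeight E)) :=
    fun y hy => (hasDerivAt_mul_meanResolvent hy.1).continuousAt.continuousWithinAt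
  obtain ⟨y, hy, h⟩ := intermediate_value_Icc hb.le hcont (show ρ ∈ Set.Icc _ _ from by
    refine ⟨by simpa using hρ0.le, ?_⟩
    calc ρ = ρ / groundWeight E * groundWeight E := (div_mul_cancel₀ _ hw.ne').symm
      _ ≤ _ := mul_le_mul_of_nonneg_left (groundWeight_le_meanResolvent hb.le) hb.le)
  have hy0 : y ≠ 0 := by
    rintro rfl
    simp only [zero_mul] at h
    exact hρ0.ne h
  refine ⟨y, lt_of_le_of_ne hy.1 hy0.symm, ?_⟩
  simp only at h
  rw [resolventParam, h, hρ]
  field_simp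
  ring

lemma inverseDepth_pos {s : ℝ} (hs : s ∈ Set.Ioo (0 : ℝ) 1) : 0 < inverseDepth E s :=
  Function.invFunOn_mem (exists_resolventParam_eq (E := E) hs)

lemma resolventParam_inverseDepth {s : ℝ} (hs : s ∈ Set.Ioo (0 : ℝ) 1) : resolventParam E (inverseDepth E s) = s :=
  Function.invFunOn_eq (exists_resolventParam_eq (E := E) hs)

lemma inverseDepth_mul_meanResolvent {s : ℝ} (hs : s ∈ Set.Ioo (0 : ℝ) 1) :
    inverseDepth E s * meanResolvent E (inverseDepth E s) = s / (1 - s) := by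
  have h := resolventParam_inverseDepth (E := E) hs
  have hy := inverseDepth_pos (E := E) hs
  have hm := meanResolvent_pos (E := E) hy.le
  have h1s := sub_pos.2 hs.2
  rw [resolventParam, div_eq_iff (by positivity)] at h
  rw [eq_div_iff h1s.ne']
  linarith

lemma div_inverseDepth_eq {s : ℝ} (hs : s ∈ Set.Ioo (0 : ℝ) 1) :
    s / inverseDepth E s = (1 - s) * meanResolvent E (inverseDepth E s) := by
  have h := inverseDepth_mul_meanResolvent (E := E) hs
  have h1s := sub_pos.2 hs.2
  rw [eq_div_iff h1s.ne'] at h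
  rw [div_eq_iff (inverseDepth_pos hs).ne']
  linarith

lemma le_inverseDepth {s : ℝ} (hs : s ∈ Set.Ioo (0 : ℝ) 1) : s / (1 - s) ≤ inverseDepth E s := by
  rw [← inverseDepth_mul_meanResolvent (E := E) hs]
  have hy := (inverseDepth_pos (E := E) hs).le
  exact mul_le_of_le_one_right hy (meanResolvent_le_one hy)

lemma inverseDepth_le {s : ℝ} (hs : s ∈ Set.Ioo (0 : ℝ) 1) {c : ℝ} (hE : IsProblemHamiltonian E c)
    (hs2 : s < 1 / 2) :
    inverseDepth E s ≤ s / (1 - 2 * s) := by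
  have hy := (inverseDepth_pos (E := E) hs).le
  have h1s := sub_pos.2 hs.2
  have h := mul_le_mul_of_nonneg_left (inv_one_add_le_meanResolvent hE hy) hy
  rw [inverseDepth_mul_meanResolvent hs, ← div_eq_mul_inv,
    div_le_div_iff₀ (by positivity) h1s] at h
  rw [le_div_iff₀ (by linarith)]
  linarith

lemma inverseDepth_resolventParam {y : ℝ} (hy : 0 < y) :
    inverseDepth E (resolventParam E y) = y :=
  (strictMonoOn_resolventParam.mono Set.Ioi_subset_Ici_self).injOn.leftInvOn_invFunOn hy

lemma contDiffAt_meanResolvent {y : ℝ} (hy : 0 ≤ y) :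
    ContDiffAt ℝ (⊤ : ℕ∞) (meanResolvent E) y := by
  unfold meanResolvent
  refine contDiffAt_const.mul (ContDiffAt.sum fun z _ => ContDiffAt.inv ?_ ?_)
  · fun_prop
  · exact (one_add_mul_pos hy z).ne'

lemma contDiffOn_inverseDepth : ContDiffOn ℝ (⊤ : ℕ∞) (inverseDepth E) (Set.Ioo 0 1) := by
  intro s hs
  refine ContDiffAt.contDiffWithinAt ?_
  have hy := inverseDepth_pos (E := E) hs
  have hm := meanResolvent_pos (E := E) hy.le
  obtain ⟨d, hd, h⟩ := hasDerivAt_resolventParam (E := E) hy.le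
  have hc : ContDiffAt ℝ (⊤ : ℕ∞) (resolventParam E) (inverseDepth E s) := by
    have hm' := contDiffAt_meanResolvent (E := E) hy.le
    refine (contDiffAt_id.mul hm').div (contDiffAt_const.add (contDiffAt_id.mul hm')) ?_
    positivity
  have hf : HasFDerivAt (resolventParam E)
      ((ContinuousLinearEquiv.unitsEquivAut ℝ (Units.mk0 d hd.ne') : ℝ →L[ℝ] ℝ))
      (inverseDepth E s) := by
    rw [hasFDerivAt_iff_hasDerivAt]
    simpa using h
  have hloc := hc.to_localInverse hf (by simp)
  rw [resolventParam_inverseDepth hs] at hloc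
  refine hloc.congr_of_eventuallyEq ?_
  have hu := (hc.hasStrictFDerivAt' hf (by simp)).localInverse_unique (g := inverseDepth E)
    (Filter.eventually_of_mem (Ioi_mem_nhds hy) fun y hy => inverseDepth_resolventParam hy)
  rwa [resolventParam_inverseDepth hs] at hu

/-! ### The real form of the adiabatic Hamiltonian and its ground vector -/

/-- The real vectors of amplitudes. `H(s)` is a real matrix, and on real vectors the derivative of
a unit vector is orthogonal to it, without a choice of phase. -/
abbrev RealQubits (n : ℕ) : Type := EuclideanSpace ℝ (Bits n)

/-- The inclusion of the real vectors into the Hilbert space of `n` qubits. -/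
noncomputable def complexify (n : ℕ) : RealQubits n →L[ℝ] Qubits n :=
  LinearMap.toContinuousLinearMap
    { toFun := fun v => WithLp.toLp 2 fun z => (v z : ℂ)
      map_add' := fun v w => by ext z; simp
      map_smul' := fun a v => by ext z; simp }

/-- The projector `|ψ₀⟩⟨ψ₀|` on real vectors: it replaces all amplitudes by their mean. -/
noncomputable def meanOp (n : ℕ) : RealQubits n →L[ℝ] RealQubits n :=
  LinearMap.toContinuousLinearMap
    { toFun := fun v => WithLp.toLp 2 fun _ => 1 / 2 ^ n * ∑ z, v z
      map_add' := fun v w => by ext z; simp [Finset.sum_add_distrib, mul_add]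
      map_smul' := fun a v => by ext z; simp [← Finset.mul_sum]; ring }

/-- The problem Hamiltonian on real vectors. -/
noncomputable def energyOp (E : Bits n → ℝ) : RealQubits n →L[ℝ] RealQubits n :=
  LinearMap.toContinuousLinearMap
    { toFun := fun v => WithLp.toLp 2 fun z => E z * v z
      map_add' := fun v w => by ext z; simp [mul_add]
      map_smul' := fun a v => by ext z; simp; ring }

/-- `H(s)` on real vectors, written as an affine function of `s`. -/
noncomputable def realOp (E : Bits n → ℝ) (s : ℝ) : RealQubits n →L[ℝ] RealQubits n :=
  -meanOp n + s • (meanOp n + energyOp E)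

/-- The real vectors that are constant on every level. -/
def realSymmetric (E : Bits n → ℝ) : Submodule ℝ (RealQubits n) where
  carrier := {v | ∀ z z', E z = E z' → v z = v z'}
  add_mem' := fun ha hb z z' h => by simp [ha z z' h, hb z z' h]
  zero_mem' := fun _ _ _ => rfl
  smul_mem' := fun c _ ha z z' h => by simp [ha z z' h]

/-- The ground vector of `H(s)`, not normalized, in terms of `y = inverseDepth E s`. -/
noncomputable def depthVector (E : Bits n → ℝ) (y : ℝ) : RealQubits n :=
  WithLp.toLp 2 fun z => (1 + y * (E z - groundEnergy E))⁻¹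

/-- The normalized ground vector of `H(s)` on the symmetric subspace. -/
noncomputable def groundVector (E : Bits n → ℝ) (s : ℝ) : RealQubits n :=
  ‖depthVector E (inverseDepth E s)‖⁻¹ • depthVector E (inverseDepth E s)

/-- The lowest eigenvalue of `H(s)` on the symmetric subspace. -/
noncomputable def groundValue (E : Bits n → ℝ) (s : ℝ) : ℝ :=
  s * groundEnergy E - s / inverseDepth E s

@[simp] lemma complexify_apply (v : RealQubits n) (z : Bits n) : complexify n v z = (v z : ℂ) := rfl

@[simp] lemma meanOp_apply (v : RealQubits n) (z : Bits n) :
    meanOp n v z = 1 / 2 ^ n * ∑ z', v z' := rfl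

@[simp] lemma energyOp_apply (v : RealQubits n) (z : Bits n) : energyOp E v z = E z * v z := rfl

lemma realOp_apply (s : ℝ) (v : RealQubits n) (z : Bits n) :
    realOp E s v z = s * E z * v z - (1 - s) * (1 / 2 ^ n * ∑ z', v z') := by
  simp only [realOp, add_apply, neg_apply,
    smul_apply, PiLp.add_apply, PiLp.neg_apply, PiLp.smul_apply, meanOp_apply,
    energyOp_apply, smul_eq_mul]
  ring

lemma adiabaticOp_complexify (s : ℝ) (v : RealQubits n) :
    adiabaticOp E s (complexify n v) = complexify n (realOp E s v) := by
  ext z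
  simp [adiabaticOp_apply, realOp_apply]

lemma inner_complexify (v w : RealQubits n) :
    inner ℂ (complexify n v) (complexify n w) = (inner ℝ v w : ℂ) := by
  simp [PiLp.inner_apply]

lemma norm_complexify (v : RealQubits n) : ‖complexify n v‖ = ‖v‖ := by
  simp [EuclideanSpace.norm_eq]

lemma complexify_smul (a : ℝ) (v : RealQubits n) :
    complexify n (a • v) = (a : ℂ) • complexify n v := by
  ext z
  simp

lemma isSymmetric_realOp (s : ℝ) : (realOp E s : RealQubits n →ₗ[ℝ] RealQubits n).IsSymmetric := by
  intro v w
  have h := isSymmetric_adiabaticOp (E := E) s (complexify n v) (complexify n w)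
  rw [adiabaticOp_complexify, adiabaticOp_complexify, inner_complexify, inner_complexify] at h
  exact_mod_cast h

lemma complexify_mem_symmetricSubspace {v : RealQubits n} (hv : v ∈ realSymmetric E) :
    complexify n v ∈ symmetricSubspace E :=
  mem_symmetricSubspace.2 fun z z' h => by simp [hv z z' h]

lemma realOp_mem_realSymmetric (s : ℝ) {v : RealQubits n} (hv : v ∈ realSymmetric E) :
    realOp E s v ∈ realSymmetric E := fun z z' h => by
  rw [realOp_apply, realOp_apply, hv z z' h, h]

lemma mem_symmetricSpectrum_of_real {s l : ℝ} {v : RealQubits n} (hv : v ∈ realSymmetric E)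
    (hv0 : v ≠ 0) (h : realOp E s v = l • v) : l ∈ symmetricSpectrum E s := by
  refine ⟨complexify n v, complexify_mem_symmetricSubspace hv, fun h0 => hv0 ?_, ?_⟩
  · rw [← norm_eq_zero, ← norm_complexify, h0, norm_zero]
  · rw [adiabaticOp_complexify, h, complexify_smul]

/-- `dH/ds = |ψ₀⟩⟨ψ₀| + H_z` has norm at most `2`. -/
lemma norm_meanOp_add_energyOp_le {c : ℝ} (hE : IsProblemHamiltonian E c) (v : RealQubits n) :
    ‖(meanOp n + energyOp E) v‖ ≤ 2 * ‖v‖ := by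
  rw [add_apply, two_mul]
  refine (norm_add_le _ _).trans (add_le_add ?_ ?_)
  · rw [EuclideanSpace.norm_eq, EuclideanSpace.norm_eq]
    refine Real.sqrt_le_sqrt ?_
    simp only [meanOp_apply, Real.norm_eq_abs, sq_abs]
    have h := sq_sum_le_card_mul_sum_sq (s := Finset.univ) (f := fun z => v z)
    simp only [Finset.sum_const, nsmul_eq_mul, Finset.card_univ, Fintype.card_pi, Fintype.card_bool,
      Finset.prod_const, Fintype.card_fin] at h ⊢
    push_cast at h ⊢
    rw [mul_pow, ← mul_assoc]
    have e : (2 : ℝ) ^ n * (1 / 2 ^ n) ^ 2 = (2 ^ n)⁻¹ := by field_simp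
    rwa [e, inv_mul_le_iff₀ (by positivity)]
  · rw [EuclideanSpace.norm_eq, EuclideanSpace.norm_eq]
    refine Real.sqrt_le_sqrt (Finset.sum_le_sum fun z _ => ?_)
    rw [energyOp_apply, norm_mul, mul_pow]
    refine mul_le_of_le_one_left (sq_nonneg _) ?_
    have := hE.energy_mem z
    rw [Real.norm_eq_abs, sq_abs]
    nlinarith [this.1, this.2]

lemma depthVector_apply (y : ℝ) (z : Bits n) :
    depthVector E y z = (1 + y * (E z - groundEnergy E))⁻¹ := rfl

lemma depthVector_ne_zero (y : ℝ) : depthVector E y ≠ 0 := by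
  obtain ⟨z, hz⟩ := exists_eq_groundEnergy (E := E)
  intro h
  have := congrArg (fun v : RealQubits n => v z) h
  simp [depthVector_apply, hz] at this

lemma norm_groundVector (s : ℝ) : ‖groundVector E s‖ = 1 := by
  have := norm_pos_iff.2 (depthVector_ne_zero (E := E) (inverseDepth E s))
  rw [groundVector, norm_smul, norm_inv, norm_norm, inv_mul_cancel₀ this.ne']

lemma groundVector_mem (s : ℝ) : groundVector E s ∈ realSymmetric E :=
  Submodule.smul_mem _ _ fun z z' h => by rw [depthVector_apply, depthVector_apply, h]

lemma contDiffOn_groundVector : ContDiffOn ℝ (⊤ : ℕ∞) (groundVector E) (Set.Ioo 0 1) := by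
  have hd : ContDiffOn ℝ (⊤ : ℕ∞) (fun s => depthVector E (inverseDepth E s)) (Set.Ioo 0 1) := by
    rw [contDiffOn_euclidean]
    intro z
    simp only [depthVector_apply]
    refine ContDiffOn.inv (contDiffOn_const.add (contDiffOn_inverseDepth.mul contDiffOn_const))
      fun s hs => ?_
    exact (one_add_mul_pos (inverseDepth_pos hs).le z).ne'
  exact ((hd.norm ℝ fun s _ => depthVector_ne_zero _).inv fun s _ =>
    norm_ne_zero_iff.2 (depthVector_ne_zero _)).smul hd

lemma contDiffOn_groundValue : ContDiffOn ℝ (⊤ : ℕ∞) (groundValue E) (Set.Ioo 0 1) :=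
  (contDiffOn_id.mul contDiffOn_const).sub
    (contDiffOn_id.div contDiffOn_inverseDepth fun _ hs => (inverseDepth_pos hs).ne')

/-- The diagonal part of `H(s) - λ`, where `λ` is the lowest eigenvalue. -/
lemma sub_groundValue {s : ℝ} (hs : s ∈ Set.Ioo (0 : ℝ) 1) (z : Bits n) :
    s * E z - groundValue E s =
      s / inverseDepth E s * (1 + inverseDepth E s * (E z - groundEnergy E)) := by
  have := inverseDepth_pos (E := E) hs
  rw [groundValue]
  field_simp
  ring

lemma sub_groundValue_pos {s : ℝ} (hs : s ∈ Set.Ioo (0 : ℝ) 1) (z : Bits n) :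
    0 < s * E z - groundValue E s := by
  rw [sub_groundValue hs]
  exact mul_pos (div_pos hs.1 (inverseDepth_pos hs)) (one_add_mul_pos (inverseDepth_pos hs).le z)

lemma realOp_groundVector {s : ℝ} (hs : s ∈ Set.Ioo (0 : ℝ) 1) :
    realOp E s (groundVector E s) = groundValue E s • groundVector E s := by
  rw [groundVector, map_smul, smul_comm]
  congr 1
  ext z
  have h1 := sub_groundValue (E := E) hs z
  have hp := one_add_mul_pos (E := E) (inverseDepth_pos (E := E) hs).le z
  rw [realOp_apply, PiLp.smul_apply, smul_eq_mul, sub_eq_iff_eq_add, ← sub_eq_iff_eq_add',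
    ← sub_mul, h1]
  simp only [depthVector_apply]
  rw [mul_assoc, mul_inv_cancel₀ hp.ne', mul_one, div_inverseDepth_eq hs, meanResolvent]

lemma groundValue_mem_symmetricSpectrum {s : ℝ} (hs : s ∈ Set.Ioo (0 : ℝ) 1) :
    groundValue E s ∈ symmetricSpectrum E s :=
  mem_symmetricSpectrum_of_real (groundVector_mem s)
    (fun h => by simpa [h] using norm_groundVector (E := E) s) (realOp_groundVector hs)

/-- The lowest eigenvalue is simple. -/
lemma eq_zero_of_realOp_eq {s : ℝ} (hs : s ∈ Set.Ioo (0 : ℝ) 1) {v : RealQubits n}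
    (h : realOp E s v = groundValue E s • v) (hv : inner ℝ (groundVector E s) v = 0) : v = 0 := by
  have hu := norm_pos_iff.2 (depthVector_ne_zero (E := E) (inverseDepth E s))
  have hv' : v = ((1 - s) * (1 / 2 ^ n * ∑ z', v z') / (s / inverseDepth E s)
      * ‖depthVector E (inverseDepth E s)‖) • groundVector E s := by
    rw [groundVector, smul_smul, mul_assoc, mul_inv_cancel₀ hu.ne', mul_one]
    ext z
    have h1 := congrArg (fun w : RealQubits n => w z) h
    simp only [realOp_apply, PiLp.smul_apply, smul_eq_mul] at h1
    have h2 := sub_groundValue (E := E) hs z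
    rw [PiLp.smul_apply, smul_eq_mul, depthVector_apply, ← div_eq_mul_inv, div_div, ← h2,
      eq_div_iff (sub_groundValue_pos hs z).ne']
    linarith
  rw [hv', inner_smul_right, real_inner_self_eq_norm_sq, norm_groundVector, one_pow, mul_one] at hv
  rw [hv', hv, zero_smul]

/-- The first eigenvalue lies below `s E₀` and all others lie above it. -/
lemma lt_of_mem_symmetricSpectrum {s l : ℝ} (hs : s ∈ Set.Ioo (0 : ℝ) 1)
    (hl : l ∈ symmetricSpectrum E s) (hne : l ≠ groundValue E s) : s * groundEnergy E < l := by
  obtain ⟨hz, hsec⟩ := secular_equation hs hl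
  obtain ⟨z₀, hz₀⟩ := exists_eq_groundEnergy (E := E)
  by_contra! hcon
  have hlt : l < s * groundEnergy E := lt_of_le_of_ne hcon fun h => hz z₀ (by rw [hz₀, h])
  set x := s * groundEnergy E - l with hx
  have hx0 : 0 < x := sub_pos.2 hlt
  have hy : 0 < s / x := div_pos hs.1 hx0
  have h1s := sub_pos.2 hs.2
  have hm : 1 / 2 ^ n * ∑ z, 1 / (s * E z - l) = meanResolvent E (s / x) / x := by
    rw [meanResolvent, mul_div_assoc, Finset.sum_div]
    congr 1
    refine Finset.sum_congr rfl fun z _ => ?_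
    rw [one_div, div_eq_mul_inv, ← mul_inv]
    congr 1
    field_simp
    rw [hx]
    ring
  rw [hm] at hsec
  have hparam : resolventParam E (s / x) = s := by
    have h1 : s / x * meanResolvent E (s / x) = s / (1 - s) := by
      rw [eq_div_iff h1s.ne']
      calc s / x * meanResolvent E (s / x) * (1 - s)
          = s * ((1 - s) * (meanResolvent E (s / x) / x)) := by ring
        _ = s := by rw [hsec, mul_one]
    rw [resolventParam, h1]
    field_simp
    ring
  have hyx : inverseDepth E s = s / x := by
    conv_lhs => rw [← hparam]
    exact inverseDepth_resolventParam hy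
  have hs0 := hs.1.ne'
  refine hne ?_
  rw [groundValue, hyx, div_div_cancel₀ hs0, hx]
  ring

/-- Every symmetric vector orthogonal to the ground vector has an energy at least that of some
higher eigenvalue: this is the Rayleigh quotient on the orthogonal complement. -/
lemma exists_mem_symmetricSpectrum_le {s : ℝ} (hs : s ∈ Set.Ioo (0 : ℝ) 1) {x : RealQubits n}
    (hx : x ∈ realSymmetric E) (hx0 : x ≠ 0) (hort : inner ℝ (groundVector E s) x = 0) :
    ∃ l ∈ symmetricSpectrum E s, l ≠ groundValue E s ∧
      l * ‖x‖ ^ 2 ≤ inner ℝ x (realOp E s x) := by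
  set A : RealQubits n →ₗ[ℝ] RealQubits n := (realOp E s).toLinearMap with hA
  set W : Submodule ℝ (RealQubits n) := realSymmetric E ⊓ (ℝ ∙ groundVector E s)ᗮ with hW
  have hmem : ∀ v, v ∈ W ↔ v ∈ realSymmetric E ∧ inner ℝ (groundVector E s) v = 0 := fun v => by
    rw [hW, Submodule.mem_inf, Submodule.mem_orthogonal_singleton_iff_inner_right]
  have hsym : A.IsSymmetric := isSymmetric_realOp s
  have hinv : ∀ v ∈ W, A v ∈ W := by
    intro v hv
    rw [hmem] at hv ⊢
    refine ⟨realOp_mem_realSymmetric s hv.1, ?_⟩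
    rw [← hsym, hA, ContinuousLinearMap.coe_coe, realOp_groundVector hs, real_inner_smul_left, hv.2,
      mul_zero]
  have hxW : x ∈ W := (hmem x).2 ⟨hx, hort⟩
  have hx0' : (⟨x, hxW⟩ : W) ≠ 0 := fun h => hx0 (congrArg Subtype.val h)
  have : Nontrivial W := ⟨⟨⟨x, hxW⟩, 0, hx0'⟩⟩
  have hT := hsym.restrict_invariant hinv
  set l : ℝ := ⨅ v : { v : W // v ≠ 0 },
    RCLike.re (inner ℝ (A.restrict hinv v) (v : W)) / ‖(v : W)‖ ^ 2 with hl
  have hval : Module.End.HasEigenvalue (A.restrict hinv) l :=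
    hT.hasEigenvalue_iInf_of_finiteDimensional
  obtain ⟨v, hv⟩ := hval.exists_hasEigenvector
  have hvW := (hmem v).1 v.2
  have hv0 : (v : RealQubits n) ≠ 0 := fun h => hv.2 (Subtype.ext h)
  have hveq : realOp E s (v : RealQubits n) = l • (v : RealQubits n) :=
    congrArg Subtype.val hv.apply_eq_smul
  refine ⟨l, mem_symmetricSpectrum_of_real hvW.1 hv0 hveq,
    fun h => hv0 (eq_zero_of_realOp_eq hs (h ▸ hveq) hvW.2), ?_⟩
  have hbdd : BddBelow (Set.range fun v : { v : W // v ≠ 0 } =>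
      RCLike.re (inner ℝ (A.restrict hinv v) (v : W)) / ‖(v : W)‖ ^ 2) := by
    refine ⟨-‖realOp E s‖, ?_⟩
    rintro _ ⟨⟨w, hw⟩, rfl⟩
    have hw0 : 0 < ‖w‖ := norm_pos_iff.2 hw
    simp only [RCLike.re_to_real]
    rw [le_div_iff₀ (by positivity)]
    have h1 := abs_real_inner_le_norm (A.restrict hinv w) w
    have h2 : ‖A.restrict hinv w‖ ≤ ‖realOp E s‖ * ‖w‖ := (realOp E s).le_opNorm w
    have h3 := (abs_le.1 h1).1
    nlinarith
  have hle : l ≤ inner ℝ (realOp E s x) x / ‖x‖ ^ 2 := ciInf_le hbdd ⟨⟨x, hxW⟩, hx0'⟩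
  have hxn : 0 < ‖x‖ := norm_pos_iff.2 hx0
  rwa [le_div_iff₀ (pow_pos hxn 2), real_inner_comm] at hle

/-- The symmetric subspace is at least two-dimensional. -/
lemma exists_orthogonal_groundVector {c s : ℝ} (hE : IsProblemHamiltonian E c)
    (hs : s ∈ Set.Ioo (0 : ℝ) 1) :
    ∃ x ∈ realSymmetric E, x ≠ 0 ∧ inner ℝ (groundVector E s) x = 0 := by
  set u := depthVector E (inverseDepth E s) with hu
  have hpos : ∀ z, 0 < u z := fun z =>
    inv_pos.2 (one_add_mul_pos (inverseDepth_pos hs).le z)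
  set p := ∑ z with E z = groundEnergy E, u z with hp
  set q := ∑ z ∈ excitedStates E, u z with hq
  have hq0 : 0 < q := Finset.sum_pos (fun z _ => hpos z) hE.excitedStates_nonempty
  obtain ⟨z₀, hz₀⟩ := exists_eq_groundEnergy (E := E)
  refine ⟨WithLp.toLp 2 fun z => if E z = groundEnergy E then q else -p,
    fun z z' h => by simp [h], fun h => ?_, ?_⟩
  · have := congrArg (fun v : RealQubits n => v z₀) h
    simp [hz₀, hq0.ne'] at this
  · rw [groundVector, real_inner_smul_left]
    refine mul_eq_zero_of_right _ ?_
    rw [PiLp.inner_apply, sum_ground_add_sum_excited]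
    simp only [RCLike.inner_apply, conj_trivial]
    rw [Finset.sum_congr rfl (g := fun z => q * u z) fun z hz => by
        rw [if_pos (Finset.mem_filter.1 hz).2],
      Finset.sum_congr (s₁ := excitedStates E) rfl (g := fun z => -p * u z) fun z hz => by
        rw [if_neg (mem_excitedStates.1 hz)], ← Finset.mul_sum, ← Finset.mul_sum]
    ring

/-! ### The gap on the symmetric subspace -/

lemma sInf_symmetricSpectrum {s : ℝ} (hs : s ∈ Set.Ioo (0 : ℝ) 1) :
    sInf (symmetricSpectrum E s) = groundValue E s := by
  refine IsLeast.csInf_eq ⟨groundValue_mem_symmetricSpectrum hs, fun l hl => ?_⟩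
  by_contra! h
  obtain ⟨z₀, hz₀⟩ := exists_eq_groundEnergy (E := E)
  have h1 := lt_of_mem_symmetricSpectrum hs hl h.ne
  have h2 := sub_groundValue_pos (E := E) hs z₀
  rw [hz₀] at h2
  linarith

lemma le_adiabaticGap {c s b : ℝ} (hE : IsProblemHamiltonian E c) (hs : s ∈ Set.Ioo (0 : ℝ) 1)
    (h : ∀ l ∈ symmetricSpectrum E s, s * groundEnergy E < l → b ≤ l - groundValue E s) :
    b ≤ adiabaticGap E s := by
  rw [adiabaticGap, sInf_symmetricSpectrum hs, le_sub_iff_add_le]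
  obtain ⟨x, hx, hx0, hort⟩ := exists_orthogonal_groundVector hE hs
  obtain ⟨l, hl, hne, -⟩ := exists_mem_symmetricSpectrum_le hs hx hx0 hort
  refine le_csInf ⟨l, hl, hne⟩ fun l hl => ?_
  linarith [h l hl.1 (lt_of_mem_symmetricSpectrum hs hl.1 hl.2)]

/-- The gap as a quadratic form inequality on the complement of the ground vector. -/
lemma adiabaticGap_mul_le {s : ℝ} (hs : s ∈ Set.Ioo (0 : ℝ) 1) {x : RealQubits n}
    (hx : x ∈ realSymmetric E) (hort : inner ℝ (groundVector E s) x = 0) :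
    adiabaticGap E s * ‖x‖ ^ 2 ≤ inner ℝ x (realOp E s x - groundValue E s • x) := by
  rcases eq_or_ne x 0 with rfl | hx0
  · simp
  obtain ⟨l, hl, hne, hle⟩ := exists_mem_symmetricSpectrum_le hs hx hx0 hort
  have hgap : adiabaticGap E s ≤ l - groundValue E s := by
    rw [adiabaticGap, sInf_symmetricSpectrum hs]
    have hbdd : BddBelow (symmetricSpectrum E s \ {groundValue E s}) :=
      ⟨s * groundEnergy E, fun l' hl' => (lt_of_mem_symmetricSpectrum hs hl'.1 hl'.2).le⟩
    exact sub_le_sub_right (csInf_le hbdd ⟨hl, hne⟩) _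
  rw [inner_sub_right, real_inner_smul_right, real_inner_self_eq_norm_sq]
  nlinarith [mul_le_mul_of_nonneg_right hgap (sq_nonneg ‖x‖)]

/-! ### The piecewise linear bound -/

/-- The speed at which `g₀` decreases on the left of the crossing. -/
noncomputable def leftSlope (E : Bits n → ℝ) : ℝ :=
  spectralParam E 1 * (spectralParam E 1 + 1) / (10 * spectralParam E 2)

/-- The speed at which `g₀` increases on the right of the crossing. -/
noncomputable def rightSlope (E : Bits n → ℝ) : ℝ :=
  (problemGap E / 30 - minGap E / 10) * (spectralParam E 1 + 1)

lemma minGap_eq_crossing : minGap E = 2 * crossing E * crossingScale E := by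
  rw [minGap_eq, crossing]
  ring

namespace IsProblemHamiltonian

lemma crossingScale_lt (hE : IsProblemHamiltonian E (11 / 500)) :
    crossingScale E < 11 / 500 * problemGap E := hE.sqrt_weight_div_lt

lemma minGap_pos (hE : IsProblemHamiltonian E (11 / 500)) : 0 < minGap E := by
  have h1 := hE.spectralParam_pos 1
  have hk := hE.crossingScale_pos
  rw [minGap_eq]
  positivity

lemma minGap_lt (hE : IsProblemHamiltonian E (11 / 500)) :
    minGap E < 11 / 250 * problemGap E := by
  have h1 := hE.spectralParam_pos 1
  have hk := hE.crossingScale_pos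
  have h : minGap E ≤ 2 * crossingScale E := by
    rw [minGap_eq]
    refine mul_le_mul_of_nonneg_right ?_ hk.le
    rw [div_le_iff₀ (by linarith)]
    linarith
  linarith [hE.crossingScale_lt]

lemma leftSlope_pos (hE : IsProblemHamiltonian E (11 / 500)) : 0 < leftSlope E := by
  have h1 := hE.spectralParam_pos 1
  have h2 := hE.spectralParam_pos 2
  unfold leftSlope
  positivity

lemma leftSlope_le_one (hE : IsProblemHamiltonian E (11 / 500)) : leftSlope E ≤ 1 := by
  have h2 := hE.spectralParam_pos 2
  rw [leftSlope, div_le_one (by positivity)]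
  linarith [hE.sq_spectralParam_one_le, hE.spectralParam_le_succ 1]

lemma inv_leftSlope_le (hE : IsProblemHamiltonian E (11 / 500)) :
    (leftSlope E)⁻¹ ≤ 10 / (problemGap E * spectralParam E 1) := by
  have h1 := hE.spectralParam_pos 1
  have hg := hE.problemGap_pos
  have h := hE.spectralParam_succ_mul_gap_le 1
  norm_num at h
  rw [leftSlope, inv_div, div_le_div_iff₀ (by positivity) (by positivity)]
  nlinarith [mul_le_mul_of_nonneg_right h h1.le]

lemma rightSlope_pos (hE : IsProblemHamiltonian E (11 / 500)) : 0 < rightSlope E := by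
  have h1 := hE.spectralParam_pos 1
  have hg := hE.problemGap_pos
  exact mul_pos (by linarith [hE.minGap_lt]) (by linarith)

lemma rightSlope_le_one (hE : IsProblemHamiltonian E (11 / 500)) : rightSlope E ≤ 1 := by
  have h1 := hE.spectralParam_pos 1
  have h0 := hE.spectralParam_succ_mul_gap_le 0
  have hw := groundWeight_pos (E := E)
  rw [spectralParam_zero] at h0
  norm_num at h0
  have hg := hE.problemGap_le_one
  have hm := mul_pos hE.minGap_pos (by linarith : 0 < spectralParam E 1 + 1)
  rw [rightSlope]
  nlinarith

lemma inv_rightSlope_le (hE : IsProblemHamiltonian E (11 / 500)) :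
    (rightSlope E)⁻¹ ≤ 35 / (problemGap E * spectralParam E 1) := by
  have h1 := hE.spectralParam_pos 1
  have hg := hE.problemGap_pos
  have h : problemGap E * spectralParam E 1 / 35 ≤ rightSlope E := by
    rw [rightSlope]
    nlinarith [mul_le_mul_of_nonneg_right hE.minGap_lt.le h1.le, hE.minGap_lt, mul_pos hg h1]
  rw [← inv_div]
  exact inv_anti₀ (by positivity) h

lemma one_sub_crossing (hE : IsProblemHamiltonian E (11 / 500)) :
    1 - crossing E = 1 / (spectralParam E 1 + 1) := by
  have h1 := hE.spectralParam_pos 1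
  rw [crossing]
  field_simp
  ring

lemma crossing_pos (hE : IsProblemHamiltonian E (11 / 500)) : 0 < crossing E := by
  have h1 := hE.spectralParam_pos 1
  rw [crossing]
  positivity

lemma crossing_lt_one (hE : IsProblemHamiltonian E (11 / 500)) : crossing E < 1 := by
  have h1 := hE.spectralParam_pos 1
  rw [crossing, div_lt_one (by positivity)]
  linarith

lemma four_ninths_le_crossing (hE : IsProblemHamiltonian E (11 / 500)) : 4 / 9 ≤ crossing E := by
  have h1 := hE.spectralParam_pos 1
  rw [crossing, le_div_iff₀ (by positivity)]
  linarith [hE.le_spectralParam_one]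

lemma crossingWidth_pos (hE : IsProblemHamiltonian E (11 / 500)) : 0 < crossingWidth E := by
  have h1 := hE.spectralParam_pos 1
  have h2 := hE.spectralParam_pos 2
  have hk := hE.crossingScale_pos
  rw [hE.crossingWidth_eq]
  positivity

lemma crossingWidth_le (hE : IsProblemHamiltonian E (11 / 500)) :
    crossingWidth E ≤ 1 / 2 * crossing E := by
  have h1 := hE.spectralParam_pos 1
  have h2 := hE.spectralParam_pos 2
  have h := hE.spectralParam_succ_mul_gap_le 1
  norm_num at h
  have h3 : crossingScale E * spectralParam E 2 ≤ 11 / 500 * spectralParam E 1 := by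
    nlinarith [mul_le_mul_of_nonneg_right hE.crossingScale_lt.le h2.le]
  rw [hE.crossingWidth_eq, crossing, div_mul_eq_mul_div, mul_div_assoc',
    div_le_div_iff₀ (by positivity) (by positivity)]
  have h4 : 2 * (crossingScale E * spectralParam E 2) ≤
      1 / 2 * spectralParam E 1 * (spectralParam E 1 + 1) := by nlinarith
  calc 2 * (crossingScale E * spectralParam E 2) * (spectralParam E 1 + 1)
      ≤ 1 / 2 * spectralParam E 1 * (spectralParam E 1 + 1) * (spectralParam E 1 + 1) :=
        mul_le_mul_of_nonneg_right h4 (by linarith)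
    _ = _ := by ring

lemma leftSlope_mul_crossingWidth (hE : IsProblemHamiltonian E (11 / 500)) :
    leftSlope E * crossingWidth E = minGap E / 10 := by
  have h2 := hE.spectralParam_pos 2
  rw [leftSlope, hE.crossingWidth_eq, minGap_eq]
  field_simp

lemma one_sub_rightZero (hE : IsProblemHamiltonian E (11 / 500)) :
    1 - rightZero E = problemGap E / 12 /
      ((problemGap E / 12 - 1 / 4 * minGap E) * (spectralParam E 1 + 1)) := by
  have hd : 0 < problemGap E / 12 - 1 / 4 * minGap E := by
    linarith [hE.minGap_lt, hE.problemGap_pos]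
  have e : 1 - rightZero E = (1 - crossing E) +
      1 / 4 * minGap E * (1 - crossing E) / (problemGap E / 12 - 1 / 4 * minGap E) := by
    rw [rightZero]
    ring
  rw [e, hE.one_sub_crossing]
  set d := problemGap E / 12 - 1 / 4 * minGap E with hdd
  have hp : problemGap E / 12 = d + 1 / 4 * minGap E := by rw [hdd]; ring
  rw [hp]
  field_simp

lemma gapBound_of_le (hE : IsProblemHamiltonian E (11 / 500)) {s : ℝ}
    (hs : s ≤ crossing E - crossingWidth E) : gapBound E s = leftSlope E * (crossing E - s) := by
  rcases hs.lt_or_eq with h | h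
  · rw [gapBound, if_pos h, hE.one_sub_crossing, leftSlope]
    field_simp
  · have hδ := hE.crossingWidth_pos
    rw [gapBound, if_neg (by linarith), if_pos (by linarith), h, sub_sub_cancel,
      hE.leftSlope_mul_crossingWidth]
    ring

lemma gapBound_of_ge (hE : IsProblemHamiltonian E (11 / 500)) {s : ℝ} (hs : crossing E ≤ s) :
    gapBound E s = minGap E / 10 + rightSlope E * (s - crossing E) := by
  have h1 := hE.spectralParam_pos 1
  have hg := hE.problemGap_pos
  have hδ := hE.crossingWidth_pos
  have hd : 0 < problemGap E / 12 - 1 / 4 * minGap E := by linarith [hE.minGap_lt]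
  have h0 : s - rightZero E = (s - crossing E) +
      1 / 4 * minGap E / ((problemGap E / 12 - 1 / 4 * minGap E) * (spectralParam E 1 + 1)) := by
    rw [rightZero, hE.one_sub_crossing]
    field_simp
    ring
  rw [gapBound, if_neg (by linarith), if_neg (by linarith), hE.one_sub_rightZero, h0, rightSlope]
  set d := problemGap E / 12 - 1 / 4 * minGap E with hdd
  have hp : problemGap E / 30 - minGap E / 10 = d * (12 / 30) := by rw [hdd]; ring
  rw [hp]
  field_simp
  ring

lemma gapBound_of_mem (hE : IsProblemHamiltonian E (11 / 500)) {s : ℝ}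
    (h1 : crossing E - crossingWidth E ≤ s) (h2 : s ≤ crossing E) :
    gapBound E s = minGap E / 10 := by
  rcases h2.lt_or_eq with h | h
  · rw [gapBound, if_neg (by linarith), if_pos h]
    ring
  · rw [hE.gapBound_of_ge h.ge, h]
    ring

lemma le_gapBound (hE : IsProblemHamiltonian E (11 / 500)) (s : ℝ) :
    minGap E / 10 ≤ gapBound E s := by
  rcases le_total s (crossing E - crossingWidth E) with h | h
  · rw [hE.gapBound_of_le h, ← hE.leftSlope_mul_crossingWidth]
    exact mul_le_mul_of_nonneg_left (by linarith) hE.leftSlope_pos.le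
  rcases le_total s (crossing E) with h' | h'
  · rw [hE.gapBound_of_mem h h']
  · rw [hE.gapBound_of_ge h']
    linarith [mul_nonneg hE.rightSlope_pos.le (sub_nonneg.2 h')]

lemma gapBound_pos (hE : IsProblemHamiltonian E (11 / 500)) (s : ℝ) : 0 < gapBound E s :=
  (div_pos hE.minGap_pos (by norm_num)).trans_le (hE.le_gapBound s)

lemma continuous_gapBound (hE : IsProblemHamiltonian E (11 / 500)) : Continuous (gapBound E) := by
  have e : gapBound E = fun s => if s ≤ crossing E then
      (if s ≤ crossing E - crossingWidth E then leftSlope E * (crossing E - s) else minGap E / 10)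
      else minGap E / 10 + rightSlope E * (s - crossing E) := by
    funext s
    split_ifs with h1 h2
    · exact hE.gapBound_of_le h2
    · exact hE.gapBound_of_mem (not_le.1 h2).le h1
    · exact hE.gapBound_of_ge (not_le.1 h1).le
  rw [e]
  have hδ := hE.crossingWidth_pos
  refine Continuous.if_le (Continuous.if_le ?_ ?_ ?_ ?_ ?_) ?_ ?_ ?_ ?_ <;> try fun_prop
  · rintro s rfl
    rw [sub_sub_cancel, hE.leftSlope_mul_crossingWidth]
  · rintro s rfl
    rw [if_neg (by linarith), sub_self, mul_zero, add_zero]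

end IsProblemHamiltonian

/-! ### The gap at the two ends of the schedule -/

lemma symmetricSpectrum_one : symmetricSpectrum E 1 = (levels E : Set ℝ) := by
  ext l
  constructor
  · rintro ⟨v, -, hv0, hl⟩
    have hz : ∃ z, v z ≠ 0 := by
      by_contra! hcon
      exact hv0 (by ext z; simp [hcon z])
    obtain ⟨z, hz⟩ := hz
    have h := congrArg (fun w : Qubits n => w z) hl
    simp only [adiabaticOp_apply, PiLp.smul_apply, smul_eq_mul, Complex.ofReal_one, one_mul,
      sub_self, zero_mul, sub_zero] at h
    have h' : E z = l := Complex.ofReal_injective (mul_right_cancel₀ hz h)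
    simp [levels, ← h']
  · intro hl
    have hd : 0 < degeneracy E l := by
      obtain ⟨z, -, hz⟩ := Finset.mem_image.1 hl
      exact Finset.card_pos.2 ⟨z, by simp [hz]⟩
    refine ⟨levelState E l, Submodule.subset_span ⟨l, hl, rfl⟩, fun h => ?_, ?_⟩
    · simpa [h] using norm_levelState hd
    · ext z
      rw [adiabaticOp_apply, PiLp.smul_apply, smul_eq_mul]
      by_cases h : E z = l
      · simp [h]
      · simp [levelState, h]

lemma adiabaticGap_one : adiabaticGap E 1 = problemGap E := by
  rw [adiabaticGap, symmetricSpectrum_one, problemGap, excitedLevels, Finset.coe_erase]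
  rfl

lemma symmetricSpectrum_zero {c : ℝ} (hE : IsProblemHamiltonian E c) :
    symmetricSpectrum E 0 = {-1, 0} := by
  have hplus : (WithLp.toLp 2 fun _ => 1 : RealQubits n) ≠ 0 := fun h => by
    simpa using congrArg (fun v : RealQubits n => v fun _ => false) h
  ext l
  simp only [Set.mem_insert_iff, Set.mem_singleton_iff]
  constructor
  · rintro ⟨v, -, hv0, hl⟩
    have h : ∀ z, -(1 / 2 ^ n * ∑ z', v z') = l * v z := by
      intro z
      have h := congrArg (fun w : Qubits n => w z) hl
      simpa only [adiabaticOp_apply, PiLp.smul_apply, smul_eq_mul, Complex.ofReal_zero, zero_mul,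
        zero_sub, sub_zero, one_mul] using h
    by_cases hs : ∑ z, v z = 0
    · right
      have hz : ∃ z, v z ≠ 0 := by
        by_contra! hcon
        exact hv0 (by ext z; simp [hcon z])
      obtain ⟨z, hz⟩ := hz
      have := h z
      rw [hs, mul_zero, neg_zero] at this
      exact_mod_cast (mul_eq_zero.1 this.symm).resolve_right hz
    · left
      have hsum := Finset.sum_congr (s₁ := Finset.univ) rfl fun z _ => h z
      rw [← Finset.mul_sum, Finset.sum_const, Finset.card_univ, nsmul_eq_mul] at hsum
      simp only [Fintype.card_pi, Fintype.card_bool, Finset.prod_const, Finset.card_univ,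
        Fintype.card_fin] at hsum
      have h2 : -(∑ z, v z) = l * ∑ z, v z := by
        rw [← hsum]
        push_cast
        field_simp
      have h3 : ((-1 : ℝ) : ℂ) = l := mul_right_cancel₀ hs (by rw [← h2]; push_cast; ring)
      exact_mod_cast h3.symm
  · rintro (rfl | rfl)
    · refine mem_symmetricSpectrum_of_real (v := WithLp.toLp 2 fun _ => 1) (fun _ _ _ => rfl)
        hplus ?_
      ext z
      simp [realOp_apply]
    · set p : ℝ := (groundDegeneracy E : ℝ) with hp
      set q : ℝ := ((excitedStates E).card : ℝ) with hq
      have hq0 : 0 < q := by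
        rw [hq]
        exact_mod_cast Finset.card_pos.2 hE.excitedStates_nonempty
      obtain ⟨z₀, hz₀⟩ := exists_eq_groundEnergy (E := E)
      refine mem_symmetricSpectrum_of_real
        (v := WithLp.toLp 2 fun z => if E z = groundEnergy E then q else -p)
        (fun z z' h => by simp [h]) (fun h => ?_) ?_
      · have := congrArg (fun v : RealQubits n => v z₀) h
        simp [hz₀, hq0.ne'] at this
      · ext z
        rw [realOp_apply, sum_ground_add_sum_excited]
        dsimp only
        rw [Finset.sum_congr rfl (g := fun z => q) fun z hz => by
            rw [if_pos (Finset.mem_filter.1 hz).2],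
          Finset.sum_congr (s₁ := excitedStates E) rfl (g := fun z => -p) fun z hz => by
            rw [if_neg (mem_excitedStates.1 hz)]]
        simp only [Finset.sum_const, nsmul_eq_mul, ← hq]
        rw [show ((Finset.univ.filter fun z => E z = groundEnergy E).card : ℝ) = p from rfl]
        simp
        ring

lemma adiabaticGap_zero {c : ℝ} (hE : IsProblemHamiltonian E c) : adiabaticGap E 0 = 1 := by
  have h1 : sInf ({-1, 0} : Set ℝ) = -1 := by
    rw [csInf_pair]
    norm_num
  have h2 : ({-1, 0} : Set ℝ) \ {-1} = {0} := by
    ext x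
    simp only [Set.mem_sdiff, Set.mem_insert_iff, Set.mem_singleton_iff]
    constructor
    · rintro ⟨rfl | rfl, h⟩
      · exact absurd rfl h
      · rfl
    · rintro rfl
      norm_num
  rw [adiabaticGap, symmetricSpectrum_zero hE, h1, h2, csInf_singleton]
  norm_num

/-! ### The gap in between -/

/-- The secular equation for the lowest eigenvalue `s (E₀ - a)`, with the ground level split off. -/
lemma secular_ground {s a : ℝ} (hs : s ∈ Set.Ioo (0 : ℝ) 1)
    (ha : a = (inverseDepth E s)⁻¹) :
    s / (1 - s) = groundWeight E / a +
      1 / 2 ^ n * ∑ z ∈ excitedStates E, 1 / (E z - groundEnergy E + a) := by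
  have hy := inverseDepth_pos (E := E) hs
  have ha0 : 0 < a := ha ▸ inv_pos.2 hy
  have hya : inverseDepth E s = a⁻¹ := by rw [ha, inv_inv]
  have hterm : ∀ z : Bits n, a⁻¹ * (1 + a⁻¹ * (E z - groundEnergy E))⁻¹ =
      1 / (E z - groundEnergy E + a) := by
    intro z
    rw [← mul_inv, one_div]
    congr 1
    field_simp
    ring
  rw [← inverseDepth_mul_meanResolvent (E := E) hs, mul_meanResolvent_eq, hya,
    Finset.sum_congr rfl fun z _ => hterm z, sum_ground_add_sum_excited, mul_add]
  congr 1
  rw [Finset.sum_congr rfl (g := fun _ => 1 / a) fun z hz => by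
    rw [(Finset.mem_filter.1 hz).2, sub_self, zero_add]]
  rw [Finset.sum_const, nsmul_eq_mul, groundWeight, groundDegeneracy, degeneracy]
  ring

namespace IsProblemHamiltonian

/-- Cauchy–Schwarz; it amounts to the variational bound from the trial state with amplitudes
`1 / (E z - E₀)` above the ground level. -/
lemma sq_spectralParam_one_le_mul (hE : IsProblemHamiltonian E (11 / 500)) {s a : ℝ}
    (hs : s ∈ Set.Ioo (0 : ℝ) 1) (ha : a = (inverseDepth E s)⁻¹) :
    spectralParam E 1 ^ 2 ≤ s / (1 - s) * (spectralParam E 1 + a * spectralParam E 2) := by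
  have ha0 : 0 < a := ha ▸ inv_pos.2 (inverseDepth_pos hs)
  have he : ∀ z ∈ excitedStates E, 0 < E z - groundEnergy E := fun z hz =>
    hE.problemGap_pos.trans_le (problemGap_le_sub hz)
  have hCS := Finset.sum_sq_le_sum_mul_sum_of_sq_le_mul (excitedStates E)
    (r := fun z => 1 / (E z - groundEnergy E))
    (f := fun z => 1 / (E z - groundEnergy E + a))
    (g := fun z => (E z - groundEnergy E + a) * (1 / (E z - groundEnergy E) ^ 2))
    (fun z hz => by have := he z hz; positivity) (fun z hz => by have := he z hz; positivity)
    (fun z hz => by have := he z hz; exact le_of_eq (by field_simp))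
  have hg : ∑ z ∈ excitedStates E,
      (E z - groundEnergy E + a) * (1 / (E z - groundEnergy E) ^ 2) =
      2 ^ n * (spectralParam E 1 + a * spectralParam E 2) := by
    rw [spectralParam_eq, spectralParam_eq, mul_left_comm a, ← mul_add, ← mul_assoc, mul_one_div,
      div_self (by positivity), one_mul, Finset.mul_sum, ← Finset.sum_add_distrib]
    refine Finset.sum_congr rfl fun z hz => ?_
    field_simp
  rw [hg] at hCS
  have hA : spectralParam E 1 = 1 / 2 ^ n * ∑ z ∈ excitedStates E, 1 / (E z - groundEnergy E) := by
    rw [spectralParam_eq]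
    simp only [pow_one]
  have hr : 1 / 2 ^ n * ∑ z ∈ excitedStates E, 1 / (E z - groundEnergy E + a) ≤ s / (1 - s) := by
    rw [secular_ground hs ha]
    have := div_pos (groundWeight_pos (E := E)) ha0
    linarith
  have hpos : 0 ≤ spectralParam E 1 + a * spectralParam E 2 := by
    have h1 := hE.spectralParam_pos 1
    have h2 := hE.spectralParam_pos 2
    positivity
  refine le_trans ?_ (mul_le_mul_of_nonneg_right hr hpos)
  conv_lhs => rw [hA]
  rw [mul_pow]
  calc (1 / 2 ^ n) ^ 2 * (∑ z ∈ excitedStates E, 1 / (E z - groundEnergy E)) ^ 2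
      ≤ (1 / 2 ^ n) ^ 2 * ((∑ z ∈ excitedStates E, 1 / (E z - groundEnergy E + a)) *
        (2 ^ n * (spectralParam E 1 + a * spectralParam E 2))) :=
        mul_le_mul_of_nonneg_left hCS (by positivity)
    _ = _ := by
        field_simp

/-- Up to the crossing, the lowest eigenvalue is at least `s √(w / A₂)` below `s E₀`. -/
lemma crossingScale_le_inv (hE : IsProblemHamiltonian E (11 / 500)) {s a : ℝ}
    (hs : s ∈ Set.Ioo (0 : ℝ) 1) (ha : a = (inverseDepth E s)⁻¹)
    (hr : s / (1 - s) ≤ spectralParam E 1) : crossingScale E ≤ a := by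
  have ha0 : 0 < a := ha ▸ inv_pos.2 (inverseDepth_pos hs)
  have h2 := hE.spectralParam_pos 2
  have he : ∀ z ∈ excitedStates E, 0 < E z - groundEnergy E := fun z hz =>
    hE.problemGap_pos.trans_le (problemGap_le_sub hz)
  have hsum : spectralParam E 1 - a * spectralParam E 2 ≤
      1 / 2 ^ n * ∑ z ∈ excitedStates E, 1 / (E z - groundEnergy E + a) := by
    rw [spectralParam_eq, spectralParam_eq, mul_left_comm a, ← mul_sub, Finset.mul_sum,
      ← Finset.sum_sub_distrib]
    refine mul_le_mul_of_nonneg_left (Finset.sum_le_sum fun z hz => ?_) (by positivity)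
    have h := he z hz
    rw [pow_one, mul_one_div, div_sub_div _ _ h.ne' (by positivity),
      div_le_div_iff₀ (by positivity) (by positivity)]
    nlinarith [mul_pos h (pow_pos ha0 2)]
  have hw : groundWeight E ≤ a ^ 2 * spectralParam E 2 := by
    have h := secular_ground hs ha
    have h3 : groundWeight E / a ≤ a * spectralParam E 2 := by linarith
    rw [div_le_iff₀ ha0] at h3
    linarith
  rw [← hE.crossingScale_sq_mul] at hw
  exact (sq_le_sq₀ hE.crossingScale_pos.le ha0.le).1 (le_of_mul_le_mul_right hw h2)

lemma gapBound_le_adiabaticGap_of_lt (hE : IsProblemHamiltonian E (11 / 500)) {s : ℝ}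
    (hs : s ∈ Set.Ioo (0 : ℝ) 1) (hsc : s < crossing E) : gapBound E s ≤ adiabaticGap E s := by
  obtain ⟨a, ha⟩ : ∃ a, a = (inverseDepth E s)⁻¹ := ⟨_, rfl⟩
  have ha0 : 0 < a := ha ▸ inv_pos.2 (inverseDepth_pos hs)
  have h1 := hE.spectralParam_pos 1
  have h2 := hE.spectralParam_pos 2
  have h1s := sub_pos.2 hs.2
  refine le_adiabaticGap hE hs fun l _ hl => ?_
  have hla : s * a ≤ l - groundValue E s := by
    rw [groundValue, div_eq_mul_inv, ← ha]
    linarith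
  refine le_trans ?_ hla
  rcases le_total s (crossing E - crossingWidth E) with h | h
  · rw [hE.gapBound_of_le h]
    have hcs := hE.sq_spectralParam_one_le_mul hs ha
    rw [div_mul_eq_mul_div, le_div_iff₀ h1s] at hcs
    have e : leftSlope E * (crossing E - s) =
        spectralParam E 1 * (spectralParam E 1 * (1 - s) - s) / (10 * spectralParam E 2) := by
      rw [leftSlope, crossing]
      field_simp
      ring
    rw [e, div_le_iff₀ (by positivity)]
    nlinarith [mul_pos (mul_pos hs.1 ha0) h2]
  · rw [hE.gapBound_of_mem h hsc.le, minGap_eq_crossing]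
    have hr : s / (1 - s) ≤ spectralParam E 1 := by
      rw [crossing, lt_div_iff₀ (by linarith)] at hsc
      rw [div_le_iff₀ h1s]
      linarith
    have hk := hE.crossingScale_le_inv hs ha hr
    have hw := hE.crossingWidth_le
    have hc := hE.crossing_pos
    have hs2 : crossing E / 2 ≤ s := by linarith
    have := mul_le_mul hs2 hk hE.crossingScale_pos.le hs.1.le
    nlinarith [mul_pos hc hE.crossingScale_pos]

/-- The secular equation for an eigenvalue `s (E₀ + b)` with `0 < b < Δ`, compared with its value
at the crossing. -/
lemma secular_excited (hE : IsProblemHamiltonian E (11 / 500)) {s b : ℝ}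
    (hs : s ∈ Set.Ioo (0 : ℝ) 1) (hl : s * (groundEnergy E + b) ∈ symmetricSpectrum E s)
    (hb : 0 < b) (hbΔ : b < problemGap E) :
    (s / (1 - s) - spectralParam E 1 + groundWeight E / b) * (problemGap E - b) ≤
      b * (spectralParam E 2 * problemGap E) := by
  obtain ⟨-, hsec⟩ := secular_equation hs hl
  have h1s := sub_pos.2 hs.2
  have hΔb := sub_pos.2 hbΔ
  have hterm : ∀ z : Bits n, 1 / (s * E z - s * (groundEnergy E + b)) =
      s⁻¹ * (1 / (E z - groundEnergy E - b)) := by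
    intro z
    rw [one_div, one_div, ← mul_inv]
    congr 1
    ring
  have hr : s / (1 - s) = -(groundWeight E / b) +
      1 / 2 ^ n * ∑ z ∈ excitedStates E, 1 / (E z - groundEnergy E - b) := by
    rw [Finset.sum_congr rfl fun z _ => hterm z, ← Finset.mul_sum, sum_ground_add_sum_excited,
      Finset.sum_congr (s₁ := Finset.univ.filter fun z => E z = groundEnergy E) rfl
        (g := fun _ => 1 / (-b)) fun z hz => by
          rw [(Finset.mem_filter.1 hz).2, sub_self, zero_sub], Finset.sum_const, nsmul_eq_mul] at hsec
    rw [groundWeight, groundDegeneracy, degeneracy, div_eq_iff h1s.ne']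
    have hs0 := hs.1.ne'
    field_simp at hsec ⊢
    linarith
  have hsum : 1 / 2 ^ n * ∑ z ∈ excitedStates E, 1 / (E z - groundEnergy E - b) ≤
      spectralParam E 1 + b * (problemGap E / (problemGap E - b)) * spectralParam E 2 := by
    rw [spectralParam_eq, spectralParam_eq, mul_left_comm (b * _), ← mul_add,
      Finset.mul_sum (excitedStates E) _ (b * _), ← Finset.sum_add_distrib]
    refine mul_le_mul_of_nonneg_left (Finset.sum_le_sum fun z hz => ?_) (by positivity)
    have h := problemGap_le_sub hz
    have h0 := hE.problemGap_pos.trans_le h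
    have h3 : 0 < E z - groundEnergy E - b := by linarith
    rw [pow_one, mul_one_div, mul_div_assoc', div_div, div_add_div _ _ h0.ne' (by positivity),
      div_le_div_iff₀ h3 (by positivity)]
    set e := E z - groundEnergy E
    set D := problemGap E
    have key : 0 ≤ e * (b ^ 2 * (e - D)) := by
      have := sub_nonneg.2 h
      positivity
    nlinarith [key]
  have h4 : s / (1 - s) - spectralParam E 1 + groundWeight E / b ≤
      b * (problemGap E / (problemGap E - b)) * spectralParam E 2 := by linarith
  calc _ ≤ b * (problemGap E / (problemGap E - b)) * spectralParam E 2 * (problemGap E - b) :=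
        mul_le_mul_of_nonneg_right h4 hΔb.le
    _ = _ := by field_simp

lemma gapBound_le_adiabaticGap_of_ge (hE : IsProblemHamiltonian E (11 / 500)) {s : ℝ}
    (hs : s ∈ Set.Ioo (0 : ℝ) 1) (hsc : crossing E ≤ s) : gapBound E s ≤ adiabaticGap E s := by
  have h1 := hE.spectralParam_pos 1
  have h2 := hE.spectralParam_pos 2
  have h1s := sub_pos.2 hs.2
  have hΔ := hE.problemGap_pos
  have hc := hE.crossing_pos
  have hk := hE.crossingScale_pos
  refine le_adiabaticGap hE hs fun l hl hlt => ?_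
  set b := l / s - groundEnergy E with hb
  have hlb : l = s * (groundEnergy E + b) := by
    rw [hb]
    have := hs.1.ne'
    field_simp
    ring
  have hb0 : 0 < b := by
    rw [hlb] at hlt
    have : 0 < s * b := by linarith
    exact pos_of_mul_pos_right this hs.1.le
  have hlg : s * b ≤ l - groundValue E s := by
    have := div_pos hs.1 (inverseDepth_pos (E := E) hs)
    rw [groundValue, hlb]
    linarith
  refine le_trans ?_ hlg
  -- `t` is the position of `s` between the crossing and the end.
  set t := s * (spectralParam E 1 + 1) - spectralParam E 1 with ht
  have ht0 : 0 ≤ t := by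
    rw [crossing, div_le_iff₀ (by linarith)] at hsc
    linarith
  have ht1 : 1 - t = (1 - s) * (spectralParam E 1 + 1) := by rw [ht]; ring
  have ht1' : 0 < 1 - t := by
    rw [ht1]
    positivity
  have hbound : gapBound E s = problemGap E / 30 * t + (1 - t) * (minGap E / 10) := by
    rw [hE.gapBound_of_ge hsc, rightSlope, ht, crossing]
    field_simp
    ring
  have hfirst : problemGap E * t ≤ b := by
    by_cases hbΔ : b < problemGap E
    · have h := hE.secular_excited hs (hlb ▸ hl) hb0 hbΔ
      have hΔb := sub_pos.2 hbΔ
      have hA := hE.spectralParam_succ_mul_gap_le 1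
      norm_num at hA
      have hρ : s / (1 - s) - spectralParam E 1 = t * (spectralParam E 1 + 1) / (1 - t) := by
        rw [ht1, mul_div_mul_right _ _ (by positivity), ht]
        field_simp
        ring
      rw [hρ, add_mul] at h
      have hpos : 0 ≤ groundWeight E / b * (problemGap E - b) :=
        mul_nonneg (div_pos groundWeight_pos hb0).le hΔb.le
      have h5 : t * (spectralParam E 1 + 1) / (1 - t) * (problemGap E - b) ≤
          b * (spectralParam E 1 + 1) := by
        have : b * (spectralParam E 2 * problemGap E) ≤ b * (spectralParam E 1 + 1) :=
          mul_le_mul_of_nonneg_left (by linarith) hb0.le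
        linarith
      rw [div_mul_eq_mul_div, div_le_iff₀ ht1'] at h5
      have h6 : (t * (problemGap E - b)) * (spectralParam E 1 + 1) ≤
          (b * (1 - t)) * (spectralParam E 1 + 1) := by linarith
      have h7 := le_of_mul_le_mul_right h6 (by linarith)
      linarith
    · have : problemGap E * t ≤ problemGap E := mul_le_of_le_one_right hΔ.le (by linarith)
      linarith
  have hsecond : crossingScale E ≤ 2 * b := by
    by_cases hbΔ : b < problemGap E / 2
    · have h := hE.secular_excited hs (hlb ▸ hl) hb0 (by linarith)
      have hρ : 0 ≤ s / (1 - s) - spectralParam E 1 := by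
        rw [sub_nonneg, le_div_iff₀ h1s]
        linarith
      have h5 : groundWeight E / b * (problemGap E / 2) ≤
          b * (spectralParam E 2 * problemGap E) := by
        have hb' : problemGap E / 2 ≤ problemGap E - b := by linarith
        have hw := div_pos (groundWeight_pos (E := E)) hb0
        exact (mul_le_mul (le_add_of_nonneg_left hρ) hb' (by positivity) (by linarith)).trans h
      rw [div_mul_eq_mul_div, div_le_iff₀ hb0, ← hE.crossingScale_sq_mul] at h5
      have h6 : crossingScale E ^ 2 * (spectralParam E 2 * problemGap E) ≤
          2 * b ^ 2 * (spectralParam E 2 * problemGap E) := by linarith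
      have h7 := le_of_mul_le_mul_right h6 (by positivity)
      nlinarith
    · linarith [hE.crossingScale_lt]
  rw [hbound, minGap_eq_crossing]
  have h8 : (1 - t) * (2 * crossing E * crossingScale E / 10) ≤
      2 * crossing E * crossingScale E / 10 :=
    mul_le_of_le_one_left (by positivity) (by linarith)
  have h9 : crossing E * b ≤ s * b := mul_le_mul_of_nonneg_right hsc hb0.le
  have h10 := mul_le_mul_of_nonneg_left hsecond hc.le
  have h11 := mul_le_mul_of_nonneg_right hE.four_ninths_le_crossing hb0.le
  linarith

theorem gapBound_le_adiabaticGap (hE : IsProblemHamiltonian E (11 / 500)) {s : ℝ}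
    (hs : s ∈ Set.Icc (0 : ℝ) 1) : gapBound E s ≤ adiabaticGap E s := by
  have h1 := hE.spectralParam_pos 1
  have hδ := hE.crossingWidth_le
  have hc := hE.crossing_pos
  rcases hs.1.eq_or_lt with rfl | h0
  · rw [adiabaticGap_zero hE, hE.gapBound_of_le (by linarith), sub_zero]
    have hc1 := hE.crossing_lt_one
    exact mul_le_one₀ hE.leftSlope_le_one hc.le hc1.le
  rcases hs.2.eq_or_lt with rfl | h1'
  · rw [adiabaticGap_one, hE.gapBound_of_ge hE.crossing_lt_one.le, rightSlope, hE.one_sub_crossing]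
    have hg := hE.problemGap_pos
    rw [mul_one_div, mul_div_cancel_right₀ _ (by positivity)]
    linarith
  rcases lt_or_ge s (crossing E) with h | h
  · exact hE.gapBound_le_adiabaticGap_of_lt ⟨h0, h1'⟩ h
  · exact hE.gapBound_le_adiabaticGap_of_ge ⟨h0, h1'⟩ h

end IsProblemHamiltonian

/-! ### Perturbation theory of an isolated eigenvector -/

section Perturbation

variable {V : Type*} [NormedAddCommGroup V] [InnerProductSpace ℝ V]

/-- The derivative of the equation `(H₀ + σ K) x = λ x + y`. -/
lemma deriv_eigen_equation {H₀ K : V →L[ℝ] V} {x y : ℝ → V} {lam : ℝ → ℝ} {x' y' : V} {lam' s : ℝ}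
    (hx : HasDerivAt x x' s) (hy : HasDerivAt y y' s) (hl : HasDerivAt lam lam' s)
    (h : ∀ᶠ σ in 𝓝 s, (H₀ + σ • K) (x σ) = lam σ • x σ + y σ) :
    (H₀ + s • K) x' - lam s • x' = lam' • x s - K (x s) + y' := by
  have h1 : HasDerivAt (fun σ => (H₀ + σ • K) (x σ)) (H₀ x' + (s • K x' + (1 : ℝ) • K (x s))) s := by
    have e0 := H₀.hasFDerivAt.comp_hasDerivAt s hx
    have e1 := (hasDerivAt_id s).smul (K.hasFDerivAt.comp_hasDerivAt s hx)
    exact e0.add e1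
  have h2 := (hl.smul hx).add hy
  have h3 := h1.unique (h2.congr_of_eventuallyEq h)
  have h4 : (H₀ + s • K) x' = H₀ x' + s • K x' := rfl
  rw [one_smul] at h3
  rw [h4, sub_eq_iff_eq_add]
  have h5 : H₀ x' + s • K x' = (H₀ x' + (s • K x' + K (x s))) - K (x s) := by abel
  rw [h5, h3]
  abel

/-- First and second order bounds for an isolated eigenvector `φ` of `H₀ + s K` with `‖K‖ ≤ 2`.
Here `g` bounds the gap from below, and `χ` is the reduced resolvent applied to `φ'`. The vectors may
be confined to an invariant subspace `U`, on which alone the gap is assumed. -/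
theorem norm_le_of_gap {H₀ K : V →L[ℝ] V} {U : Submodule ℝ V} {φ φ₁ χ : ℝ → V}
    {lam lam₁ : ℝ → ℝ} {φ₂ χ₁ : V} {lam₂ g s : ℝ} (hg : 0 < g)
    (hsymm : ∀ x y, inner ℝ ((H₀ + s • K) x) y = inner ℝ x ((H₀ + s • K) y))
    (hK : ∀ x, ‖K x‖ ≤ 2 * ‖x‖)
    (hgap : ∀ x ∈ U, inner ℝ (φ s) x = 0 →
      g * ‖x‖ ^ 2 ≤ inner ℝ x ((H₀ + s • K) x - lam s • x))
    (hφ : ∀ᶠ σ in 𝓝 s, HasDerivAt φ (φ₁ σ) σ) (hφ₁ : HasDerivAt φ₁ φ₂ s)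
    (hlam : ∀ᶠ σ in 𝓝 s, HasDerivAt lam (lam₁ σ) σ) (hlam₁ : HasDerivAt lam₁ lam₂ s)
    (hχ : HasDerivAt χ χ₁ s)
    (heig : ∀ᶠ σ in 𝓝 s, (H₀ + σ • K) (φ σ) = lam σ • φ σ)
    (hnorm : ∀ᶠ σ in 𝓝 s, ‖φ σ‖ = 1)
    (hres : ∀ᶠ σ in 𝓝 s, (H₀ + σ • K) (χ σ) = lam σ • χ σ + φ₁ σ)
    (hort : ∀ᶠ σ in 𝓝 s, inner ℝ (φ σ) (χ σ) = 0)
    (hU : φ s ∈ U) (hU₁ : φ₁ s ∈ U) (hU₂ : φ₂ ∈ U) (hUχ : χ s ∈ U) (hUχ₁ : χ₁ ∈ U) :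
    ‖φ₁ s‖ ≤ 4 / g ∧ ‖χ s‖ ≤ 4 / g ^ 2 ∧ ‖χ₁‖ ≤ 80 / g ^ 3 := by
  have n0 : ‖φ s‖ = 1 := hnorm.self_of_nhds
  have eig := heig.self_of_nhds
  have hφs := hφ.self_of_nhds
  have bound : ∀ {x w : V} {m : ℝ}, x ∈ U → inner ℝ (φ s) x = 0 →
      (∃ c : ℝ, (H₀ + s • K) x - lam s • x = w + c • φ s) → ‖w‖ ≤ m → ‖x‖ ≤ m / g := by
    rintro x w m hx hox ⟨c, hc⟩ hw
    have h1 := hgap x hx hox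
    rw [hc, inner_add_right, real_inner_smul_right, real_inner_comm (φ s) x, hox, mul_zero,
      add_zero, real_inner_comm] at h1
    rcases eq_or_ne x 0 with rfl | hx0
    · rw [norm_zero]
      exact div_nonneg ((norm_nonneg _).trans hw) hg.le
    · have hxn := norm_pos_iff.2 hx0
      have h2 := (real_inner_le_norm w x).trans (mul_le_mul_of_nonneg_right hw hxn.le)
      rw [le_div_iff₀ hg]
      exact le_of_mul_le_mul_right (by nlinarith) hxn
  -- The three differentiated equations.
  have e1 : ∀ᶠ σ in 𝓝 s, (H₀ + σ • K) (φ₁ σ) =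
      lam σ • φ₁ σ + (lam₁ σ • φ σ - K (φ σ)) := by
    filter_upwards [hφ, hlam, heig.eventually_nhds] with σ h1 h2 h3
    have := deriv_eigen_equation (y := fun _ => 0) h1 (hasDerivAt_const σ 0) h2 (by simpa using h3)
    rw [add_zero, sub_eq_iff_eq_add'] at this
    exact this
  have hy : HasDerivAt (fun σ => lam₁ σ • φ σ - K (φ σ))
      (lam₁ s • φ₁ s + lam₂ • φ s - K (φ₁ s)) s :=
    (hlam₁.smul hφs).sub (K.hasFDerivAt.comp_hasDerivAt s hφs)
  have e2 := deriv_eigen_equation hφ₁ hy hlam.self_of_nhds e1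
  have e3 := deriv_eigen_equation hχ hφ₁ hlam.self_of_nhds hres
  -- The components along `φ`.
  have o1 : ∀ᶠ σ in 𝓝 s, inner ℝ (φ σ) (φ₁ σ) = 0 := by
    filter_upwards [hφ, hnorm.eventually_nhds] with σ h1 h2
    have h3 := (h1.inner ℝ h1).unique
      ((hasDerivAt_const σ (1 : ℝ)).congr_of_eventuallyEq (by
        filter_upwards [h2] with τ hτ
        rw [real_inner_self_eq_norm_sq, hτ, one_pow]))
    rw [real_inner_comm (φ σ) (φ₁ σ)] at h3
    linarith
  have o2 : inner ℝ (φ s) φ₂ + ‖φ₁ s‖ ^ 2 = 0 := by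
    rw [← real_inner_self_eq_norm_sq]
    exact (hφs.inner ℝ hφ₁).unique ((hasDerivAt_const s (0 : ℝ)).congr_of_eventuallyEq o1)
  have o3 : inner ℝ (φ s) χ₁ + inner ℝ (φ₁ s) (χ s) = 0 :=
    (hφs.inner ℝ hχ).unique ((hasDerivAt_const s (0 : ℝ)).congr_of_eventuallyEq hort)
  have nφφ : inner ℝ (φ s) (φ s) = (1 : ℝ) := by rw [real_inner_self_eq_norm_sq, n0, one_pow]
  have l1 : |lam₁ s| ≤ 2 := by
    have h1 : inner ℝ (φ s) ((H₀ + s • K) (φ₁ s)) = 0 := by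
      rw [← hsymm, eig, real_inner_smul_left, o1.self_of_nhds, mul_zero]
    rw [e1.self_of_nhds, inner_add_right, real_inner_smul_right, o1.self_of_nhds, mul_zero,
      zero_add, inner_sub_right, real_inner_smul_right, nφφ, mul_one, sub_eq_zero] at h1
    rw [h1]
    refine (abs_real_inner_le_norm _ _).trans ?_
    have := hK (φ s)
    rw [n0] at this ⊢
    linarith
  have nK : ∀ x : V, ‖lam₁ s • x - K x‖ ≤ 4 * ‖x‖ := by
    intro x
    refine (norm_sub_le _ _).trans ?_
    rw [norm_smul, Real.norm_eq_abs]
    nlinarith [hK x, mul_le_mul_of_nonneg_right l1 (norm_nonneg x)]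
  have b1 : ‖φ₁ s‖ ≤ 4 / g := by
    refine bound hU₁ o1.self_of_nhds (w := lam₁ s • φ s - K (φ s)) ⟨0, ?_⟩ ?_
    · rw [e1.self_of_nhds]
      simp
    · simpa [n0] using nK (φ s)
  have b2 : ‖χ s‖ ≤ 4 / g ^ 2 := by
    have := bound hUχ hort.self_of_nhds (w := φ₁ s) ⟨0, by rw [hres.self_of_nhds]; simp⟩ b1
    rwa [div_div, ← sq] at this
  have b3 : ‖φ₂ + ‖φ₁ s‖ ^ 2 • φ s‖ ≤ 32 / g ^ 2 := by
    have h1 := bound (x := φ₂ + ‖φ₁ s‖ ^ 2 • φ s) (w := (2 : ℝ) • (lam₁ s • φ₁ s - K (φ₁ s)))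
      (m := 2 * (4 * (4 / g))) (U.add_mem hU₂ (U.smul_mem _ hU))
      (by rw [inner_add_right, real_inner_smul_right, nφφ, mul_one, o2])
      ⟨lam₂, by
        rw [map_add, map_smul, eig, smul_add, smul_comm (lam s), add_sub_add_right_eq_sub, e2,
          two_smul]
        abel⟩ ?_
    · refine h1.trans (le_of_eq ?_)
      field_simp
      norm_num
    · rw [norm_smul, Real.norm_eq_abs, abs_two]
      have := nK (φ₁ s)
      linarith
  have b4 : ‖φ₂‖ ≤ 48 / g ^ 2 := by
    have h1 := norm_sub_le (φ₂ + ‖φ₁ s‖ ^ 2 • φ s) (‖φ₁ s‖ ^ 2 • φ s)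
    rw [add_sub_cancel_right, norm_smul, n0, mul_one, norm_pow, norm_norm] at h1
    have h2 : ‖φ₁ s‖ ^ 2 ≤ (4 / g) ^ 2 := by gcongr
    have h3 : (4 / g) ^ 2 = 16 / g ^ 2 := by rw [div_pow]; norm_num
    have h4 : 48 / g ^ 2 = 32 / g ^ 2 + 16 / g ^ 2 := by ring
    linarith
  have b5 : ‖χ₁ + (inner ℝ (φ₁ s) (χ s) : ℝ) • φ s‖ ≤ 64 / g ^ 3 := by
    have h1 := bound (x := χ₁ + (inner ℝ (φ₁ s) (χ s) : ℝ) • φ s)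
      (w := lam₁ s • χ s - K (χ s) + φ₂) (m := 64 / g ^ 2)
      (U.add_mem hUχ₁ (U.smul_mem _ hU))
      (by rw [inner_add_right, real_inner_smul_right, nφφ, mul_one, o3])
      ⟨0, by
        rw [map_add, map_smul, eig, smul_add, smul_comm (lam s), add_sub_add_right_eq_sub, e3,
          zero_smul, add_zero]⟩ ?_
    · rwa [div_div, ← pow_succ] at h1
    · refine (norm_add_le _ _).trans ?_
      have h2 := nK (χ s)
      have h4 : 64 / g ^ 2 = 4 * (4 / g ^ 2) + 48 / g ^ 2 := by ring
      linarith
  refine ⟨b1, b2, ?_⟩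
  have h1 := norm_sub_le (χ₁ + (inner ℝ (φ₁ s) (χ s) : ℝ) • φ s) ((inner ℝ (φ₁ s) (χ s) : ℝ) • φ s)
  rw [add_sub_cancel_right, norm_smul, n0, mul_one, Real.norm_eq_abs] at h1
  have h2 : |inner ℝ (φ₁ s) (χ s)| ≤ 4 / g * (4 / g ^ 2) :=
    (abs_real_inner_le_norm _ _).trans (mul_le_mul b1 b2 (norm_nonneg _) (by positivity))
  have h3 : 4 / g * (4 / g ^ 2) = 16 / g ^ 3 := by
    field_simp
    norm_num
  have h4 : 80 / g ^ 3 = 64 / g ^ 3 + 16 / g ^ 3 := by ring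
  linarith

end Perturbation

/-- The inverse of the diagonal part of `H(s) - λ`, applied to the derivative of the ground vector. -/
noncomputable def diagonalResponse (E : Bits n → ℝ) (s : ℝ) : RealQubits n :=
  WithLp.toLp 2 fun z => (s * E z - groundValue E s)⁻¹ * deriv (groundVector E) s z

/-- The reduced resolvent of `H(s)` at its lowest eigenvalue, applied to the derivative of the ground
vector. As that derivative is orthogonal to the ground vector, the rank one part of `H(s)` drops out
and inverting the diagonal part is enough. -/
noncomputable def groundResponse (E : Bits n → ℝ) (s : ℝ) : RealQubits n :=
  diagonalResponse E s - (inner ℝ (groundVector E s) (diagonalResponse E s) : ℝ) • groundVector E s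

lemma contDiffOn_deriv_groundVector :
    ContDiffOn ℝ (⊤ : ℕ∞) (deriv (groundVector E)) (Set.Ioo 0 1) :=
  ((contDiffOn_infty_iff_deriv_of_isOpen isOpen_Ioo).1 contDiffOn_groundVector).2

lemma contDiffOn_groundResponse : ContDiffOn ℝ (⊤ : ℕ∞) (groundResponse E) (Set.Ioo 0 1) := by
  have h : ContDiffOn ℝ (⊤ : ℕ∞) (diagonalResponse E) (Set.Ioo 0 1) := by
    rw [contDiffOn_euclidean]
    intro z
    refine ContDiffOn.mul (ContDiffOn.inv ((contDiffOn_id.mul contDiffOn_const).sub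
      contDiffOn_groundValue) fun s hs => (sub_groundValue_pos hs z).ne') ?_
    exact contDiffOn_euclidean.1 contDiffOn_deriv_groundVector z
  exact h.sub ((contDiffOn_groundVector.inner ℝ h).smul contDiffOn_groundVector)

/-- A derivative of a curve in the symmetric subspace lies in it. -/
lemma mem_realSymmetric_of_hasDerivAt {x : ℝ → RealQubits n} {x' : RealQubits n} {s : ℝ}
    (hx : HasDerivAt x x' s) (h : ∀ᶠ σ in 𝓝 s, x σ ∈ realSymmetric E) :
    x' ∈ realSymmetric E := by
  intro z z' hz
  have h1 := ((EuclideanSpace.proj z : RealQubits n →L[ℝ] ℝ).hasFDerivAt.comp_hasDerivAt s hx)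
  have h2 := ((EuclideanSpace.proj z' : RealQubits n →L[ℝ] ℝ).hasFDerivAt.comp_hasDerivAt s hx)
  refine h1.unique (h2.congr_of_eventuallyEq ?_)
  filter_upwards [h] with σ hσ
  exact hσ z z' hz

lemma hasDerivAt_groundVector {s : ℝ} (hs : s ∈ Set.Ioo (0 : ℝ) 1) :
    HasDerivAt (groundVector E) (deriv (groundVector E) s) s :=
  ((contDiffOn_groundVector.differentiableOn (by simp)).differentiableAt
    (isOpen_Ioo.mem_nhds hs)).hasDerivAt

lemma hasDerivAt_groundResponse {s : ℝ} (hs : s ∈ Set.Ioo (0 : ℝ) 1) :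
    HasDerivAt (groundResponse E) (deriv (groundResponse E) s) s :=
  ((contDiffOn_groundResponse.differentiableOn (by simp)).differentiableAt
    (isOpen_Ioo.mem_nhds hs)).hasDerivAt

lemma deriv_groundVector_mem {s : ℝ} (hs : s ∈ Set.Ioo (0 : ℝ) 1) :
    deriv (groundVector E) s ∈ realSymmetric E :=
  mem_realSymmetric_of_hasDerivAt (hasDerivAt_groundVector hs)
    (Eventually.of_forall fun σ => groundVector_mem σ)

lemma groundResponse_mem {s : ℝ} (hs : s ∈ Set.Ioo (0 : ℝ) 1) :
    groundResponse E s ∈ realSymmetric E := by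
  refine Submodule.sub_mem _ (fun z z' h => ?_) (Submodule.smul_mem _ _ (groundVector_mem s))
  simp only [diagonalResponse]
  rw [h, deriv_groundVector_mem hs z z' h]

lemma inner_groundVector_groundResponse (s : ℝ) :
    inner ℝ (groundVector E s) (groundResponse E s) = 0 := by
  rw [groundResponse, inner_sub_right, real_inner_smul_right, real_inner_self_eq_norm_sq,
    norm_groundVector, one_pow, mul_one, sub_self]

lemma inner_groundVector_deriv {s : ℝ} (hs : s ∈ Set.Ioo (0 : ℝ) 1) :
    inner ℝ (groundVector E s) (deriv (groundVector E) s) = 0 := by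
  have h1 := hasDerivAt_groundVector (E := E) hs
  have h3 := (h1.inner ℝ h1).unique
    ((hasDerivAt_const s (1 : ℝ)).congr_of_eventuallyEq (Eventually.of_forall fun τ => by
      dsimp only
      rw [real_inner_self_eq_norm_sq, norm_groundVector, one_pow]))
  rw [real_inner_comm (groundVector E s)] at h3
  linarith

lemma realOp_groundResponse {s : ℝ} (hs : s ∈ Set.Ioo (0 : ℝ) 1) :
    realOp E s (groundResponse E s) =
      groundValue E s • groundResponse E s + deriv (groundVector E) s := by
  have hort := inner_groundVector_deriv (E := E) hs
  have hsum : ∑ z, diagonalResponse E s z = 0 := by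
    have hu := norm_pos_iff.2 (depthVector_ne_zero (E := E) (inverseDepth E s))
    rw [groundVector, real_inner_smul_left, PiLp.inner_apply] at hort
    have h0 := (mul_eq_zero.1 hort).resolve_left (inv_pos.2 hu).ne'
    have h1 : ∑ z, diagonalResponse E s z = (s / inverseDepth E s)⁻¹ *
        ∑ z, inner ℝ (depthVector E (inverseDepth E s) z) (deriv (groundVector E) s z) := by
      rw [Finset.mul_sum]
      refine Finset.sum_congr rfl fun z _ => ?_
      simp only [diagonalResponse, sub_groundValue hs, depthVector_apply, RCLike.inner_apply,
        conj_trivial, mul_inv]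
      ring
    rw [h1, h0, mul_zero]
  have hd : realOp E s (diagonalResponse E s) =
      groundValue E s • diagonalResponse E s + deriv (groundVector E) s := by
    ext z
    have hz := sub_groundValue_pos (E := E) hs z
    rw [realOp_apply, hsum, PiLp.add_apply, PiLp.smul_apply, smul_eq_mul, mul_zero, mul_zero,
      sub_zero, ← sub_eq_iff_eq_add', ← sub_mul]
    simp only [diagonalResponse]
    rw [← mul_assoc, mul_inv_cancel₀ hz.ne', one_mul]
  rw [groundResponse, map_sub, map_smul, realOp_groundVector hs, hd, smul_sub, smul_comm]
  abel

/-- The bounds of perturbation theory for the ground vector of `H(s)`, in terms of any lower bound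
`g` on the gap. -/
theorem norm_groundVector_bounds {c s g : ℝ} (hE : IsProblemHamiltonian E c)
    (hs : s ∈ Set.Ioo (0 : ℝ) 1) (hg : 0 < g) (hgap : g ≤ adiabaticGap E s) :
    ‖deriv (groundVector E) s‖ ≤ 4 / g ∧ ‖groundResponse E s‖ ≤ 4 / g ^ 2 ∧
      ‖deriv (groundResponse E) s‖ ≤ 80 / g ^ 3 := by
  have hev : ∀ᶠ σ in 𝓝 s, σ ∈ Set.Ioo (0 : ℝ) 1 := isOpen_Ioo.mem_nhds hs
  have hφ₁ : HasDerivAt (deriv (groundVector E)) (deriv (deriv (groundVector E)) s) s :=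
    ((contDiffOn_deriv_groundVector.differentiableOn (by simp)).differentiableAt
      (isOpen_Ioo.mem_nhds hs)).hasDerivAt
  have hlam₁ : HasDerivAt (deriv (groundValue E)) (deriv (deriv (groundValue E)) s) s :=
    ((((contDiffOn_infty_iff_deriv_of_isOpen isOpen_Ioo).1
      contDiffOn_groundValue).2.differentiableOn (by simp)).differentiableAt
        (isOpen_Ioo.mem_nhds hs)).hasDerivAt
  exact norm_le_of_gap (H₀ := -meanOp n) (K := meanOp n + energyOp E) (U := realSymmetric E)
    (lam := groundValue E) hg (fun x y => isSymmetric_realOp (E := E) s x y)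
    (norm_meanOp_add_energyOp_le hE)
    (fun x hx hort => (mul_le_mul_of_nonneg_right hgap (sq_nonneg _)).trans
      (adiabaticGap_mul_le hs hx hort))
    (hev.mono fun σ hσ => hasDerivAt_groundVector hσ) hφ₁
    (hev.mono fun σ hσ => ((contDiffOn_groundValue.differentiableOn (by simp)).differentiableAt
      (isOpen_Ioo.mem_nhds hσ)).hasDerivAt) hlam₁
    (hasDerivAt_groundResponse hs)
    (hev.mono fun σ hσ => realOp_groundVector hσ)
    (Eventually.of_forall fun σ => norm_groundVector σ)
    (hev.mono fun σ hσ => realOp_groundResponse hσ)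
    (Eventually.of_forall fun σ => inner_groundVector_groundResponse σ)
    (groundVector_mem s) (deriv_groundVector_mem hs)
    (mem_realSymmetric_of_hasDerivAt hφ₁ (hev.mono fun σ hσ => deriv_groundVector_mem hσ))
    (groundResponse_mem hs)
    (mem_realSymmetric_of_hasDerivAt (hasDerivAt_groundResponse hs)
      (hev.mono fun σ hσ => groundResponse_mem hσ))

/-! ### Integrals of powers of the gap bound -/

lemma integral_affine_rpow_le {α β G q a b : ℝ} (hq : q < -1) (hβ : β ≠ 0) (hG : 0 < G)
    (hab : a ≤ b) (h : ∀ x ∈ Set.Icc a b, G ≤ α + β * x) :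
    ∫ x in a..b, (α + β * x) ^ q ≤ G ^ (q + 1) / ((-q - 1) * |β|) := by
  have hM : 0 < -q - 1 := by linarith
  have hpos : ∀ x ∈ Set.Icc a b, 0 < α + β * x := fun x hx => hG.trans_le (h x hx)
  have hd : ∀ x ∈ Set.uIcc a b,
      HasDerivAt (fun x => (α + β * x) ^ (q + 1) / ((q + 1) * β)) ((α + β * x) ^ q) x := by
    intro x hx
    rw [Set.uIcc_of_le hab] at hx
    have h1 : HasDerivAt (fun x => α + β * x) β x := by
      simpa using ((hasDerivAt_id x).const_mul β).const_add α
    have h2 := (h1.rpow_const (p := q + 1) (Or.inl (hpos x hx).ne')).div_const ((q + 1) * β)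
    refine h2.congr_deriv ?_
    have : q + 1 ≠ 0 := by linarith
    rw [add_sub_cancel_right]
    field_simp
  have hint : IntervalIntegrable (fun x => (α + β * x) ^ q) MeasureTheory.volume a b := by
    refine ContinuousOn.intervalIntegrable fun x hx => ?_
    rw [Set.uIcc_of_le hab] at hx
    have h1 : ContinuousAt (fun x => α + β * x) x := by fun_prop
    exact (h1.rpow_const (Or.inl (hpos x hx).ne')).continuousWithinAt
  rw [intervalIntegral.integral_eq_sub_of_hasDerivAt hd hint, ← sub_div]
  refine (le_abs_self _).trans ?_
  have e : |(q + 1) * β| = (-q - 1) * |β| := by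
    rw [abs_mul, abs_of_neg (by linarith : q + 1 < 0)]
    ring
  rw [abs_div, e]
  have hle : ∀ x ∈ Set.Icc a b, (α + β * x) ^ (q + 1) ≤ G ^ (q + 1) := fun x hx =>
    Real.rpow_le_rpow_of_nonpos hG (h x hx) (by linarith)
  have hnn : ∀ x ∈ Set.Icc a b, 0 ≤ (α + β * x) ^ (q + 1) := fun x hx =>
    Real.rpow_nonneg (hpos x hx).le _
  have ha : a ∈ Set.Icc a b := ⟨le_rfl, hab⟩
  have hb : b ∈ Set.Icc a b := ⟨hab, le_rfl⟩
  gcongr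
  rw [abs_le]
  constructor <;> linarith [hle a ha, hle b hb, hnn a ha, hnn b hb]

namespace IsProblemHamiltonian

lemma continuous_gapBound_rpow (hE : IsProblemHamiltonian E (11 / 500)) (q : ℝ) :
    Continuous fun x => gapBound E x ^ q :=
  hE.continuous_gapBound.rpow_const fun x => Or.inl (hE.gapBound_pos x).ne'

/-- For exponents below `-1` the integral is dominated by the neighbourhood of the crossing. -/
lemma integral_gapBound_rpow_le (hE : IsProblemHamiltonian E (11 / 500)) {q : ℝ} (hq : q < -1) :
    ∫ x in (0 : ℝ)..1, gapBound E x ^ q ≤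
      (minGap E / 10) ^ (q + 1) * ((leftSlope E)⁻¹ + (rightSlope E)⁻¹) * (1 / (-q - 1) + 1) := by
  have hL := hE.leftSlope_pos
  have hR := hE.rightSlope_pos
  have hδ := hE.crossingWidth_pos
  have hδ' := hE.crossingWidth_le
  have hc1 := hE.crossing_lt_one
  have hG : 0 < minGap E / 10 := div_pos hE.minGap_pos (by norm_num)
  have hii : ∀ a b, IntervalIntegrable (fun x => gapBound E x ^ q) MeasureTheory.volume a b :=
    fun a b => (hE.continuous_gapBound_rpow q).intervalIntegrable a b
  rw [← intervalIntegral.integral_add_adjacent_intervals (hii 0 (crossing E)) (hii _ 1),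
    ← intervalIntegral.integral_add_adjacent_intervals (hii 0 (crossing E - crossingWidth E))
      (hii _ (crossing E))]
  set G := minGap E / 10 with hGdef
  have hGq : G ^ (q + 1) = G ^ q * G := by rw [Real.rpow_add hG, Real.rpow_one]
  have i1 : ∫ x in (0 : ℝ)..(crossing E - crossingWidth E), gapBound E x ^ q ≤
      G ^ (q + 1) / ((-q - 1) * leftSlope E) := by
    have h := integral_affine_rpow_le (α := leftSlope E * crossing E) (β := -leftSlope E)
      (a := 0) (b := crossing E - crossingWidth E) hq (by linarith [hL]) hG (by linarith)
      (fun x hx => by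
        have := hE.le_gapBound x
        rw [hE.gapBound_of_le hx.2] at this
        linarith)
    rw [abs_neg, abs_of_pos hL] at h
    refine le_trans (le_of_eq (intervalIntegral.integral_congr fun x hx => ?_)) h
    rw [Set.uIcc_of_le (by linarith)] at hx
    simp only [hE.gapBound_of_le hx.2]
    ring_nf
  have i2 : ∫ x in (crossing E - crossingWidth E)..(crossing E), gapBound E x ^ q =
      G ^ (q + 1) / leftSlope E := by
    have h : ∫ x in (crossing E - crossingWidth E)..(crossing E), gapBound E x ^ q =
        ∫ _x in (crossing E - crossingWidth E)..(crossing E), G ^ q := by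
      refine intervalIntegral.integral_congr fun x hx => ?_
      rw [Set.uIcc_of_le (by linarith)] at hx
      simp only [hE.gapBound_of_mem hx.1 hx.2, hGdef]
    rw [h, intervalIntegral.integral_const, sub_sub_cancel, smul_eq_mul, hGq, eq_div_iff hL.ne',
      hGdef, ← hE.leftSlope_mul_crossingWidth]
    ring
  have i3 : ∫ x in (crossing E)..1, gapBound E x ^ q ≤
      G ^ (q + 1) / ((-q - 1) * rightSlope E) := by
    have h := integral_affine_rpow_le (α := G - rightSlope E * crossing E) (β := rightSlope E)
      (a := crossing E) (b := 1) hq hR.ne' hG hc1.le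
      (fun x hx => by
        have := hE.le_gapBound x
        rw [hE.gapBound_of_ge hx.1, ← hGdef] at this
        linarith)
    rw [abs_of_pos hR] at h
    refine le_trans (le_of_eq (intervalIntegral.integral_congr fun x hx => ?_)) h
    rw [Set.uIcc_of_le hc1.le] at hx
    simp only [hE.gapBound_of_ge hx.1, ← hGdef]
    ring_nf
  have h4 : 0 ≤ G ^ (q + 1) * (rightSlope E)⁻¹ := by positivity
  calc _ ≤ G ^ (q + 1) / ((-q - 1) * leftSlope E) + G ^ (q + 1) / leftSlope E +
        G ^ (q + 1) / ((-q - 1) * rightSlope E) + G ^ (q + 1) * (rightSlope E)⁻¹ := by linarith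
    _ = _ := by
      field_simp
      ring

/-! ### The schedule -/

/-- A gap-adapted schedule exists for every duration: it is the inverse of the strictly increasing
function `x ↦ (1 / v) ∫ y in 0..x, g₀ y ^ (-p)`. -/
lemma exists_schedule (hE : IsProblemHamiltonian E (11 / 500)) (p : ℝ) {T : ℝ} (hT : 0 < T) :
    ∃ s, IsGapAdaptedSchedule E p T s ∧ ∀ t ∈ Set.Icc 0 T, HasDerivWithinAt s
      ((∫ x in (0 : ℝ)..1, gapBound E x ^ (-p)) / T * gapBound E (s t) ^ p) (Set.Icc 0 T) t ∧
      s t ∈ Set.Icc (0 : ℝ) 1 := by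
  set I := ∫ x in (0 : ℝ)..1, gapBound E x ^ (-p) with hI
  have hcont := hE.continuous_gapBound_rpow (-p)
  have hpos : ∀ x, 0 < gapBound E x ^ (-p) := fun x => Real.rpow_pos_of_pos (hE.gapBound_pos x) _
  have hI0 : 0 < I := intervalIntegral.intervalIntegral_pos_of_pos
    (hcont.intervalIntegrable _ _) hpos one_pos
  have hv : 0 < I / T := div_pos hI0 hT
  set τ : ℝ → ℝ := fun x => (I / T)⁻¹ * ∫ y in (0 : ℝ)..x, gapBound E y ^ (-p) with hτ
  have hd : ∀ x, HasStrictDerivAt τ ((I / T)⁻¹ * gapBound E x ^ (-p)) x := fun x =>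
    (hcont.integral_hasStrictDerivAt 0 x).const_mul _
  have hd0 : ∀ x, 0 < (I / T)⁻¹ * gapBound E x ^ (-p) := fun x => mul_pos (inv_pos.2 hv) (hpos x)
  have hmono : StrictMono τ := strictMono_of_deriv_pos fun x => by
    rw [(hd x).hasDerivAt.deriv]
    exact hd0 x
  have hτc : Continuous τ := continuous_iff_continuousAt.2 fun x => (hd x).hasDerivAt.continuousAt
  have hτ0 : τ 0 = 0 := by simp [hτ]
  have hτ1 : τ 1 = T := by
    simp only [hτ, ← hI]
    field_simp
  set s := Function.invFun τ with hs
  have hinv : ∀ x, s (τ x) = x := Function.leftInverse_invFun hmono.injective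
  have hsurj : ∀ t ∈ Set.Icc 0 T, ∃ x ∈ Set.Icc (0 : ℝ) 1, τ x = t := fun t ht =>
    intermediate_value_Icc zero_le_one hτc.continuousOn (by rwa [hτ0, hτ1])
  have hderiv : ∀ t ∈ Set.Icc 0 T, HasDerivWithinAt s (I / T * gapBound E (s t) ^ p)
      (Set.Icc 0 T) t := by
    intro t ht
    obtain ⟨x, -, rfl⟩ := hsurj t ht
    have h := ((hd x).to_local_left_inverse (hd0 x).ne'
      (Eventually.of_forall hinv)).hasDerivAt.hasDerivWithinAt (s := Set.Icc 0 T)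
    rw [hinv]
    refine h.congr_deriv ?_
    rw [mul_inv, inv_inv, Real.rpow_neg (hE.gapBound_pos x).le, inv_inv]
  refine ⟨s, ⟨?_, ?_, ?_, I / T, hv, hderiv⟩, fun t ht => ⟨hderiv t ht, ?_⟩⟩
  · simpa only [hτ0] using hinv 0
  · rw [← hτ1, hinv]
  · intro t ht t' ht' htt'
    obtain ⟨x, -, rfl⟩ := hsurj t ht
    obtain ⟨x', -, rfl⟩ := hsurj t' ht'
    rw [hinv, hinv]
    exact hmono.le_iff_le.1 htt'
  · obtain ⟨x, hx, rfl⟩ := hsurj t ht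
    rwa [hinv]

end IsProblemHamiltonian

/-! ### The ground vector at the two ends of the schedule -/

lemma tendsto_groundVector {l : Filter ℝ} {v : RealQubits n} (hv : v ≠ 0)
    (h : Tendsto (fun s => depthVector E (inverseDepth E s)) l (𝓝 v)) :
    Tendsto (groundVector E) l (𝓝 (‖v‖⁻¹ • v)) :=
  (h.norm.inv₀ (norm_ne_zero_iff.2 hv)).smul h

lemma tendsto_inverseDepth_zero {c : ℝ} (hE : IsProblemHamiltonian E c) :
    Tendsto (inverseDepth E) (𝓝[>] 0) (𝓝 0) := by
  have hlim : Tendsto (fun s : ℝ => s / (1 - 2 * s)) (𝓝[>] 0) (𝓝 0) := by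
    have : ContinuousAt (fun s : ℝ => s / (1 - 2 * s)) 0 :=
      ContinuousAt.div (by fun_prop) (by fun_prop) (by norm_num)
    have h := this.tendsto.mono_left (nhdsWithin_le_nhds (s := Set.Ioi 0))
    simpa using h
  have hmem : ∀ᶠ s : ℝ in 𝓝[>] 0, s ∈ Set.Ioo (0 : ℝ) (1 / 2) :=
    Ioo_mem_nhdsGT (by norm_num)
  refine tendsto_of_tendsto_of_tendsto_of_le_of_le' tendsto_const_nhds hlim ?_ ?_
  · filter_upwards [hmem] with s hs
    exact (inverseDepth_pos ⟨hs.1, by linarith [hs.2]⟩).le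
  · filter_upwards [hmem] with s hs
    exact inverseDepth_le ⟨hs.1, by linarith [hs.2]⟩ hE hs.2

lemma tendsto_inverseDepth_one : Tendsto (inverseDepth E) (𝓝[<] 1) atTop := by
  have hlim : Tendsto (fun s : ℝ => s / (1 - s)) (𝓝[<] 1) atTop := by
    have h1 : Tendsto (fun s : ℝ => 1 - s) (𝓝[<] 1) (𝓝[>] 0) := by
      refine tendsto_nhdsWithin_of_tendsto_nhds_of_eventually_within _ ?_ ?_
      · have : Tendsto (fun s : ℝ => 1 - s) (𝓝 1) (𝓝 (1 - 1)) := by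
          exact (continuous_const.sub continuous_id).tendsto 1
        simpa using this.mono_left nhdsWithin_le_nhds
      · filter_upwards [self_mem_nhdsWithin] with s hs
        exact sub_pos.2 (Set.mem_Iio.1 hs)
    have h2 : Tendsto (fun s : ℝ => s) (𝓝[<] 1) (𝓝 1) := tendsto_id.mono_left nhdsWithin_le_nhds
    exact h2.pos_mul_atTop one_pos (tendsto_inv_nhdsGT_zero.comp h1)
  refine tendsto_atTop_mono' _ ?_ hlim
  filter_upwards [Ioo_mem_nhdsLT (zero_lt_one (α := ℝ))] with s hs
  exact le_inverseDepth hs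

lemma tendsto_complexify_groundVector_zero {c : ℝ} (hE : IsProblemHamiltonian E c) :
    Tendsto (fun s => complexify n (groundVector E s)) (𝓝[>] 0) (𝓝 (plusState n)) := by
  set v : RealQubits n := WithLp.toLp 2 fun _ => 1 with hv
  have hv0 : v ≠ 0 := fun h => by
    simpa [hv] using congrArg (fun v : RealQubits n => v fun _ => false) h
  have hd : Tendsto (fun s => depthVector E (inverseDepth E s)) (𝓝[>] 0) (𝓝 v) := by
    refine ((PiLp.continuous_toLp 2 _).tendsto _).comp (tendsto_pi_nhds.2 fun z => ?_)
    have h := ((tendsto_inverseDepth_zero hE).mul_const (E z - groundEnergy E)).const_add 1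
    simpa using h.inv₀ (by simp)
  have h := ((complexify n).continuous.tendsto _).comp (tendsto_groundVector hv0 hd)
  have e : complexify n (‖v‖⁻¹ • v) = plusState n := by
    ext z
    rw [complexify_apply, plusState_apply, EuclideanSpace.norm_eq]
    simp [hv]
  rwa [e] at h

lemma tendsto_complexify_groundVector_one :
    Tendsto (fun s => complexify n (groundVector E s)) (𝓝[<] 1) (𝓝 (groundState E)) := by
  set v : RealQubits n := WithLp.toLp 2 fun z => if E z = groundEnergy E then 1 else 0 with hv
  obtain ⟨z₀, hz₀⟩ := exists_eq_groundEnergy (E := E)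
  have hv0 : v ≠ 0 := fun h => by
    simpa [hv, hz₀] using congrArg (fun v : RealQubits n => v z₀) h
  have hd : Tendsto (fun s => depthVector E (inverseDepth E s)) (𝓝[<] 1) (𝓝 v) := by
    refine ((PiLp.continuous_toLp 2 _).tendsto _).comp (tendsto_pi_nhds.2 fun z => ?_)
    by_cases hz : E z = groundEnergy E
    · simp [hz]
    · rw [if_neg hz]
      have hpos : 0 < E z - groundEnergy E :=
        sub_pos.2 (lt_of_le_of_ne (groundEnergy_le z) (Ne.symm hz))
      exact tendsto_inv_atTop_zero.comp (tendsto_atTop_add_const_left _ 1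
        (tendsto_inverseDepth_one.atTop_mul_const hpos))
  have h := ((complexify n).continuous.tendsto _).comp (tendsto_groundVector hv0 hd)
  have e : complexify n (‖v‖⁻¹ • v) = groundState E := by
    have hn : ‖v‖ = √(degeneracy E (groundEnergy E) : ℝ) := by
      rw [EuclideanSpace.norm_eq]
      congr 1
      simp [hv, degeneracy]
    ext z
    rw [complexify_apply, PiLp.smul_apply, hn]
    simp only [hv, groundState, levelState]
    split_ifs <;> simp
  rwa [e] at h

/-! ### The fidelity at the end of the schedule -/

/-- The fidelity of `ψ` with the ground vector of `H(s)`. -/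
noncomputable def fidelity (E : Bits n → ℝ) (s : ℝ) (ψ : Qubits n) : ℝ :=
  ‖inner ℂ (complexify n (groundVector E s)) ψ‖ ^ 2

lemma rpow_mul_pow {g : ℝ} (hg : 0 < g) (q : ℝ) (k : ℕ) : g ^ (q + k) = g ^ q * g ^ k := by
  rw [Real.rpow_add hg, Real.rpow_natCast]

namespace IsProblemHamiltonian

/-- The loss of fidelity while `s` runs through an interval on which `g₀` is affine, so that the
speed of the schedule is differentiable. -/
lemma fidelity_ge_of_affine (hE : IsProblemHamiltonian E (11 / 500)) {p : ℝ}
    (hp : p ∈ Set.Ioo (1 : ℝ) 2) {T v : ℝ} {s : ℝ → ℝ} {ψ : ℝ → Qubits n} (hv : 0 < v)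
    (hs : ∀ t ∈ Set.Icc 0 T, HasDerivWithinAt s (v * gapBound E (s t) ^ p) (Set.Icc 0 T) t)
    (hψ : ∀ t ∈ Set.Icc 0 T,
      HasDerivWithinAt ψ (-Complex.I • adiabaticOp E (s t) (ψ t)) (Set.Icc 0 T) t)
    (nψ : ∀ t ∈ Set.Icc 0 T, ‖ψ t‖ = 1) {a b α β : ℝ} (hab : a ≤ b)
    (hsub : Set.Icc a b ⊆ Set.Icc 0 T) (hmem : ∀ t ∈ Set.Icc a b, s t ∈ Set.Ioo (0 : ℝ) 1)
    (hβ : |β| ≤ 1) (haff : ∀ t ∈ Set.Icc a b, gapBound E (s t) = α + β * s t) :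
    fidelity E (s a) (ψ a) - 16 * (v * (minGap E / 10) ^ (p - 2)) -
      208 * (v * ((∫ x in (0 : ℝ)..(s b), gapBound E x ^ (p - 3)) -
        ∫ x in (0 : ℝ)..(s a), gapBound E x ^ (p - 3))) ≤ fidelity E (s b) (ψ b) := by
  set P : ℝ → ℝ := fun σ => ∫ x in (0 : ℝ)..σ, gapBound E x ^ (p - 3) with hP
  set h : ℝ → ℝ := fun t => v * (α + β * s t) ^ p with hh
  have hpos : ∀ t ∈ Set.Icc a b, 0 < α + β * s t := fun t ht => by
    rw [← haff t ht]
    exact hE.gapBound_pos _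
  have hs' : ∀ t ∈ Set.Icc a b, HasDerivWithinAt s (h t) (Set.Icc a b) t := fun t ht => by
    have := (hs t (hsub ht)).mono hsub
    rwa [haff t ht] at this
  have bounds : ∀ t ∈ Set.Icc a b, _ := fun t ht => norm_groundVector_bounds (g := α + β * s t) hE
    (hmem t ht) (hpos t ht) (by
      rw [← haff t ht]
      exact hE.gapBound_le_adiabaticGap (Set.Ioo_subset_Icc_self (hmem t ht)))
  have p3 : ∀ t ∈ Set.Icc a b, (α + β * s t) ^ p = (α + β * s t) ^ (p - 3) * (α + β * s t) ^ 3 :=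
    fun t ht => by
      rw [← rpow_mul_pow (hpos t ht)]
      congr 1
      push_cast
      ring
  have p1 : ∀ t ∈ Set.Icc a b,
      (α + β * s t) ^ (p - 1) = (α + β * s t) ^ (p - 3) * (α + β * s t) ^ 2 := fun t ht => by
    rw [← rpow_mul_pow (hpos t ht)]
    congr 1
    push_cast
    ring
  have edge : ∀ t ∈ Set.Icc a b, h t * ‖complexify n (groundResponse E (s t))‖ ≤
      4 * (v * (minGap E / 10) ^ (p - 2)) := by
    intro t ht
    have hg := hpos t ht
    have hG : 0 < minGap E / 10 := div_pos hE.minGap_pos (by norm_num)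
    have h1 : (α + β * s t) ^ (p - 2) ≤ (minGap E / 10) ^ (p - 2) := by
      refine Real.rpow_le_rpow_of_nonpos hG ?_ (by linarith [hp.2])
      rw [← haff t ht]
      exact hE.le_gapBound _
    have h2 : (α + β * s t) ^ p = (α + β * s t) ^ (p - 2) * (α + β * s t) ^ 2 := by
      rw [← rpow_mul_pow hg]
      congr 1
      push_cast
      ring
    rw [norm_complexify, hh]
    calc v * (α + β * s t) ^ p * ‖groundResponse E (s t)‖
        ≤ v * (α + β * s t) ^ p * (4 / (α + β * s t) ^ 2) := by
          refine mul_le_mul_of_nonneg_left (bounds t ht).2.1 ?_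
          positivity
      _ = 4 * (v * (α + β * s t) ^ (p - 2)) := by
          rw [h2]
          field_simp
      _ ≤ _ := by gcongr
  have main := sq_norm_inner_ge_of_adiabatic (A := fun t => adiabaticOp E (s t)) (ψ := ψ)
    (φ := fun t => complexify n (groundVector E (s t)))
    (φ' := fun t => complexify n (deriv (groundVector E) (s t)))
    (χ := fun t => complexify n (groundResponse E (s t)))
    (χ' := fun t => complexify n (deriv (groundResponse E) (s t)))
    (h := h) (h' := fun t => v * (β * h t * p * (α + β * s t) ^ (p - 1)))
    (lam := fun t => groundValue E (s t))
    (Φ := fun t => 104 * v * P (s t))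
    (Φ' := fun t => 104 * v * (h t * gapBound E (s t) ^ (p - 3)))
    hab (fun t _ => isSymmetric_adiabaticOp _) (fun t ht => (hψ t (hsub ht)).mono hsub)
    (fun t ht => by
      have h1 := (hasDerivAt_groundVector (E := E) (hmem t ht)).scomp_hasDerivWithinAt t (hs' t ht)
      have h2 := (complexify n).hasFDerivAt.comp_hasDerivWithinAt t h1
      rwa [complexify_smul] at h2)
    (fun t ht => by
      have h1 := (hasDerivAt_groundResponse (E := E) (hmem t ht)).scomp_hasDerivWithinAt t
        (hs' t ht)
      have h2 := (complexify n).hasFDerivAt.comp_hasDerivWithinAt t h1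
      rwa [complexify_smul] at h2)
    (fun t ht => (((((hs' t ht).const_mul β).const_add α).rpow_const (p := p)
      (Or.inl (hpos t ht).ne')).const_mul v))
    (fun t ht => by
      have h1 : HasDerivAt P (gapBound E (s t) ^ (p - 3)) (s t) :=
        ((hE.continuous_gapBound_rpow (p - 3)).integral_hasStrictDerivAt 0 (s t)).hasDerivAt
      exact (h1.scomp_hasDerivWithinAt t (hs' t ht)).const_mul (104 * v))
    (fun t ht => by
      rw [adiabaticOp_complexify, realOp_groundVector (hmem t ht), complexify_smul])
    (fun t ht => by
      rw [adiabaticOp_complexify, realOp_groundResponse (hmem t ht), map_add, complexify_smul])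
    (fun t ht => (nψ t (hsub ht)).le) (fun t _ => by rw [norm_complexify, norm_groundVector])
    (fun t ht => by
      have := hpos t ht
      rw [hh]
      positivity)
    (fun t ht => by
      have hg := hpos t ht
      obtain ⟨b1, b2, b3⟩ := bounds t ht
      have hht : h t = v * ((α + β * s t) ^ (p - 3) * (α + β * s t) ^ 3) := by
        rw [← p3 t ht]
      have hht0 : 0 ≤ h t := by
        rw [hht]
        positivity
      have hp0 : 0 < p := by linarith [hp.1]
      simp only [norm_complexify]
      rw [haff t ht, p1 t ht]
      set g := α + β * s t with hgdef
      set Q := g ^ (p - 3) with hQ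
      have c1 : |v * (β * h t * p * (Q * g ^ 2))| ≤ 2 * v * h t * (Q * g ^ 2) := by
        rw [abs_mul, abs_of_pos hv, abs_mul, abs_mul, abs_mul, abs_of_nonneg hht0, abs_of_pos hp0,
          abs_of_pos (by positivity : 0 < Q * g ^ 2)]
        have : |β| * p ≤ 2 := by nlinarith [hp.2, abs_nonneg β]
        calc v * (|β| * h t * p * (Q * g ^ 2)) = |β| * p * (v * h t * (Q * g ^ 2)) := by ring
          _ ≤ 2 * (v * h t * (Q * g ^ 2)) := mul_le_mul_of_nonneg_right this (by positivity)
          _ = _ := by ring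
      calc |v * (β * h t * p * (Q * g ^ 2))| * ‖groundResponse E (s t)‖ + h t ^ 2 *
            (‖deriv (groundResponse E) (s t)‖ +
              ‖deriv (groundVector E) (s t)‖ * ‖groundResponse E (s t)‖)
          ≤ 2 * v * h t * (Q * g ^ 2) * (4 / g ^ 2) + h t ^ 2 *
            (80 / g ^ 3 + 4 / g * (4 / g ^ 2)) := by gcongr
        _ = 8 * v * h t * Q + h t * (v * (Q * g ^ 3)) * (96 / g ^ 3) := by
            rw [← hht]
            field_simp
            ring
        _ = 104 * v * (h t * Q) := by
            field_simp
            ring)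
  have ea := edge a ⟨le_rfl, hab⟩
  have eb := edge b ⟨hab, le_rfl⟩
  simp only [fidelity]
  linarith

/-- The total loss of fidelity over the whole schedule. -/
theorem fidelity_groundState_ge (hE : IsProblemHamiltonian E (11 / 500)) {p : ℝ}
    (hp : p ∈ Set.Ioo (1 : ℝ) 2) {T v : ℝ} {s : ℝ → ℝ} {ψ : ℝ → Qubits n} (hT : 0 < T)
    (hv : 0 < v)
    (hs : ∀ t ∈ Set.Icc 0 T, HasDerivWithinAt s (v * gapBound E (s t) ^ p) (Set.Icc 0 T) t)
    (hs0 : s 0 = 0) (hsT : s T = 1)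
    (hψ : IsEvolution E T s ψ) :
    1 - v * (48 * (minGap E / 10) ^ (p - 2) +
        208 * ∫ x in (0 : ℝ)..1, gapBound E x ^ (p - 3)) ≤
      ‖inner ℂ (groundState E) (ψ T)‖ ^ 2 := by
  set P : ℝ → ℝ := fun σ => ∫ x in (0 : ℝ)..σ, gapBound E x ^ (p - 3) with hP
  set G := (minGap E / 10) ^ (p - 2) with hG
  have nψ : ∀ t ∈ Set.Icc 0 T, ‖ψ t‖ = 1 := fun t ht => by
    rw [norm_eq_of_schrodinger (A := fun t => adiabaticOp E (s t)) (c := fun _ => 1)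
      (fun t _ => isSymmetric_adiabaticOp _) (by simpa using hψ.schrodinger) t ht, hψ.start,
      norm_plusState]
  have hsc : ContinuousOn s (Set.Icc 0 T) := fun t ht => (hs t ht).continuousWithinAt
  have hψc : ContinuousOn ψ (Set.Icc 0 T) := fun t ht => (hψ.schrodinger t ht).continuousWithinAt
  have hsm : StrictMonoOn s (Set.Icc 0 T) := by
    refine strictMonoOn_of_hasDerivWithinAt_pos (f' := fun t => v * gapBound E (s t) ^ p)
      (convex_Icc 0 T) hsc (fun t ht => (hs t (interior_subset ht)).mono interior_subset)
      fun t ht => ?_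
    exact mul_pos hv (Real.rpow_pos_of_pos (hE.gapBound_pos _) _)
  have h0 : (0 : ℝ) ∈ Set.Icc 0 T := ⟨le_rfl, hT.le⟩
  have hTm : T ∈ Set.Icc 0 T := ⟨hT.le, le_rfl⟩
  have hδ := hE.crossingWidth_pos
  have hδ' := hE.crossingWidth_le
  have hc := hE.crossing_pos
  have hc1 := hE.crossing_lt_one
  have hmem : ∀ t ∈ Set.Ioo 0 T, s t ∈ Set.Ioo (0 : ℝ) 1 := fun t ht => by
    have ht' := Set.Ioo_subset_Icc_self ht
    exact ⟨hs0 ▸ hsm h0 ht' ht.1, hsT ▸ hsm ht' hTm ht.2⟩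
  -- The times at which the schedule enters and leaves the window at the crossing.
  have hivt : ∀ c ∈ Set.Ioo (0 : ℝ) 1, ∃ t ∈ Set.Ioo 0 T, s t = c := fun c hc =>
    intermediate_value_Ioo hT.le hsc (by rwa [hs0, hsT])
  obtain ⟨t₁, ht₁, hst₁⟩ := hivt (crossing E - crossingWidth E) ⟨by linarith, by linarith⟩
  obtain ⟨t₂, ht₂, hst₂⟩ := hivt (crossing E) ⟨hc, hc1⟩
  have h12 : t₁ < t₂ := (hsm.lt_iff_lt (Set.Ioo_subset_Icc_self ht₁)
    (Set.Ioo_subset_Icc_self ht₂)).1 (by linarith)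
  have step : ∀ a b α β : ℝ, 0 < a → b < T → a ≤ b → |β| ≤ 1 →
      (∀ x ∈ Set.Icc (s a) (s b), gapBound E x = α + β * x) →
      fidelity E (s a) (ψ a) - 16 * (v * G) - 208 * (v * (P (s b) - P (s a))) ≤
        fidelity E (s b) (ψ b) := by
    intro a b α β ha hb hab hβ haff
    have hsub : Set.Icc a b ⊆ Set.Icc 0 T := Set.Icc_subset_Icc ha.le hb.le
    refine hE.fidelity_ge_of_affine hp hv hs hψ.schrodinger nψ hab hsub
      (fun t ht => hmem t ⟨ha.trans_le ht.1, ht.2.trans_lt hb⟩) hβ fun t ht => haff _ ?_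
    exact ⟨hsm.monotoneOn (hsub ⟨le_rfl, hab⟩) (hsub ht) ht.1,
      hsm.monotoneOn (hsub ht) (hsub ⟨hab, le_rfl⟩) ht.2⟩
  have hinner : ∀ a ∈ Set.Ioo 0 t₁, ∀ b ∈ Set.Ioo t₂ T,
      fidelity E (s a) (ψ a) - v * (48 * G + 208 * (P (s b) - P (s a))) ≤
        fidelity E (s b) (ψ b) := by
    intro a ha b hb
    have e1 := step a t₁ (leftSlope E * crossing E) (-leftSlope E) ha.1 ht₁.2 ha.2.le
      (by rw [abs_neg, abs_of_pos hE.leftSlope_pos]; exact hE.leftSlope_le_one) (fun x hx => by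
        rw [hE.gapBound_of_le (hst₁ ▸ hx.2)]
        ring)
    have e2 := step t₁ t₂ (minGap E / 10) 0 ht₁.1 ht₂.2 h12.le (by simp) (fun x hx => by
        rw [hE.gapBound_of_mem (hst₁ ▸ hx.1) (hst₂ ▸ hx.2)]
        ring)
    have e3 := step t₂ b (minGap E / 10 - rightSlope E * crossing E) (rightSlope E) ht₂.1 hb.2
      hb.1.le (by rw [abs_of_pos hE.rightSlope_pos]; exact hE.rightSlope_le_one) (fun x hx => by
        rw [hE.gapBound_of_ge (hst₂ ▸ hx.1)]
        ring)
    linarith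
  -- The limits at the two ends.
  have hPc : Continuous P := continuous_iff_continuousAt.2 fun x =>
    ((hE.continuous_gapBound_rpow (p - 3)).integral_hasStrictDerivAt 0 x).hasDerivAt.continuousAt
  have hst0 : Tendsto s (𝓝[Set.Ioo 0 T] 0) (𝓝[>] 0) := by
    refine tendsto_nhdsWithin_of_tendsto_nhds_of_eventually_within _ ?_ ?_
    · have := ((hsc 0 h0).mono Set.Ioo_subset_Icc_self).tendsto
      rwa [hs0] at this
    · filter_upwards [self_mem_nhdsWithin] with t ht
      exact (hmem t ht).1
  have hstT : Tendsto s (𝓝[Set.Ioo 0 T] T) (𝓝[<] 1) := by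
    refine tendsto_nhdsWithin_of_tendsto_nhds_of_eventually_within _ ?_ ?_
    · have := ((hsc T hTm).mono Set.Ioo_subset_Icc_self).tendsto
      rwa [hsT] at this
    · filter_upwards [self_mem_nhdsWithin] with t ht
      exact (hmem t ht).2
  have lim0 : Tendsto (fun t => fidelity E (s t) (ψ t)) (𝓝[Set.Ioo 0 T] 0) (𝓝 1) := by
    have h1 := (tendsto_complexify_groundVector_zero hE).comp hst0
    have h2 := ((hψc 0 h0).mono Set.Ioo_subset_Icc_self).tendsto
    have h3 := ((h1.inner (𝕜 := ℂ) h2).norm).pow 2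
    have e : ‖inner ℂ (plusState n) (ψ 0)‖ ^ 2 = 1 := by
      rw [hψ.start, inner_self_eq_norm_sq_to_K, norm_plusState]
      simp
    rwa [e] at h3
  have limT : Tendsto (fun t => fidelity E (s t) (ψ t)) (𝓝[Set.Ioo 0 T] T)
      (𝓝 (‖inner ℂ (groundState E) (ψ T)‖ ^ 2)) := by
    have h1 := (tendsto_complexify_groundVector_one (E := E)).comp hstT
    have h2 := ((hψc T hTm).mono Set.Ioo_subset_Icc_self).tendsto
    exact ((h1.inner (𝕜 := ℂ) h2).norm).pow 2
  have limP : ∀ t ∈ Set.Icc 0 T, Tendsto (fun τ => P (s τ)) (𝓝[Set.Ioo 0 T] t) (𝓝 (P (s t))) :=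
    fun t ht => (hPc.tendsto _).comp ((hsc t ht).mono Set.Ioo_subset_Icc_self).tendsto
  have hP0 : P (s 0) = 0 := by simp [hP, hs0]
  have hP1 : P (s T) = P 1 := by rw [hsT]
  have ne0 : (𝓝[Set.Ioo 0 T] (0 : ℝ)).NeBot := left_nhdsWithin_Ioo_neBot hT
  have neT : (𝓝[Set.Ioo 0 T] T).NeBot := right_nhdsWithin_Ioo_neBot hT
  have first : ∀ b ∈ Set.Ioo t₂ T, 1 - v * (48 * G + 208 * (P (s b) - P (s 0))) ≤
      fidelity E (s b) (ψ b) := by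
    intro b hb
    refine le_of_tendsto (lim0.sub ((((limP 0 h0).const_sub (P (s b))).const_mul 208).const_add
      (48 * G) |>.const_mul v)) ?_
    filter_upwards [self_mem_nhdsWithin, nhdsWithin_le_nhds (Iio_mem_nhds ht₁.1)] with a ha ha'
    exact hinner a ⟨ha.1, ha'⟩ b hb
  have second : 1 - v * (48 * G + 208 * (P (s T) - P (s 0))) ≤
      ‖inner ℂ (groundState E) (ψ T)‖ ^ 2 := by
    refine le_of_tendsto_of_tendsto (((((limP T hTm).sub_const (P (s 0))).const_mul 208).const_add
      (48 * G) |>.const_mul v).const_sub 1) limT ?_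
    filter_upwards [self_mem_nhdsWithin, nhdsWithin_le_nhds (Ioi_mem_nhds ht₂.2)] with b hb hb'
    exact first b ⟨hb', hb.2⟩
  rwa [hP0, hP1, sub_zero] at second

end IsProblemHamiltonian

lemma exists_evolution {T : ℝ} {s : ℝ → ℝ}
    (hT : 0 ≤ T) (hsc : ContinuousOn s (Set.Icc 0 T))
    (hsm : ∀ t ∈ Set.Icc 0 T, s t ∈ Set.Icc (0 : ℝ) 1) :
    ∃ ψ : ℝ → Qubits n, IsEvolution E T s ψ := by
  set A₀ := LinearMap.toContinuousLinearMap (adiabaticOp E 0) with hA₀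
  set A₁ := LinearMap.toContinuousLinearMap (adiabaticOp E 1) with hA₁
  have hA : ∀ (σ : ℝ) x, adiabaticOp E σ x = A₀ x + (σ : ℂ) • (A₁ x - A₀ x) := by
    intro σ x
    ext z
    simp only [hA₀, hA₁, LinearMap.coe_toContinuousLinearMap', PiLp.add_apply, PiLp.smul_apply,
      PiLp.sub_apply, adiabaticOp_apply, smul_eq_mul, Complex.ofReal_zero, Complex.ofReal_one]
    ring
  obtain ⟨ψ, h0, hψ⟩ := exists_schrodinger (A := fun t => adiabaticOp E (s t)) (T := T)
    (K := ‖A₀‖ + ‖A₁ - A₀‖) hT (by positivity) (fun t _ => isSymmetric_adiabaticOp _)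
    (fun t ht x => by
      rw [hA, add_mul]
      refine (norm_add_le _ _).trans (add_le_add (A₀.le_opNorm x) ?_)
      rw [norm_smul, Complex.norm_real, Real.norm_eq_abs, abs_of_nonneg (hsm t ht).1]
      exact (mul_le_of_le_one_left (norm_nonneg _) (hsm t ht).2).trans ((A₁ - A₀).le_opNorm x))
    (fun x => by
      simp only [hA]
      exact continuousOn_const.add ((Complex.continuous_ofReal.comp_continuousOn hsc).smul
        continuousOn_const))
    (norm_plusState (n := n))
  exact ⟨ψ, h0, hψ⟩

/-! ### The running time -/

/-- The running time without the factor `1 / ε` and the constant. -/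
noncomputable def timeScale (E : Bits n → ℝ) : ℝ :=
  √(spectralParam E 2) / (spectralParam E 1 ^ 2 * problemGap E ^ 2) *
    √((2 : ℝ) ^ n / (groundDegeneracy E : ℝ))

/-- The constant of the running time. It blows up at `p = 1` and at `p = 2`, where the two integrals
of powers of `g₀` become logarithmic. -/
noncomputable def timeConstant (p : ℝ) : ℝ :=
  2025 * (45 / 4) * ((1 / (p - 1) + 1) * (48 + 208 * (1 / (2 - p) + 1)))

lemma timeConstant_pos {p : ℝ} (hp : p ∈ Set.Ioo (1 : ℝ) 2) : 0 < timeConstant p := by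
  have h1 : 0 < p - 1 := sub_pos.2 hp.1
  have h2 : 0 < 2 - p := sub_pos.2 hp.2
  unfold timeConstant
  positivity

namespace IsProblemHamiltonian

lemma timeScale_pos (hE : IsProblemHamiltonian E (11 / 500)) : 0 < timeScale E := by
  have h1 := hE.spectralParam_pos 1
  have h2 := hE.spectralParam_pos 2
  have hg := hE.problemGap_pos
  have hd : (0 : ℝ) < groundDegeneracy E := by exact_mod_cast groundDegeneracy_pos
  unfold timeScale
  positivity

lemma inv_crossingScale (hE : IsProblemHamiltonian E (11 / 500)) : (crossingScale E)⁻¹ =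
    √(spectralParam E 2) * √((2 : ℝ) ^ n / (groundDegeneracy E : ℝ)) := by
  have h2 := hE.spectralParam_pos 2
  rw [crossingScale, ← Real.sqrt_inv, ← Real.sqrt_mul h2.le, groundWeight]
  congr 1
  rw [inv_div, div_div_eq_mul_div, mul_div_assoc]

/-- The loss of fidelity is inversely proportional to the duration. -/
lemma loss_le (hE : IsProblemHamiltonian E (11 / 500)) {p : ℝ} (hp : p ∈ Set.Ioo (1 : ℝ) 2) :
    (∫ x in (0 : ℝ)..1, gapBound E x ^ (-p)) * (48 * (minGap E / 10) ^ (p - 2) +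
      208 * ∫ x in (0 : ℝ)..1, gapBound E x ^ (p - 3)) ≤ timeConstant p * timeScale E := by
  have hL := hE.leftSlope_pos
  have hR := hE.rightSlope_pos
  have hk := hE.crossingScale_pos
  have hp1 : 0 < p - 1 := sub_pos.2 hp.1
  have hp2 : 0 < 2 - p := sub_pos.2 hp.2
  have hG : 0 < minGap E / 10 := div_pos hE.minGap_pos (by norm_num)
  have hI := hE.integral_gapBound_rpow_le (q := -p) (by linarith [hp.1])
  have hJ := hE.integral_gapBound_rpow_le (q := p - 3) (by linarith [hp.2])
  rw [show -p + 1 = 1 - p by ring, show -(-p) - 1 = p - 1 by ring] at hI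
  rw [show p - 3 + 1 = p - 2 by ring, show -(p - 3) - 1 = 2 - p by ring] at hJ
  have hW : (leftSlope E)⁻¹ + (rightSlope E)⁻¹ ≤ 45 / (problemGap E * spectralParam E 1) := by
    have := add_le_add hE.inv_leftSlope_le hE.inv_rightSlope_le
    refine this.trans (le_of_eq ?_)
    ring
  have hW1 : 1 ≤ (leftSlope E)⁻¹ + (rightSlope E)⁻¹ := by
    have := one_le_inv_iff₀.2 ⟨hL, hE.leftSlope_le_one⟩
    have := inv_pos.2 hR
    linarith
  set W := (leftSlope E)⁻¹ + (rightSlope E)⁻¹ with hWdef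
  set G := minGap E / 10 with hGdef
  have hGinv : G ^ (1 - p) * G ^ (p - 2) = G⁻¹ := by
    rw [← Real.rpow_add hG, ← Real.rpow_neg_one]
    congr 1
    ring
  have hGk : G⁻¹ ≤ 45 / 4 * (crossingScale E)⁻¹ := by
    have hc := hE.four_ninths_le_crossing
    rw [← inv_inv (45 / 4 : ℝ), ← mul_inv]
    refine inv_anti₀ (by positivity) ?_
    rw [hGdef, minGap_eq_crossing]
    nlinarith [mul_le_mul_of_nonneg_right hc hk.le]
  have hGp : 0 < G ^ (p - 2) := Real.rpow_pos_of_pos hG _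
  have hJ0 : 0 ≤ ∫ x in (0 : ℝ)..1, gapBound E x ^ (p - 3) :=
    intervalIntegral.integral_nonneg zero_le_one fun x _ =>
      (Real.rpow_pos_of_pos (hE.gapBound_pos x) _).le
  have hsum : 48 * G ^ (p - 2) + 208 * ∫ x in (0 : ℝ)..1, gapBound E x ^ (p - 3) ≤
      G ^ (p - 2) * W * (48 + 208 * (1 / (2 - p) + 1)) := by
    have := mul_le_mul_of_nonneg_left hW1 hGp.le
    linarith
  calc _ ≤ G ^ (1 - p) * W * (1 / (p - 1) + 1) *
        (G ^ (p - 2) * W * (48 + 208 * (1 / (2 - p) + 1))) :=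
        mul_le_mul hI hsum (by positivity) (by positivity)
    _ = G ^ (1 - p) * G ^ (p - 2) * W ^ 2 *
        ((1 / (p - 1) + 1) * (48 + 208 * (1 / (2 - p) + 1))) := by ring
    _ ≤ 45 / 4 * (crossingScale E)⁻¹ * (45 / (problemGap E * spectralParam E 1)) ^ 2 *
        ((1 / (p - 1) + 1) * (48 + 208 * (1 / (2 - p) + 1))) := by
        rw [hGinv]
        gcongr
    _ = timeConstant p * timeScale E := by
        rw [hE.inv_crossingScale, timeConstant, timeScale]
        field_simp
        ring

/-- Adiabatic evolution succeeds in time `timeConstant p * (1 / ε) * timeScale E`. -/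
theorem preparesGroundState (hE : IsProblemHamiltonian E (11 / 500)) {p ε : ℝ}
    (hp : p ∈ Set.Ioo (1 : ℝ) 2) (hε : 0 < ε) :
    0 < timeConstant p * (1 / ε * timeScale E) ∧
      PreparesGroundState E p ε (timeConstant p * (1 / ε * timeScale E)) := by
  have hT : 0 < timeConstant p * (1 / ε * timeScale E) :=
    mul_pos (timeConstant_pos hp) (mul_pos (by positivity) hE.timeScale_pos)
  set T := timeConstant p * (1 / ε * timeScale E) with hTdef
  refine ⟨hT, ?_⟩
  obtain ⟨s, hs, hs'⟩ := hE.exists_schedule p hT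
  refine ⟨s, hs, exists_evolution hT.le (fun t ht => (hs' t ht).1.continuousWithinAt)
    fun t ht => (hs' t ht).2, fun ψ hψ => ?_⟩
  have hv : 0 < (∫ x in (0 : ℝ)..1, gapBound E x ^ (-p)) / T :=
    div_pos (intervalIntegral.intervalIntegral_pos_of_pos
      ((hE.continuous_gapBound_rpow (-p)).intervalIntegrable _ _)
      (fun x => Real.rpow_pos_of_pos (hE.gapBound_pos x) _) one_pos) hT
  refine le_trans (sub_le_sub_left ?_ 1) (hE.fidelity_groundState_ge hp hT hv
    (fun t ht => (hs' t ht).1) hs.start hs.finish hψ)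
  rw [div_mul_eq_mul_div, div_le_iff₀ hT]
  refine (hE.loss_le hp).trans (le_of_eq ?_)
  rw [hTdef]
  field_simp

/-- With a polynomial bound on `1 / Δ`, the spectral parameters contribute only polynomial
factors. -/
lemma timeScale_le (hE : IsProblemHamiltonian E (11 / 500)) {b : ℝ}
    (hb : 1 ≤ b * problemGap E) :
    timeScale E ≤ 2 * b ^ 3 * √((2 : ℝ) ^ n / (groundDegeneracy E : ℝ)) := by
  have h1 := hE.le_spectralParam_one
  have hg := hE.problemGap_pos
  have hA := hE.spectralParam_succ_mul_gap_le 1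
  have hA' := hE.spectralParam_succ_mul_gap_le 0
  rw [spectralParam_zero] at hA'
  norm_num at hA hA'
  have hw := groundWeight_pos (E := E)
  have hbΔ : (problemGap E)⁻¹ ≤ b := by
    rw [inv_eq_one_div, div_le_iff₀ hg]
    exact hb
  have hsq : √(spectralParam E 2) ≤ (problemGap E)⁻¹ := by
    rw [← Real.sqrt_sq (inv_pos.2 hg).le]
    refine Real.sqrt_le_sqrt ?_
    rw [inv_pow, ← one_div, le_div_iff₀ (by positivity)]
    nlinarith
  refine mul_le_mul_of_nonneg_right ?_ (Real.sqrt_nonneg _)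
  calc √(spectralParam E 2) / (spectralParam E 1 ^ 2 * problemGap E ^ 2)
      ≤ (problemGap E)⁻¹ / (1 / 2 * problemGap E ^ 2) := by
        gcongr
        nlinarith
    _ = 2 * (problemGap E)⁻¹ ^ 3 := by
        field_simp
    _ ≤ 2 * b ^ 3 := by gcongr

end IsProblemHamiltonian

/-- At positive integers a polynomial is dominated by a monomial. -/
lemma exists_eval_natCast_le (q : Polynomial ℝ) :
    ∃ c : ℝ, 0 < c ∧ ∀ n : ℕ, 1 ≤ n → q.eval (n : ℝ) ≤ c * (n : ℝ) ^ q.natDegree := by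
  refine ⟨∑ i ∈ Finset.range (q.natDegree + 1), |q.coeff i| + 1,
    add_pos_of_nonneg_of_pos (Finset.sum_nonneg fun _ _ => abs_nonneg _) one_pos, fun n hn => ?_⟩
  have hn' : (1 : ℝ) ≤ n := by exact_mod_cast hn
  rw [Polynomial.eval_eq_sum_range, add_mul, Finset.sum_mul]
  refine (Finset.sum_le_sum fun i hi => ?_).trans (le_add_of_nonneg_right (by positivity))
  exact mul_le_mul (le_abs_self _)
    (pow_le_pow_right₀ hn' (Nat.lt_succ_iff.1 (Finset.mem_range.1 hi))) (by positivity)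
    (abs_nonneg _)

end AQO

theorem theorem1 (p : ℝ) (hp : p ∈ Set.Ioo (1 : ℝ) 2) :
    (∃ C : ℝ, 0 < C ∧
      ∀ (n : ℕ) (E : AQO.Bits n → ℝ), AQO.IsProblemHamiltonian E (11 / 500) →
        (∀ s ∈ Set.Icc (0 : ℝ) 1,
          0 < AQO.gapBound E s ∧ AQO.gapBound E s ≤ AQO.adiabaticGap E s) ∧
        ∀ ε ∈ Set.Ioo (0 : ℝ) 1, ∃ T : ℝ, 0 < T ∧
          T ≤ C * ((1 / ε) *
            (√(AQO.spectralParam E 2) / (AQO.spectralParam E 1 ^ 2 * AQO.problemGap E ^ 2)) *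
            √((2 : ℝ) ^ n / (AQO.groundDegeneracy E : ℝ))) ∧
          AQO.PreparesGroundState E p ε T) ∧
    (∀ (m : ℕ) (q : Polynomial ℝ), ∃ (C : ℝ) (k : ℕ), 0 < C ∧
      ∀ (n : ℕ) (E : AQO.Bits n → ℝ), AQO.IsProblemHamiltonian E (11 / 500) →
        AQO.IsNormalizedIsing m E → 1 ≤ q.eval (n : ℝ) * AQO.problemGap E →
        ∀ ε ∈ Set.Ioo (0 : ℝ) 1, ∃ T : ℝ, 0 < T ∧
          T ≤ C * ((1 / ε) * (n : ℝ) ^ k * √((2 : ℝ) ^ n / (AQO.groundDegeneracy E : ℝ))) ∧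
          AQO.PreparesGroundState E p ε T) := by
  have hC := AQO.timeConstant_pos hp
  refine ⟨⟨AQO.timeConstant p, hC, fun n E hE => ⟨fun s hs =>
    ⟨hE.gapBound_pos s, hE.gapBound_le_adiabaticGap hs⟩, fun ε hε => ?_⟩⟩, fun m q => ?_⟩
  · obtain ⟨hT, h⟩ := hE.preparesGroundState hp hε.1
    refine ⟨_, hT, le_of_eq ?_, h⟩
    rw [AQO.timeScale, mul_assoc (1 / ε)]
  · obtain ⟨c, hc, hq⟩ := AQO.exists_eval_natCast_le q
    refine ⟨AQO.timeConstant p * (2 * c ^ 3), q.natDegree * 3, by positivity,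
      fun n E hE _ hqE ε hε => ?_⟩
    obtain ⟨hT, h⟩ := hE.preparesGroundState hp hε.1
    refine ⟨_, hT, ?_, h⟩
    have hn : 1 ≤ n := by
      -- With no qubits there is only one level.
      rcases Nat.eq_zero_or_pos n with rfl | hn
      · have h2 := hE.two_le_card_levels
        have h3 : (AQO.levels E).card ≤ 1 := Finset.card_image_le.trans (by simp)
        omega
      · exact hn
    have hε0 := hε.1
    have hb : 1 ≤ c * (n : ℝ) ^ q.natDegree * AQO.problemGap E :=
      hqE.trans (mul_le_mul_of_nonneg_right (hq n hn) hE.problemGap_pos.le)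
    have h4 := hE.timeScale_le hb
    calc AQO.timeConstant p * (1 / ε * AQO.timeScale E)
        ≤ AQO.timeConstant p * (1 / ε * (2 * (c * (n : ℝ) ^ q.natDegree) ^ 3 *
          √((2 : ℝ) ^ n / (AQO.groundDegeneracy E : ℝ)))) := by gcongr
      _ = _ := by
        rw [mul_pow, ← pow_mul]
        ring
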